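/- \textbf{Conventions.} All functions are defined on $(0,\infty)$; $0\cdot\infty=0/0=\infty/\infty=0$. A \emph{weight} is a non-negative measurable function $v$ on $(0,\infty)$ with $0<\int_0^x v(t)\,dt<\infty$ for all $x>0$. For weights $b$ and $v$ put $B(x)=\int_0^x b(t)\,dt$, $V(x)=\int_0^x v(t)\,dt$. For $1<p<\infty$ let $p'=p/(p-1)$, and for $q<p$ let $\frac1r=\frac1q-\frac1p$. The weighted Hardy operator is $(P_{u,b}f)(t)=\frac{u(t)}{B(t)}\int_0^t f(\tau)b(\tau)\,d\tau$. Let $\mathfrak M^{+,\downarrow}$ be the set of non-negative measurable non-increasing functions on $(0,\infty)$. \textbf{Theorem.} Let $1<p,q<\infty$. There is a constant $C\in(0,\infty)$ depending only on $p$ and $q$ such that the following holds for all weights $a,b,u,v,w$ on $(0,\infty)$ with $b(t)>0$ for a.e. $t$ and with $u$ continuous on $(0,\infty)$. Let $$N=\sup_{f\in\mathfrak M^{+,\downarrow}}\frac{\Big(\int_0^\infty\Big(\int_0^x (P_{u,b}f)(t)\,a(t)\,dt\Big)^q w(x)\,dx\Big)^{1/q}}{\Big(\int_0^\infty f(s)^p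 v(s)\,ds\Big)^{1/p}}\in[0,\infty]$$ be the norm of $P_{u,b}$ from $L^p(v)$ into $\mathrm{Ces}_q(w,a)$ on non-increasing functions, where $\|g\|_{\mathrm{Ces}_q(w,a)}=\big(\int_0^\infty(\int_0^x g\,a)^q w(x)\,dx\big)^{1/q}$. (i) If $p\le q$, then $C^{-1}S\le N\le C S$, where $$\begin{aligned} S={}&\sup_{x>0}\Big(\int_0^x\Big(\int_0^t a(y)u(y)\,dy\Big)^q w(t)\,dt\Big)^{\frac1q}\Big(\int_x^\infty V(s)^{-p'}v(s)\,ds\Big)^{\frac1{p'}}\\ &+\sup_{x>0}\Big(\int_x^\infty w(t)\,dt\Big)^{\frac1q}\Big(\int_0^x\Big(\int_0^s a(y)u(y)\,dy\Big)^{p'}V(s)^{-p'}v(s)\,ds\Big)^{\frac1{p'}}\\ &+\sup_{x>0}\Big(\int_x^\infty\Big(\int_x^t\frac{a(\tau)}{B(\tau)}u(\tau)\,d\tau\Big)^q w(t)\,dt\Big)^{\frac1q}\Big(\int_0^x\Big(\frac{B(s)}{V(s)}\Big)^{p'}v(s)\,ds\Big)^{\frac1{p'}}\\ &+\sup_{x>0}\Big(\int_x^\infty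 w(t)\,dt\Big)^{\frac1q}\Big(\int_0^x\Big(\int_s^x\frac{a(\tau)}{B(\tau)}u(\tau)\,d\tau\Big)^{p'}\Big(\frac{B(s)}{V(s)}\Big)^{p'}v(s)\,ds\Big)^{\frac1{p'}}\\ &+\Big(\int_0^\infty v(s)\,ds\Big)^{-\frac1p}\Big(\int_0^\infty\Big(\int_0^x a(t)u(t)\,dt\Big)^q w(x)\,dx\Big)^{\frac1q}. \end{aligned}$$ (ii) If $q<p$, then $C^{-1}I\le N\le C I$, where $$\begin{aligned} I={}&\Big(\int_0^\infty\Big(\int_0^x\Big(\int_0^t a(y)u(y)\,dy\Big)^q w(t)\,dt\Big)^{\frac rp}\Big(\int_x^\infty V(z)^{-p'}v(z)\,dz\Big)^{\frac r{p'}}\Big(\int_0^x a(y)u(y)\,dy\Big)^q w(x)\,dx\Big)^{\frac1r}\\ &+\Big(\int_0^\infty\Big(\int_x^\infty w(t)\,dt\Big)^{\frac rp}\Big(\int_0^x\Big(\int_0^z a(y)u(y)\,dy\Big)^{p'}V(z)^{-p'}v(z)\,dz\Big)^{\frac r{p'}}w(x)\,dx\Big)^{\frac1r}\\ &+\Big(\int_0^\infty\Big(\int_x^\infty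 w(t)\,dt\Big)^{\frac rp}\Big(\int_0^x\Big(\int_z^x\frac{a(\tau)}{B(\tau)}u(\tau)\,d\tau\Big)^{p'}\Big(\frac{B(z)}{V(z)}\Big)^{p'}v(z)\,dz\Big)^{\frac r{p'}}w(x)\,dx\Big)^{\frac1r}\\ &+\Big(\int_0^\infty\Big(\int_x^\infty w(t)\Big(\int_x^t\frac{a(\tau)}{B(\tau)}u(\tau)\,d\tau\Big)^q dt\Big)^{\frac rq}\Big(\int_0^x\Big(\frac{B(s)}{V(s)}\Big)^{p'}v(s)\,ds\Big)^{\frac r{q'}}\Big(\frac{B(x)}{V(x)}\Big)^{p'}v(x)\,dx\Big)^{\frac1r}\\ &+\Big(\int_0^\infty v(s)\,ds\Big)^{-\frac1p}\Big(\int_0^\infty\Big(\int_0^x a(y)u(y)\,dy\Big)^q w(x)\,dx\Big)^{\frac1q}. \end{aligned}$$ -/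

import Mathlib

open MeasureTheory Set
open scoped ENNReal NNReal

noncomputable section

namespace CesaroHardy

/-- Nonnegative measurable functions on `(0,∞)` (extended-valued; values outside `(0,∞)` play no
role). -/
def MeasPos (f : ℝ → ℝ≥0∞) : Prop :=
  AEMeasurable f (volume.restrict (Ioi 0))

/-- Nonnegative measurable non-increasing functions on `(0,∞)`. -/
def MeasPosDecr (f : ℝ → ℝ≥0∞) : Prop :=
  MeasPos f ∧ AntitoneOn f (Ioi 0)

/-- The primitive `x ↦ ∫₀ˣ v(t) dt`. -/
def prim (v : ℝ → ℝ≥0∞) (x : ℝ) : ℝ≥0∞ :=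
  ∫⁻ t in Ioo 0 x, v t

/-- A weight: nonnegative, measurable, with `0 < ∫₀ˣ v < ∞` for every `x > 0`. -/
def IsWeight (v : ℝ → ℝ≥0∞) : Prop :=
  MeasPos v ∧ ∀ x : ℝ, 0 < x → 0 < prim v x ∧ prim v x < ∞

/-- Finite-valued continuous functions on `(0,∞)`. -/
def IsContinuousFinite (u : ℝ → ℝ≥0∞) : Prop :=
  ContinuousOn u (Ioi 0) ∧ ∀ t : ℝ, 0 < t → u t < ∞

/-- `‖f‖_{L^p(w)} = (∫₀^∞ f^p w)^{1/p}`. -/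
def lpNorm (p : ℝ) (w f : ℝ → ℝ≥0∞) : ℝ≥0∞ :=
  (∫⁻ x in Ioi 0, f x ^ p * w x) ^ (1 / p)

/-- `‖g‖_{Ces_q(w,a)} = (∫₀^∞ (∫₀ˣ g a)^q w(x) dx)^{1/q}`. -/
def cesNorm (q : ℝ) (w a g : ℝ → ℝ≥0∞) : ℝ≥0∞ :=
  lpNorm q w (fun x => ∫⁻ t in Ioo 0 x, g t * a t)

/-- The weighted Hardy operator `(P_{u,b} f)(t) = (u(t)/B(t)) ∫₀ᵗ f b`. -/
def hardyOp (u b f : ℝ → ℝ≥0∞) (t : ℝ) : ℝ≥0∞ :=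
  u t / prim b t * ∫⁻ τ in Ioo 0 t, f τ * b τ

/-- The norm of `P_{u,b} : L^p(v) → Ces_q(w,a)` on the cone of non-increasing functions.
Division in `[0,∞]` obeys `0/0 = ∞/∞ = 0`. -/
def hardyNorm (p q : ℝ) (a b u v w : ℝ → ℝ≥0∞) : ℝ≥0∞ :=
  ⨆ f : {f : ℝ → ℝ≥0∞ // MeasPosDecr f},
    cesNorm q w a (hardyOp u b f.1) / lpNorm p v f.1

/-- `∫ₓᵗ (a(τ)/B(τ)) u(τ) dτ`. -/
def kern (a b u : ℝ → ℝ≥0∞) (x t : ℝ) : ℝ≥0∞ :=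
  ∫⁻ τ in Ioo x t, a τ / prim b τ * u τ

/-- The exponent `r` with `1/r = 1/q - 1/p`. -/
def rExp (p q : ℝ) : ℝ := (1 / q - 1 / p)⁻¹

/-- The conjugate exponent `p' = p/(p-1)`. -/
abbrev conj (p : ℝ) : ℝ := Real.conjExponent p

/-! The functionals for `p ≤ q`. Throughout, `prim (fun y => a y * u y) t = ∫₀ᵗ a u`. -/

def sup₁ (p q : ℝ) (a u v w : ℝ → ℝ≥0∞) : ℝ≥0∞ :=
  ⨆ x : Ioi (0 : ℝ),
    (∫⁻ t in Ioo 0 (x : ℝ), prim (fun y => a y * u y) t ^ q * w t) ^ (1 / q) *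
      (∫⁻ s in Ioi (x : ℝ), prim v s ^ (-conj p) * v s) ^ (1 / conj p)

def sup₂ (p q : ℝ) (a u v w : ℝ → ℝ≥0∞) : ℝ≥0∞ :=
  ⨆ x : Ioi (0 : ℝ),
    (∫⁻ t in Ioi (x : ℝ), w t) ^ (1 / q) *
      (∫⁻ s in Ioo 0 (x : ℝ),
        prim (fun y => a y * u y) s ^ conj p * prim v s ^ (-conj p) * v s) ^ (1 / conj p)

def sup₃ (p q : ℝ) (a b u v w : ℝ → ℝ≥0∞) : ℝ≥0∞ :=
  ⨆ x : Ioi (0 : ℝ),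
    (∫⁻ t in Ioi (x : ℝ), kern a b u x t ^ q * w t) ^ (1 / q) *
      (∫⁻ s in Ioo 0 (x : ℝ), (prim b s / prim v s) ^ conj p * v s) ^ (1 / conj p)

def sup₄ (p q : ℝ) (a b u v w : ℝ → ℝ≥0∞) : ℝ≥0∞ :=
  ⨆ x : Ioi (0 : ℝ),
    (∫⁻ t in Ioi (x : ℝ), w t) ^ (1 / q) *
      (∫⁻ s in Ioo 0 (x : ℝ),
        kern a b u s x ^ conj p * (prim b s / prim v s) ^ conj p * v s) ^ (1 / conj p)

/-! The functional common to both cases. -/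

def endTerm (p q : ℝ) (a u v w : ℝ → ℝ≥0∞) : ℝ≥0∞ :=
  (∫⁻ s in Ioi 0, v s) ^ (-(1 / p)) *
    (∫⁻ x in Ioi 0, prim (fun y => a y * u y) x ^ q * w x) ^ (1 / q)

/-! The functionals for `q < p`. -/

def int₁ (p q : ℝ) (a u v w : ℝ → ℝ≥0∞) : ℝ≥0∞ :=
  (∫⁻ x in Ioi 0,
    (∫⁻ t in Ioo 0 x, prim (fun y => a y * u y) t ^ q * w t) ^ (rExp p q / p) *
      (∫⁻ z in Ioi x, prim v z ^ (-conj p) * v z) ^ (rExp p q / conj p) *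
      prim (fun y => a y * u y) x ^ q * w x) ^ (1 / rExp p q)

def int₂ (p q : ℝ) (a u v w : ℝ → ℝ≥0∞) : ℝ≥0∞ :=
  (∫⁻ x in Ioi 0,
    (∫⁻ t in Ioi x, w t) ^ (rExp p q / p) *
      (∫⁻ z in Ioo 0 x,
        prim (fun y => a y * u y) z ^ conj p * prim v z ^ (-conj p) * v z) ^
          (rExp p q / conj p) *
      w x) ^ (1 / rExp p q)

def int₃ (p q : ℝ) (a b u v w : ℝ → ℝ≥0∞) : ℝ≥0∞ :=
  (∫⁻ x in Ioi 0,
    (∫⁻ t in Ioi x, w t) ^ (rExp p q / p) *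
      (∫⁻ z in Ioo 0 x,
        kern a b u z x ^ conj p * (prim b z / prim v z) ^ conj p * v z) ^
          (rExp p q / conj p) *
      w x) ^ (1 / rExp p q)

def int₄ (p q : ℝ) (a b u v w : ℝ → ℝ≥0∞) : ℝ≥0∞ :=
  (∫⁻ x in Ioi 0,
    (∫⁻ t in Ioi x, w t * kern a b u x t ^ q) ^ (rExp p q / q) *
      (∫⁻ s in Ioo 0 x, (prim b s / prim v s) ^ conj p * v s) ^ (rExp p q / conj q) *
      (prim b x / prim v x) ^ conj p * v x) ^ (1 / rExp p q)

/-- Two-sided estimate `C⁻¹ Y ≤ X ≤ C Y`. -/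
def EquivWith (C : ℝ≥0) (X Y : ℝ≥0∞) : Prop :=
  X ≤ C * Y ∧ Y ≤ C * X

end CesaroHardy

end

open CesaroHardy

open MeasureTheory Set
open scoped ENNReal NNReal

noncomputable section

namespace CesaroHardy

open Filter Topology

/-! ### Distribution functions of atomless measures and their chain rules -/

section Distribution

/-! On (0,∞) put μ = v dt, ν = w dx, β = b dt and κ = (a u / B) dt, with A(x) = ∫₀ˣ a u. Then ∫₀ˣ (P
f) a = ∫_{t<x} ∫_{s<t} f dβ dκ, so the theorem concerns the positive iterated operator `iterOp`.

Removing monotonicity. For arbitrary g ≥ 0 the tail average s ↦ ∫_{y>s} g/V dμ is non-increasing,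
and Copson's inequality (`exists_tailAvg_bdd`) bounds its L^p(μ) norm by that of g. Conversely,
1/V(s) = ∫_{y>s} V⁻² dμ + 1/V(∞) shows that a non-increasing f lies below the tail average of its
own running average plus the constant ‖f‖ V(∞)^(-1/p) (`Antitone.le_tailAvg`). Hardy's inequality
(`lintegral_average_rpow_le`) controls the running average. The constant produces the end term,
which is also the quotient for the test function f = 1. Up to the end term, N is therefore
comparable with the best constant for `iterOp` applied to tail averages of arbitrary g
(`hardyNorm_le`, `isBddIter_of_hardyNorm`).

Splitting. Fubini (`iterOp_tailAvg`) turns that composition into a sum of three operators: the Hardy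
operator ∫_{y<x} (A/V) g dμ, the kernel operator ∫_{y<x} κ(y,x) (B/V) g dμ, and A(x) ∫_{y>x} g/V dμ.
All are nonnegative, so the sum is bounded exactly when each is. The adjoint Hardy operator gives
the first functional, the Hardy operator the second, and the kernel operator the third and fourth.

Criteria. For the Hardy operator, write ∫ G^q dρ = q ∫ g G^(q-1) ρ(s,∞) dσ and apply Hölder against
the averages G/V (`hardy_lintegral_le_of_le`, `hardy_lintegral_le_of_lt`). For the kernel operator,
use the additivity of κ(s,x) in its intervals and cut the line where the output passes the levels
4^j (`exists_blocks`). This leaves a Hardy operator into a discrete measure and a block-diagonal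
part (`exists_kernel_lintegral_le`). Necessity comes from test functions (`IsBddKernel.tail_mul_le`,
`IsBddKernel.integral_condition_of_finite`) and from duality combined with the reflection x ↦ -x
(`IsBddKernel.adjoint`).

If A is infinite at one point, it is infinite at every x > 0; then the norm and the first functional
are both infinite (`hardyNorm_eq_top`, `sup₁_eq_top`, `int₁_eq_top`). -/

lemma continuous_real_Iio (η : Measure ℝ) [IsFiniteMeasure η] [NullSingletonClass η] :
    Continuous fun s => η.real (Iio s) := by
  have h : (fun s => η.real (Iio s)) = fun s => ∫ t, (Iio s).indicator (fun _ => (1 : ℝ)) t ∂η := by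
    ext s
    rw [integral_indicator measurableSet_Iio]
    simp
  rw [h, continuous_iff_continuousAt]
  intro s
  refine continuousAt_of_dominated (bound := fun _ => 1) ?_ ?_ (integrable_const _) ?_
  · exact Eventually.of_forall fun x =>
      (measurable_const.indicator measurableSet_Iio).aestronglyMeasurable
  · refine Eventually.of_forall fun x => Eventually.of_forall fun t => ?_
    by_cases h : t ∈ Iio x <;> simp [h]
  · have : ∀ᵐ t ∂η, t ≠ s := by
      simp [ae_iff, measure_singleton]
    filter_upwards [this] with t ht
    rcases lt_or_gt_of_ne ht with h | h
    · have : ∀ᶠ x in 𝓝 s, (Iio x).indicator (fun _ => (1 : ℝ)) t = 1 := by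
        filter_upwards [lt_mem_nhds h] with x hx
        simp [hx]
      exact (tendsto_const_nhds.congr' (this.mono fun _ h => h.symm)).trans
        (by simp [h])
    · have : ∀ᶠ x in 𝓝 s, (Iio x).indicator (fun _ => (1 : ℝ)) t = 0 := by
        filter_upwards [gt_mem_nhds h] with x hx
        simp [hx.le]
      exact (tendsto_const_nhds.congr' (this.mono fun _ h => h.symm)).trans
        (by simp [h.le])

lemma tendsto_real_Iio_atTop (η : Measure ℝ) [IsFiniteMeasure η] [NullSingletonClass η] :
    Tendsto (fun s => η.real (Iio s)) atTop (𝓝 (η.real univ)) := by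
  have := tendsto_measure_Iic_atTop η
  have h2 := (ENNReal.tendsto_toReal (measure_ne_top η univ)).comp this
  refine h2.congr fun s => ?_
  simp [Measure.real, measure_congr (Iio_ae_eq_Iic (μ := η) (a := s))]

lemma tendsto_real_Iio_atBot (η : Measure ℝ) [IsFiniteMeasure η] [NullSingletonClass η] :
    Tendsto (fun s => η.real (Iio s)) atBot (𝓝 0) := by
  have := tendsto_measure_Ici_atBot η
  have h2 := (ENNReal.tendsto_toReal (measure_ne_top η univ)).comp this
  have h3 := (tendsto_const_nhds (x := η.real univ)).sub h2
  rw [← Measure.real, sub_self] at h3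
  refine h3.congr fun s => ?_
  have := measureReal_compl (μ := η) (measurableSet_Ici (a := s))
  rw [compl_Ici] at this
  exact this.symm

lemma exists_real_Iio_eq (η : Measure ℝ) [IsFiniteMeasure η] [NullSingletonClass η] {c : ℝ} (h0 : 0 < c)
    (h1 : c < η.real univ) : ∃ s, η.real (Iio s) = c := by
  obtain ⟨a, ha⟩ := ((tendsto_real_Iio_atBot η).eventually (gt_mem_nhds h0)).exists
  obtain ⟨b, hb⟩ := ((tendsto_real_Iio_atTop η).eventually (lt_mem_nhds h1)).exists
  exact mem_range_of_exists_le_of_exists_ge (continuous_real_Iio η) ⟨a, ha.le⟩ ⟨b, hb.le⟩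

lemma monotone_real_Iio (η : Measure ℝ) [IsFiniteMeasure η] :
    Monotone fun s => η.real (Iio s) := fun _ _ h => measureReal_mono (Iio_subset_Iio h)

lemma monotone_measure_Iio (η : Measure ℝ) : Monotone fun s => η (Iio s) :=
  fun _ _ h => measure_mono (Iio_subset_Iio h)

lemma antitone_measure_Ioi (η : Measure ℝ) : Antitone fun s => η (Ioi s) :=
  fun _ _ h => measure_mono (Ioi_subset_Ioi h)

/-- The probability integral transform. Continuity supplies s with F(s) = c for each intermediate
level c of the distribution function F; the sublevel set {F ≤ c} contains `Iio s` and lies in `Iio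
s'` as soon as F(s') > c, so it has mass c. This replaces differentiation in every chain rule below.
-/
lemma map_real_Iio (η : Measure ℝ) [IsFiniteMeasure η] [NullSingletonClass η] :
    η.map (fun s => η.real (Iio s)) = volume.restrict (Ioo 0 (η.real univ)) := by
  have hmeas : Measurable fun s => η.real (Iio s) := (continuous_real_Iio η).measurable
  refine Measure.ext_of_Iic _ _ fun c => ?_
  rw [Measure.map_apply hmeas measurableSet_Iic, Measure.restrict_apply measurableSet_Iic]
  have key : ∀ c : ℝ, 0 < c → c < η.real univ →
      η ((fun s => η.real (Iio s)) ⁻¹' Iic c) = ENNReal.ofReal c := by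
    intro c h0 h1
    apply le_antisymm
    · have : ∀ c' : ℝ, c < c' → c' < η.real univ →
        η ((fun s => η.real (Iio s)) ⁻¹' Iic c) ≤ ENNReal.ofReal c' := by
        intro c' h h'
        obtain ⟨s, hs⟩ := exists_real_Iio_eq η (h0.trans h) h'
        rw [← hs, ofReal_measureReal]
        refine measure_mono fun t ht => ?_
        by_contra hst
        have := monotone_real_Iio η (not_lt.mp hst)
        simp only [mem_preimage, mem_Iic] at ht this
        linarith
      have hc : Tendsto (fun c' => ENNReal.ofReal c') (𝓝[>] c) (𝓝 (ENNReal.ofReal c)) :=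
        (ENNReal.continuous_ofReal.tendsto c).mono_left nhdsWithin_le_nhds
      refine ge_of_tendsto hc ?_
      filter_upwards [Ioo_mem_nhdsGT h1] with c' hc'
      exact this c' hc'.1 hc'.2
    · obtain ⟨s, hs⟩ := exists_real_Iio_eq η h0 h1
      rw [← hs, ofReal_measureReal]
      exact measure_mono fun t ht => monotone_real_Iio η (le_of_lt ht)
  rcases le_or_gt (η.real univ) c with hc | hc
  · have h1 : ((fun s => η.real (Iio s)) ⁻¹' Iic c) = univ :=
      eq_univ_of_forall fun s => (measureReal_mono (subset_univ _)).trans hc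
    have h2 : Iic c ∩ Ioo 0 (η.real univ) = Ioo 0 (η.real univ) :=
      inter_eq_right.mpr fun y hy => hy.2.le.trans hc
    rw [h1, h2, Real.volume_Ioo, sub_zero, ofReal_measureReal]
  · rcases le_or_gt c 0 with h0 | h0
    · have h2 : Iic c ∩ Ioo 0 (η.real univ) = ∅ := by
        ext y; simp only [mem_inter_iff, mem_Iic, mem_Ioo, mem_empty_iff_false, iff_false]
        rintro ⟨h, h', -⟩; linarith
      rw [h2, measure_empty]
      refine le_antisymm ?_ zero_le
      rcases eq_or_lt_of_le (measureReal_nonneg : 0 ≤ η.real univ) with hm | hm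
      · rw [measure_mono_null (subset_univ _) ((measureReal_eq_zero_iff (measure_ne_top _ _)).mp hm.symm)]
      · have hz : Tendsto (fun c' => ENNReal.ofReal c') (𝓝[>] 0) (𝓝 0) := by
          have := (ENNReal.continuous_ofReal.tendsto 0).mono_left
            (nhdsWithin_le_nhds (s := Ioi (0 : ℝ)))
          simpa using this
        refine ge_of_tendsto hz ?_
        filter_upwards [Ioo_mem_nhdsGT hm] with c' hc'
        rw [← key c' hc'.1 hc'.2]
        exact measure_mono fun t ht => le_trans ht (h0.trans hc'.1.le)
    · have h2 : Iic c ∩ Ioo 0 (η.real univ) = Ioc 0 c := by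
        ext y; simp only [mem_inter_iff, mem_Iic, mem_Ioo, mem_Ioc]
        constructor
        · rintro ⟨h, h', -⟩; exact ⟨h', h⟩
        · rintro ⟨h, h'⟩; exact ⟨h', h, h'.trans_lt hc⟩
      rw [h2, key c h0 hc, Real.volume_Ioc, sub_zero]

/-- The distribution function of an atomless finite measure transports it to Lebesgue measure. -/
lemma lintegral_comp_measure_Iio (η : Measure ℝ) [IsFiniteMeasure η] [NullSingletonClass η]
    {φ : ℝ≥0∞ → ℝ≥0∞} (hφ : Measurable φ) :
    ∫⁻ s, φ (η (Iio s)) ∂η = ∫⁻ y in Ioo 0 (η.real univ), φ (ENNReal.ofReal y) := by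
  rw [← map_real_Iio, lintegral_map (by fun_prop) (continuous_real_Iio η).measurable]
  simp

lemma setLIntegral_comp_measure_Iio (σ : Measure ℝ) [NullSingletonClass σ] {x : ℝ} (hx : σ (Iio x) ≠ ∞)
    {φ : ℝ≥0∞ → ℝ≥0∞} (hφ : Measurable φ) :
    ∫⁻ s in Iio x, φ (σ (Iio s)) ∂σ = ∫⁻ y in Ioo 0 (σ (Iio x)).toReal, φ (ENNReal.ofReal y) := by
  have : IsFiniteMeasure (σ.restrict (Iio x)) := ⟨by simpa using hx.lt_top⟩
  have := lintegral_comp_measure_Iio (σ.restrict (Iio x)) hφ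
  simp only [Measure.real, Measure.restrict_apply MeasurableSet.univ, univ_inter] at this
  rw [← this]
  refine setLIntegral_congr_fun measurableSet_Iio fun s hs => ?_
  rw [Measure.restrict_apply measurableSet_Iio, inter_eq_left.mpr (Iio_subset_Iio (le_of_lt hs))]

lemma lintegral_Ioo_rpow {α m : ℝ} (hα : 0 < α) (hm : 0 ≤ m) :
    ∫⁻ y in Ioo 0 m, ENNReal.ofReal y ^ (α - 1) = (ENNReal.ofReal α)⁻¹ * ENNReal.ofReal m ^ α := by
  have h1 : ∫⁻ y in Ioo 0 m, ENNReal.ofReal y ^ (α - 1)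
      = ∫⁻ y in Ioo 0 m, ENNReal.ofReal (y ^ (α - 1)) :=
    setLIntegral_congr_fun measurableSet_Ioo fun y hy => ENNReal.ofReal_rpow_of_pos hy.1
  rw [h1, ← ofReal_integral_eq_lintegral_ofReal, ← integral_Ioc_eq_integral_Ioo,
    ← intervalIntegral.integral_of_le hm, integral_rpow (Or.inl (by linarith)),
    sub_add_cancel, Real.zero_rpow hα.ne', sub_zero, ENNReal.ofReal_rpow_of_nonneg hm hα.le,
    ← ENNReal.ofReal_inv_of_pos hα, ← ENNReal.ofReal_mul (by positivity)]
  · congr 1; ring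
  · have := (intervalIntegral.intervalIntegrable_rpow' (a := 0) (b := m) (r := α - 1) (by linarith))
    rw [intervalIntegrable_iff_integrableOn_Ioo_of_le hm] at this
    exact this
  · filter_upwards [ae_restrict_mem measurableSet_Ioo] with y hy
    exact Real.rpow_nonneg hy.1.le _

/-- Chain rule for powers of a distribution function. -/
lemma setLIntegral_Iio_rpow (σ : Measure ℝ) [NullSingletonClass σ] {x : ℝ} (hx : σ (Iio x) ≠ ∞) {α : ℝ}
    (hα : 0 < α) :
    ∫⁻ s in Iio x, σ (Iio s) ^ (α - 1) ∂σ = (ENNReal.ofReal α)⁻¹ * σ (Iio x) ^ α := by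
  rw [setLIntegral_comp_measure_Iio σ hx (φ := fun y => y ^ (α - 1)) (by fun_prop),
    lintegral_Ioo_rpow hα ENNReal.toReal_nonneg, ENNReal.ofReal_toReal hx]

lemma rpow_eq_mul_setLIntegral (σ : Measure ℝ) [NullSingletonClass σ] {x : ℝ} (hx : σ (Iio x) ≠ ∞) {α : ℝ}
    (hα : 0 < α) :
    σ (Iio x) ^ α = ENNReal.ofReal α * ∫⁻ s in Iio x, σ (Iio s) ^ (α - 1) ∂σ := by
  rw [setLIntegral_Iio_rpow σ hx hα, ← mul_assoc, ENNReal.mul_inv_cancel, one_mul]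
  · simpa using hα
  · simp

lemma setLIntegral_Ici_eq_iSup (σ : Measure ℝ) (f : ℝ → ℝ≥0∞) (x : ℝ) :
    ∫⁻ s in Ici x, f s ∂σ = ⨆ n : ℕ, ∫⁻ s in Ico x n, f s ∂σ := by
  have : Ici x = ⋃ n : ℕ, Ico x n := by
    ext y; simp only [mem_Ici, mem_iUnion, mem_Ico, exists_and_left, iff_self_and]
    exact fun _ => exists_nat_gt y
  rw [this, setLIntegral_iUnion_of_directed]
  exact directed_of_isDirected_le fun i j h => Ico_subset_Ico_right (by exact_mod_cast h)

/-- Transport to ∫_c^∞ y^(-1-β) dy = c^(-β)/β with c = σ(Iio x). Only an inequality holds in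
general, because the values of the distribution function stop at the total mass of σ. -/
lemma setLIntegral_Ici_rpow_neg_le (σ : Measure ℝ) [NullSingletonClass σ] (hσ : ∀ x, σ (Iio x) ≠ ∞) (x : ℝ)
    {β : ℝ} (hβ : 0 < β) :
    ∫⁻ s in Ici x, σ (Iio s) ^ (-1 - β) ∂σ ≤ (ENNReal.ofReal β)⁻¹ * σ (Iio x) ^ (-β) := by
  rcases eq_or_ne (σ (Iio x)) 0 with h0 | h0
  · rw [h0, ENNReal.zero_rpow_of_neg (by linarith), ENNReal.mul_top (by simp)]
    exact le_top
  rw [setLIntegral_Ici_eq_iSup]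
  refine iSup_le fun n => ?_
  set c := σ (Iio x)
  have hc : 0 < c.toReal := ENNReal.toReal_pos h0 (hσ x)
  calc ∫⁻ s in Ico x n, σ (Iio s) ^ (-1 - β) ∂σ
      ≤ ∫⁻ s in Iio (n : ℝ), (Ici c).indicator (fun y => y ^ (-1 - β)) (σ (Iio s)) ∂σ := by
        rw [← lintegral_indicator measurableSet_Ico, ← lintegral_indicator measurableSet_Iio]
        refine lintegral_mono fun s => ?_
        by_cases hs : s ∈ Ico x n
        · have h1 : s ∈ Iio (n : ℝ) := hs.2
          have h2 : σ (Iio s) ∈ Ici c := monotone_measure_Iio σ hs.1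
          simp [hs, h1, h2]
        · simp [hs]
    _ = ∫⁻ y in Ioo 0 (σ (Iio (n : ℝ))).toReal,
          (Ici c).indicator (fun y => y ^ (-1 - β)) (ENNReal.ofReal y) :=
        setLIntegral_comp_measure_Iio σ (hσ _)
          ((by fun_prop : Measurable fun y : ℝ≥0∞ => y ^ (-1 - β)).indicator measurableSet_Ici)
    _ ≤ ∫⁻ y in Ici c.toReal, ENNReal.ofReal (y ^ (-1 - β)) := by
        rw [← lintegral_indicator measurableSet_Ioo, ← lintegral_indicator measurableSet_Ici]
        refine lintegral_mono fun y => ?_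
        by_cases hy : y ∈ Ioo 0 (σ (Iio (n : ℝ))).toReal
        · by_cases h2 : ENNReal.ofReal y ∈ Ici c
          · have h3 : y ∈ Ici c.toReal := by
              exact ENNReal.toReal_le_of_le_ofReal hy.1.le h2
            simp only [indicator_of_mem hy, indicator_of_mem h2, indicator_of_mem h3]
            rw [ENNReal.ofReal_rpow_of_pos hy.1]
          · rw [indicator_of_mem hy, indicator_of_notMem h2]
            exact zero_le
        · simp [hy]
    _ = (ENNReal.ofReal β)⁻¹ * c ^ (-β) := by
        rw [setLIntegral_congr Ioi_ae_eq_Ici.symm, ← ofReal_integral_eq_lintegral_ofReal,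
          integral_Ioi_rpow_of_lt (by linarith) hc]
        · have hct : c ≠ ∞ := hσ x
          rw [← ENNReal.ofReal_toReal hct, ENNReal.toReal_ofReal hc.le,
            ENNReal.ofReal_rpow_of_pos hc, ← ENNReal.ofReal_inv_of_pos hβ, ← ENNReal.ofReal_mul (by positivity)]
          congr 1
          rw [show -1 - β + 1 = -β by ring]
          field_simp
        · exact integrableOn_Ioi_rpow_of_lt (by linarith) hc
        · filter_upwards [ae_restrict_mem measurableSet_Ioi] with y hy
          exact Real.rpow_nonneg (hc.le.trans (le_of_lt hy)) _

/-- The fundamental theorem for 1/V. The boundary value 1/V(∞), which is 0 for infinite total mass,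
is the origin of the end term in the theorem. -/
lemma inv_measure_Iio_le (σ : Measure ℝ) [NullSingletonClass σ] (hσ : ∀ x, σ (Iio x) ≠ ∞) (x : ℝ)
    (hx : σ (Iio x) ≠ 0) :
    (σ (Iio x))⁻¹ ≤ ∫⁻ s in Ioi x, σ (Iio s) ^ (-2 : ℝ) ∂σ + (σ univ)⁻¹ := by
  set c := σ (Iio x) with hcdef
  have hc : 0 < c.toReal := ENNReal.toReal_pos hx (hσ x)
  -- The total mass may be infinite, so the bound is proved with the finite mass of `Iio n` in its
  -- place and n is sent to infinity.
  have hlim : Tendsto (fun n : ℕ => (σ (Iio (n : ℝ)))⁻¹) atTop (𝓝 (σ univ)⁻¹) := by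
    refine (continuous_inv.tendsto _).comp ?_
    have : (univ : Set ℝ) = ⋃ n : ℕ, Iio (n : ℝ) := by
      ext y; simpa using exists_nat_gt y
    rw [this]
    exact tendsto_measure_iUnion_atTop fun i j h => Iio_subset_Iio (by exact_mod_cast h)
  refine ge_of_tendsto (tendsto_const_nhds.add hlim) ?_
  filter_upwards [eventually_ge_atTop ⌈x⌉₊] with n hn
  have hxn : x ≤ n := (Nat.le_ceil x).trans (by exact_mod_cast hn)
  set m := σ (Iio (n : ℝ)) with hmdef
  have hcm : c ≤ m := monotone_measure_Iio σ hxn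
  have hcm' : c.toReal ≤ m.toReal := ENNReal.toReal_mono (hσ _) hcm
  have key : ∫⁻ y in Ioo c.toReal m.toReal, ENNReal.ofReal (y ^ (-2 : ℝ))
      ≤ ∫⁻ s in Ioi x, σ (Iio s) ^ (-2 : ℝ) ∂σ := by
    calc ∫⁻ y in Ioo c.toReal m.toReal, ENNReal.ofReal (y ^ (-2 : ℝ))
        ≤ ∫⁻ y in Ioo 0 m.toReal,
          (Ioi c).indicator (fun y => y ^ (-2 : ℝ)) (ENNReal.ofReal y) := by
          rw [← lintegral_indicator measurableSet_Ioo, ← lintegral_indicator measurableSet_Ioo]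
          refine lintegral_mono fun y => ?_
          by_cases hy : y ∈ Ioo c.toReal m.toReal
          · have h1 : y ∈ Ioo 0 m.toReal := ⟨hc.trans hy.1, hy.2⟩
            have h2 : ENNReal.ofReal y ∈ Ioi c := by
              exact (ENNReal.lt_ofReal_iff_toReal_lt (hσ x)).mpr hy.1
            simp only [indicator_of_mem hy, indicator_of_mem h1, indicator_of_mem h2]
            rw [ENNReal.ofReal_rpow_of_pos h1.1]
          · simp [hy]
      _ = ∫⁻ s in Iio (n : ℝ), (Ioi c).indicator (fun y => y ^ (-2 : ℝ)) (σ (Iio s)) ∂σ :=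
          (setLIntegral_comp_measure_Iio σ (hσ _)
            ((by fun_prop : Measurable fun y : ℝ≥0∞ => y ^ (-2 : ℝ)).indicator
              measurableSet_Ioi)).symm
      _ ≤ _ := by
          rw [← lintegral_indicator measurableSet_Iio, ← lintegral_indicator measurableSet_Ioi]
          refine lintegral_mono fun s => ?_
          by_cases h2 : σ (Iio s) ∈ Ioi c
          · have h1 : s ∈ Ioi x := by
              by_contra h
              exact absurd (monotone_measure_Iio σ (not_lt.mp h)) (not_le.mpr h2)
            rw [indicator_of_mem h1]
            refine (indicator_le_self _ _ _).trans ?_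
            rw [indicator_of_mem h2]
          · by_cases h3 : s ∈ Iio (n : ℝ) <;> simp [h2, h3]
  refine le_trans ?_ (add_le_add_left key _)
  have hval : ∫⁻ y in Ioo c.toReal m.toReal, ENNReal.ofReal (y ^ (-2 : ℝ))
      = ENNReal.ofReal (c.toReal⁻¹ - m.toReal⁻¹) := by
    have h0 : (0 : ℝ) ∉ uIcc c.toReal m.toReal := by
      rw [uIcc_of_le hcm']; exact fun h => absurd h.1 (not_le.mpr hc)
    rw [← ofReal_integral_eq_lintegral_ofReal, ← integral_Ioc_eq_integral_Ioo,
      ← intervalIntegral.integral_of_le hcm', integral_rpow (Or.inr ⟨by norm_num, h0⟩)]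
    · congr 1
      norm_num [Real.rpow_neg_one]
      ring
    · have := intervalIntegral.intervalIntegrable_rpow (μ := volume) (r := (-2 : ℝ)) (Or.inr h0)
      rw [intervalIntegrable_iff_integrableOn_Ioo_of_le hcm'] at this
      exact this
    · filter_upwards [ae_restrict_mem measurableSet_Ioo] with y hy
      exact Real.rpow_nonneg (hc.le.trans hy.1.le) _
  have hm : 0 < m.toReal := hc.trans_le hcm'
  have hct : c ≠ ∞ := hσ x
  have hmt : m ≠ ∞ := hσ n
  rw [hval, ← ENNReal.ofReal_toReal hct, ← ENNReal.ofReal_toReal hmt,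
    ← ENNReal.ofReal_inv_of_pos hc, ← ENNReal.ofReal_inv_of_pos hm, ENNReal.toReal_ofReal hm.le,
    ENNReal.toReal_ofReal hc.le,
    ← ENNReal.ofReal_add (sub_nonneg.mpr (by gcongr)) (by positivity)]
  simp

end Distribution

/-! ### Fubini on the half-plane s < x, null sets and Hölder -/

section Tools

lemma measurable_setLIntegral_Iio (σ : Measure ℝ) [SFinite σ] {F : ℝ → ℝ → ℝ≥0∞}
    (hF : Measurable (Function.uncurry F)) : Measurable fun x => ∫⁻ s in Iio x, F s x ∂σ := by
  have h : (fun x => ∫⁻ s in Iio x, F s x ∂σ)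
      = fun x => ∫⁻ s, {z : ℝ × ℝ | z.2 < z.1}.indicator (fun z => F z.2 z.1) (x, s) ∂σ := by
    ext x
    rw [← lintegral_indicator measurableSet_Iio]
    rfl
  rw [h]
  exact ((hF.comp measurable_swap).indicator
    (measurableSet_lt measurable_snd measurable_fst)).lintegral_prod_right'

lemma measurable_setLIntegral_Ioi (σ : Measure ℝ) [SFinite σ] {F : ℝ → ℝ → ℝ≥0∞}
    (hF : Measurable (Function.uncurry F)) : Measurable fun s => ∫⁻ x in Ioi s, F s x ∂σ := by
  have h : (fun s => ∫⁻ x in Ioi s, F s x ∂σ)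
      = fun s => ∫⁻ x, {z : ℝ × ℝ | z.1 < z.2}.indicator (fun z => F z.1 z.2) (s, x) ∂σ := by
    ext x
    rw [← lintegral_indicator measurableSet_Ioi]
    rfl
  rw [h]
  exact (Measurable.indicator hF
    (measurableSet_lt measurable_fst measurable_snd)).lintegral_prod_right'

lemma lintegral_setLIntegral_swap (σ ρ : Measure ℝ) [SFinite σ] [SFinite ρ] {F : ℝ → ℝ → ℝ≥0∞}
    (hF : Measurable (Function.uncurry F)) :
    ∫⁻ x, ∫⁻ s in Iio x, F s x ∂σ ∂ρ = ∫⁻ s, ∫⁻ x in Ioi s, F s x ∂ρ ∂σ := by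
  have h1 : ∀ x, ∫⁻ s in Iio x, F s x ∂σ
      = ∫⁻ s, {z : ℝ × ℝ | z.1 < z.2}.indicator (fun z => F z.1 z.2) (s, x) ∂σ := by
    intro x
    rw [← lintegral_indicator measurableSet_Iio]
    rfl
  have h2 : ∀ s, ∫⁻ x in Ioi s, F s x ∂ρ
      = ∫⁻ x, {z : ℝ × ℝ | z.1 < z.2}.indicator (fun z => F z.1 z.2) (s, x) ∂ρ := by
    intro s
    rw [← lintegral_indicator measurableSet_Ioi]
    rfl
  simp_rw [h1, h2]
  refine lintegral_lintegral_swap ?_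
  exact ((Measurable.indicator hF
    (measurableSet_lt measurable_fst measurable_snd)).comp measurable_swap).aemeasurable

lemma measurable_measure_Iio (η : Measure ℝ) : Measurable fun s => η (Iio s) :=
  (monotone_measure_Iio η).measurable

lemma measurable_measure_Ioi (η : Measure ℝ) : Measurable fun s => η (Ioi s) :=
  (antitone_measure_Ioi η).measurable

lemma withDensity_Iio (σ : Measure ℝ) (g : ℝ → ℝ≥0∞) (x : ℝ) :
    (σ.withDensity g) (Iio x) = ∫⁻ s in Iio x, g s ∂σ := withDensity_apply _ measurableSet_Iio

lemma monotone_setLIntegral_Iio (σ : Measure ℝ) (g : ℝ → ℝ≥0∞) :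
    Monotone fun x => ∫⁻ s in Iio x, g s ∂σ :=
  fun _ _ h => lintegral_mono_set (Iio_subset_Iio h)

lemma antitone_setLIntegral_Ioi (σ : Measure ℝ) (g : ℝ → ℝ≥0∞) :
    Antitone fun x => ∫⁻ s in Ioi x, g s ∂σ :=
  fun _ _ h => lintegral_mono_set (Ioi_subset_Ioi h)

/-- After transport the set in question becomes {0} inside (0,m), which is Lebesgue-null. It makes
division by V harmless σ-almost everywhere. -/
lemma ae_measure_Iio_ne_zero (σ : Measure ℝ) [NullSingletonClass σ] (hσ : ∀ x, σ (Iio x) ≠ ∞) :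
    ∀ᵐ s ∂σ, σ (Iio s) ≠ 0 := by
  have hm : MeasurableSet {s | σ (Iio s) = 0} :=
    measurable_measure_Iio σ (measurableSet_singleton 0)
  have h : ∀ n : ℕ, σ ({s | σ (Iio s) = 0} ∩ Iio (n : ℝ)) = 0 := by
    intro n
    have := setLIntegral_comp_measure_Iio σ (hσ n) (φ := ({0} : Set ℝ≥0∞).indicator 1)
      (measurable_one.indicator (measurableSet_singleton 0))
    have h0 : ∫⁻ y in Ioo 0 (σ (Iio (n : ℝ))).toReal,
        ({0} : Set ℝ≥0∞).indicator 1 (ENNReal.ofReal y) = 0 := by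
      rw [setLIntegral_congr_fun (g := fun _ => 0) measurableSet_Ioo]
      · simp
      · intro y hy
        simp [hy.1]
    rw [h0] at this
    rw [← Measure.restrict_apply hm, ← lintegral_indicator_one hm]
    exact this
  have hU : {s | ¬ σ (Iio s) ≠ 0} = ⋃ n : ℕ, ({s | σ (Iio s) = 0} ∩ Iio (n : ℝ)) := by
    ext s
    simp only [ne_eq, not_not, mem_ofPred_eq, mem_iUnion, mem_inter_iff, mem_Iio, exists_and_left,
      iff_self_and]
    exact fun _ => exists_nat_gt s
  rw [ae_iff, hU]
  exact measure_iUnion_null h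

lemma lintegral_mul_le_rpow {α : Type*} [MeasurableSpace α] (μ : Measure α) {p p' : ℝ}
    (hp : p.HolderConjugate p')
    {f g : α → ℝ≥0∞} (hf : AEMeasurable f μ) (hg : AEMeasurable g μ) :
    ∫⁻ x, f x * g x ∂μ ≤ (∫⁻ x, f x ^ p ∂μ) ^ (1 / p) * (∫⁻ x, g x ^ p' ∂μ) ^ (1 / p') :=
  ENNReal.lintegral_mul_le_Lp_mul_Lq μ hp hf hg

lemma setLIntegral_Iio_le_rpow (σ : Measure ℝ) {p p' : ℝ} (hp : p.HolderConjugate p')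
    {g : ℝ → ℝ≥0∞} (hg : AEMeasurable g σ) (x : ℝ) :
    ∫⁻ s in Iio x, g s ∂σ ≤ (∫⁻ s, g s ^ p ∂σ) ^ (1 / p) * σ (Iio x) ^ (1 / p') := by
  have := lintegral_mul_le_rpow (σ.restrict (Iio x)) hp hg.restrict
    (aemeasurable_const (b := (1 : ℝ≥0∞)))
  simp only [mul_one, ENNReal.one_rpow, lintegral_const, Measure.restrict_apply MeasurableSet.univ,
    univ_inter, one_mul] at this
  refine this.trans ?_
  gcongr
  · exact hp.one_div_nonneg
  · exact Measure.restrict_le_self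

lemma rpow_add_eq {x : ℝ≥0∞} (h0 : x ≠ 0) (ht : x ≠ ∞) {a b c : ℝ} (h : a + b = c) :
    x ^ a * x ^ b = x ^ c := by rw [← ENNReal.rpow_add _ _ h0 ht, h]

lemma rpow_mul_eq (x : ℝ≥0∞) {a b c : ℝ} (h : a * b = c) : (x ^ a) ^ b = x ^ c := by
  rw [← ENNReal.rpow_mul, h]

lemma rpow_le_iff {X Y : ℝ≥0∞} {q : ℝ} (hq : 0 < q) : X ^ (1 / q) ≤ Y ↔ X ≤ Y ^ q := by
  rw [one_div]; exact ENNReal.rpow_inv_le_iff hq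

end Tools

/-! ### Hardy's inequality for averages and its two-measure versions on finite measures -/

/-- Hardy's inequality for averages with respect to an atomless measure. -/
lemma lintegral_average_rpow_le (σ : Measure ℝ) [SFinite σ] [NullSingletonClass σ]
    (hσ : ∀ x, σ (Iio x) ≠ ∞) {p p' : ℝ} (hp : p.HolderConjugate p') {g : ℝ → ℝ≥0∞}
    (hg : Measurable g) :
    ∫⁻ x, ((∫⁻ s in Iio x, g s ∂σ) / σ (Iio x)) ^ p ∂σ
      ≤ ENNReal.ofReal p' ^ p * ∫⁻ s, g s ^ p ∂σ := by
  have hp0 := hp.pos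
  have hp'0 := hp.symm.pos
  have hpp : p / p' = p - 1 := hp.div_conj_eq_sub_one
  have hinv : p⁻¹ + p'⁻¹ = 1 := hp.inv_add_inv_eq_one
  set V : ℝ → ℝ≥0∞ := fun x => σ (Iio x) with hV
  have hVm : Measurable V := measurable_measure_Iio σ
  have hV0 : ∀ᵐ s ∂σ, V s ≠ 0 := ae_measure_Iio_ne_zero σ hσ
  set c := ENNReal.ofReal p' with hc
  have hc0 : c ≠ 0 := by simpa [hc] using hp'0
  have hct : c ≠ ∞ := ENNReal.ofReal_ne_top
  have hcinv : (ENNReal.ofReal (1 / p'))⁻¹ = c := by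
    rw [one_div, ENNReal.ofReal_inv_of_pos hp'0, inv_inv]
  have hcinv' : (ENNReal.ofReal (p'⁻¹))⁻¹ = c := by rw [← hcinv, one_div]
  have hpointwise : ∀ x, (∫⁻ s in Iio x, g s ∂σ) ^ p
      ≤ (∫⁻ s in Iio x, g s ^ p * V s ^ p'⁻¹ ∂σ) * (c * V x ^ p'⁻¹) ^ (p - 1) := by
    intro x
    -- Hölder with the auxiliary weight V^(1/(pp')). Its inverse, raised to the power p', is
    -- V^(-1/p) = V^(1/p' - 1), which integrates to p' V(x)^(1/p').
    have h1 : ∫⁻ s in Iio x, g s ∂σ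
        = ∫⁻ s in Iio x, (g s * V s ^ (p⁻¹ * p'⁻¹)) * V s ^ (-(p⁻¹ * p'⁻¹)) ∂σ := by
      refine lintegral_congr_ae ?_
      filter_upwards [ae_restrict_of_ae hV0] with s hs
      rw [mul_assoc, rpow_add_eq hs (hσ s) (add_neg_cancel _), ENNReal.rpow_zero, mul_one]
    have h2 := lintegral_mul_le_rpow (σ.restrict (Iio x)) hp
      (f := fun s => g s * V s ^ (p⁻¹ * p'⁻¹)) (g := fun s => V s ^ (-(p⁻¹ * p'⁻¹)))
      (by fun_prop) (by fun_prop)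
    have h3 : ∫⁻ s in Iio x, (V s ^ (-(p⁻¹ * p'⁻¹))) ^ p' ∂σ = c * V x ^ p'⁻¹ := by
      rw [← hcinv', ← setLIntegral_Iio_rpow σ (hσ x) (inv_pos.mpr hp'0)]
      refine lintegral_congr fun s => rpow_mul_eq _ ?_
      field_simp
      linear_combination hp.mul_eq_add
    have h4 : ∀ s, (g s * V s ^ (p⁻¹ * p'⁻¹)) ^ p = g s ^ p * V s ^ p'⁻¹ := by
      intro s
      rw [ENNReal.mul_rpow_of_nonneg _ _ hp0.le, rpow_mul_eq]
      field_simp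
    rw [h3] at h2
    simp_rw [h4] at h2
    rw [← h1] at h2
    calc (∫⁻ s in Iio x, g s ∂σ) ^ p ≤ _ := ENNReal.rpow_le_rpow h2 hp0.le
      _ = _ := by
        rw [ENNReal.mul_rpow_of_nonneg _ _ hp0.le, rpow_mul_eq _ (c := 1) (by field_simp),
          ENNReal.rpow_one, rpow_mul_eq _ (c := p - 1) (by rw [← hpp]; ring)]
  calc ∫⁻ x, ((∫⁻ s in Iio x, g s ∂σ) / V x) ^ p ∂σ
      ≤ ∫⁻ x, c ^ (p - 1) * ∫⁻ s in Iio x, g s ^ p * V s ^ p'⁻¹ * V x ^ (-1 - p'⁻¹) ∂σ ∂σ := by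
        refine lintegral_mono_ae ?_
        filter_upwards [hV0] with x hx
        rw [ENNReal.div_rpow_of_nonneg _ _ hp0.le, ENNReal.div_eq_inv_mul, ← ENNReal.rpow_neg,
          lintegral_mul_const' _ _ (ENNReal.rpow_ne_top_of_ne_zero hx (hσ x))]
        refine (mul_le_mul_right (hpointwise x) _).trans (le_of_eq ?_)
        rw [ENNReal.mul_rpow_of_nonneg _ _ hp.sub_one_pos.le, rpow_mul_eq _ rfl,
          ← rpow_add_eq hx (hσ x) (a := -p) (b := p'⁻¹ * (p - 1)) (c := -1 - p'⁻¹)]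
        · ring
        · have : p'⁻¹ = 1 - p⁻¹ := by linarith
          rw [this]; field_simp; ring
    -- After Fubini the inner integral of V^(-1-1/p') over x > s is at most p' V(s)^(-1/p'). This
    -- cancels the weight and supplies the last factor of c^p.
    _ = c ^ (p - 1) * ∫⁻ s, ∫⁻ x in Ioi s, g s ^ p * V s ^ p'⁻¹ * V x ^ (-1 - p'⁻¹) ∂σ ∂σ := by
        rw [lintegral_const_mul' _ _ (ENNReal.rpow_ne_top_of_ne_zero hc0 hct),
          lintegral_setLIntegral_swap σ σ (F := fun s x => g s ^ p * V s ^ p'⁻¹ * V x ^ (-1 - p'⁻¹))]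
        fun_prop
    _ ≤ c ^ (p - 1) * ∫⁻ s, g s ^ p * c ∂σ := by
        refine mul_le_mul_right (lintegral_mono_ae ?_) _
        filter_upwards [hV0] with s hs
        rw [lintegral_const_mul _ (by fun_prop), mul_assoc]
        refine mul_le_mul_right ?_ _
        refine (mul_le_mul_right ((lintegral_mono_set Ioi_subset_Ici_self).trans
          (setLIntegral_Ici_rpow_neg_le σ hσ s (inv_pos.mpr hp'0))) _).trans (le_of_eq ?_)
        rw [hcinv', mul_left_comm, rpow_add_eq hs (hσ s) (add_neg_cancel _), ENNReal.rpow_zero,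
          mul_one]
    _ = c ^ p * ∫⁻ s, g s ^ p ∂σ := by
        rw [lintegral_mul_const' _ _ hct, mul_comm (lintegral _ _), ← mul_assoc]
        congr 1
        nth_rw 2 [← ENNReal.rpow_one c]
        exact rpow_add_eq hc0 hct (by ring)

/-- The primitive of g is the distribution function of g dσ, so the chain rule applies to its q-th
power; Fubini then collects ρ into tails. -/
lemma lintegral_Iio_rpow_eq (σ ρ : Measure ℝ) [SFinite σ] [SFinite ρ] [NullSingletonClass σ]
    {g : ℝ → ℝ≥0∞} (hg : Measurable g) (hG : ∀ x, ∫⁻ s in Iio x, g s ∂σ ≠ ∞) {q : ℝ}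
    (hq : 0 < q) :
    ∫⁻ x, (∫⁻ s in Iio x, g s ∂σ) ^ q ∂ρ = ENNReal.ofReal q *
      ∫⁻ s, g s * ((∫⁻ z in Iio s, g z ∂σ) ^ (q - 1) * ρ (Ioi s)) ∂σ := by
  have hGm : Measurable fun s => ∫⁻ z in Iio s, g z ∂σ :=
    (monotone_setLIntegral_Iio σ g).measurable
  have h1 : ∀ x, (∫⁻ s in Iio x, g s ∂σ) ^ q = ENNReal.ofReal q *
      ∫⁻ s in Iio x, g s * (∫⁻ z in Iio s, g z ∂σ) ^ (q - 1) ∂σ := by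
    intro x
    have := rpow_eq_mul_setLIntegral (σ.withDensity g) (x := x)
      (by rw [withDensity_Iio]; exact hG x) hq
    simp_rw [withDensity_Iio] at this
    rw [this, restrict_withDensity measurableSet_Iio,
      lintegral_withDensity_eq_lintegral_mul _ hg (by fun_prop)]
    rfl
  simp_rw [h1]
  rw [lintegral_const_mul' _ _ ENNReal.ofReal_ne_top,
    lintegral_setLIntegral_swap σ ρ (F := fun s _ => g s * (∫⁻ z in Iio s, g z ∂σ) ^ (q - 1))
      (hg.mul (hGm.pow_const _) |>.comp measurable_fst)]
  congr 1
  refine lintegral_congr fun s => ?_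
  rw [setLIntegral_const, mul_assoc]

/-- Boundedness, with constant `M`, of `g ↦ ∫_{s<t} k(s,t) g(s) dσ(s)` from `L^p(σ)` to
`L^q(ν)`. -/
def IsBddKernel (p q : ℝ) (σ ν : Measure ℝ) (k : ℝ → ℝ → ℝ≥0∞) (M : ℝ≥0∞) : Prop :=
  ∀ g : ℝ → ℝ≥0∞, Measurable g → ∫⁻ s, g s ^ p ∂σ ≠ ∞ →
    (∫⁻ t, (∫⁻ s in Iio t, k s t * g s ∂σ) ^ q ∂ν) ^ (1 / q) ≤ M * (∫⁻ s, g s ^ p ∂σ) ^ (1 / p)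

lemma IsBddKernel.mono {p q : ℝ} {σ ν : Measure ℝ} {k : ℝ → ℝ → ℝ≥0∞} {M M' : ℝ≥0∞}
    (h : IsBddKernel p q σ ν k M) (hM : M ≤ M') : IsBddKernel p q σ ν k M' :=
  fun g hg hP => (h g hg hP).trans (mul_le_mul_left hM _)

lemma setLIntegral_Iio_ne_top (σ : Measure ℝ) [IsFiniteMeasure σ] {p p' : ℝ}
    (hp : p.HolderConjugate p') {g : ℝ → ℝ≥0∞} (hg : Measurable g)
    (hP : ∫⁻ s, g s ^ p ∂σ ≠ ∞) (x : ℝ) : ∫⁻ s in Iio x, g s ∂σ ≠ ∞ := by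
  refine ne_top_of_le_ne_top ?_ (setLIntegral_Iio_le_rpow σ hp hg.aemeasurable x)
  exact ENNReal.mul_ne_top (ENNReal.rpow_ne_top_of_nonneg hp.one_div_nonneg hP)
    (ENNReal.rpow_ne_top_of_nonneg hp.symm.one_div_nonneg (measure_ne_top _ _))

/-- In g G^(q-1) ρ(s,∞), spend q - p powers of G on Hölder's bound G ≤ P^(1/p) V^(1/p'), and use
ρ(s,∞) ≤ S^q V^(-q/p'). The surviving power of V is exactly -(p-1), which leaves ∫ g (G/V)^(p-1),
controlled by the inequality for averages. -/
lemma hardy_lintegral_le_of_le (σ ρ : Measure ℝ) [IsFiniteMeasure σ] [NullSingletonClass σ]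
    [SFinite ρ] {p p' q : ℝ} (hp : p.HolderConjugate p') (hpq : p ≤ q) {S : ℝ≥0∞}
    (hS : ∀ x, ρ (Ioi x) ^ (1 / q) * σ (Iio x) ^ (1 / p') ≤ S) {g : ℝ → ℝ≥0∞}
    (hg : Measurable g) (hP : ∫⁻ s, g s ^ p ∂σ ≠ ∞) :
    ∫⁻ x, (∫⁻ s in Iio x, g s ∂σ) ^ q ∂ρ ≤
      ENNReal.ofReal q * ENNReal.ofReal p' ^ (p - 1) * S ^ q *
        (∫⁻ s, g s ^ p ∂σ) ^ (q / p) := by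
  have hp0 := hp.pos
  have hp'0 := hp.symm.pos
  have hq0 : 0 < q := hp0.trans_le hpq
  have hp1 := hp.sub_one_pos
  have hpp : p / p' = p - 1 := hp.div_conj_eq_sub_one
  have hinv : p⁻¹ + p'⁻¹ = 1 := hp.inv_add_inv_eq_one
  set P := ∫⁻ s, g s ^ p ∂σ with hPdef
  set V : ℝ → ℝ≥0∞ := fun x => σ (Iio x) with hV
  have hVm : Measurable V := measurable_measure_Iio σ
  set G : ℝ → ℝ≥0∞ := fun x => ∫⁻ s in Iio x, g s ∂σ with hG
  have hGm : Measurable G := (monotone_setLIntegral_Iio σ g).measurable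
  have hV0 : ∀ᵐ s ∂σ, V s ≠ 0 := ae_measure_Iio_ne_zero σ fun x => measure_ne_top _ _
  have hGt : ∀ x, G x ≠ ∞ := setLIntegral_Iio_ne_top σ hp hg hP
  have hGle : ∀ x, G x ≤ P ^ (1 / p) * V x ^ (1 / p') :=
    setLIntegral_Iio_le_rpow σ hp hg.aemeasurable
  have point : ∀ᵐ s ∂σ, G s ^ (q - 1) * ρ (Ioi s) ≤
      S ^ q * P ^ ((q - p) / p) * (G s / V s) ^ (p - 1) := by
    filter_upwards [hV0] with s hs
    have hst : V s ≠ ∞ := measure_ne_top _ _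
    have h1 : ρ (Ioi s) ≤ S ^ q * V s ^ (-(q / p')) := by
      have : ρ (Ioi s) = (ρ (Ioi s) ^ (1 / q) * V s ^ (1 / p')) ^ q * V s ^ (-(q / p')) := by
        rw [ENNReal.mul_rpow_of_nonneg _ _ hq0.le, rpow_mul_eq _ (c := 1) (by field_simp),
          rpow_mul_eq _ (c := q / p') (by field_simp), mul_assoc,
          rpow_add_eq hs hst (add_neg_cancel _), ENNReal.rpow_one, ENNReal.rpow_zero, mul_one]
      rw [this]
      gcongr
      exact hS s
    have h2 : G s ^ (q - 1) ≤ G s ^ (p - 1) * (P ^ (1 / p) * V s ^ (1 / p')) ^ (q - p) := by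
      rw [show q - 1 = (p - 1) + (q - p) by ring,
        ENNReal.rpow_add_of_nonneg _ _ hp1.le (sub_nonneg.mpr hpq)]
      gcongr
      exact hGle s
    calc G s ^ (q - 1) * ρ (Ioi s)
        ≤ (G s ^ (p - 1) * (P ^ (1 / p) * V s ^ (1 / p')) ^ (q - p)) *
          (S ^ q * V s ^ (-(q / p'))) := mul_le_mul' h2 h1
      _ = S ^ q * P ^ ((q - p) / p) * (G s ^ (p - 1) *
          (V s ^ ((q - p) / p') * V s ^ (-(q / p')))) := by
        rw [ENNReal.mul_rpow_of_nonneg _ _ (sub_nonneg.mpr hpq),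
          rpow_mul_eq _ (c := (q - p) / p) (by field_simp),
          rpow_mul_eq _ (c := (q - p) / p') (by field_simp)]
        ring
      _ = _ := by
        rw [rpow_add_eq hs hst (c := -(p - 1)) (by rw [← hpp]; field_simp; ring),
          ENNReal.div_rpow_of_nonneg _ _ hp1.le, ENNReal.rpow_neg, ENNReal.div_eq_inv_mul,
          mul_comm (V s ^ (p - 1))⁻¹]
  have hH : ∫⁻ s, g s * (G s / V s) ^ (p - 1) ∂σ ≤ ENNReal.ofReal p' ^ (p - 1) * P := by
    have h1 := lintegral_mul_le_rpow σ hp hg.aemeasurable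
      (g := fun s => (G s / V s) ^ (p - 1)) (by fun_prop)
    have h2 : ∀ s, ((G s / V s) ^ (p - 1)) ^ p' = (G s / V s) ^ p := by
      intro s
      refine rpow_mul_eq _ ?_
      rw [← hpp]; field_simp
    simp_rw [h2] at h1
    have h3 := lintegral_average_rpow_le σ (fun x => measure_ne_top _ _) hp hg
    refine h1.trans ((mul_le_mul_right (ENNReal.rpow_le_rpow h3 hp.symm.one_div_nonneg)
      _).trans (le_of_eq ?_))
    rw [ENNReal.mul_rpow_of_nonneg _ _ hp.symm.one_div_nonneg,
      rpow_mul_eq _ (c := p - 1) (by rw [← hpp]; ring), mul_left_comm,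
      ← ENNReal.rpow_add_of_nonneg _ _ hp.one_div_nonneg hp.symm.one_div_nonneg,
      one_div, one_div, hinv, ENNReal.rpow_one]
  rw [lintegral_Iio_rpow_eq σ ρ hg hGt hq0]
  calc ENNReal.ofReal q * ∫⁻ s, g s * (G s ^ (q - 1) * ρ (Ioi s)) ∂σ
      ≤ ENNReal.ofReal q * ∫⁻ s, (S ^ q * P ^ ((q - p) / p)) *
          (g s * (G s / V s) ^ (p - 1)) ∂σ := by
        refine mul_le_mul_right (lintegral_mono_ae ?_) _
        filter_upwards [point] with s hs
        rw [mul_left_comm (S ^ q * P ^ ((q - p) / p))]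
        exact mul_le_mul_right hs _
    _ = ENNReal.ofReal q * ((S ^ q * P ^ ((q - p) / p)) *
          ∫⁻ s, g s * (G s / V s) ^ (p - 1) ∂σ) := by
        rw [lintegral_const_mul _ (by fun_prop)]
    _ ≤ ENNReal.ofReal q * ((S ^ q * P ^ ((q - p) / p)) *
          (ENNReal.ofReal p' ^ (p - 1) * P)) := by gcongr
    _ = _ := by
        have : P ^ (q / p) = P ^ ((q - p) / p) * P := by
          nth_rw 3 [← ENNReal.rpow_one P]
          rw [← ENNReal.rpow_add_of_nonneg _ _ (div_nonneg (sub_nonneg.mpr hpq) hp0.le) zero_le_one]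
          congr 1; field_simp; ring
        rw [this]; ring

/-- Factor the integrand as g · (G/V)^(q-1) · (ρ(s,∞) V^(q-1)) and apply Hölder with the exponents
1/p, (q-1)/p and q/r, which sum to 1. The functional is kept as an integral against σ, so ρ may have
atoms; this is needed for the discrete ρ arising from the kernel operator. -/
lemma hardy_lintegral_le_of_lt (σ ρ : Measure ℝ) [IsFiniteMeasure σ] [NullSingletonClass σ]
    [SFinite ρ] {p p' q q' r : ℝ} (hp : p.HolderConjugate p') (hq : q.HolderConjugate q')
    (hr : r⁻¹ = q⁻¹ - p⁻¹) (hr0 : 0 < r) {g : ℝ → ℝ≥0∞}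
    (hg : Measurable g) (hP : ∫⁻ s, g s ^ p ∂σ ≠ ∞) :
    ∫⁻ x, (∫⁻ s in Iio x, g s ∂σ) ^ q ∂ρ ≤
      ENNReal.ofReal q * ENNReal.ofReal p' ^ (q - 1) *
      (∫⁻ x, ρ (Ioi x) ^ (r / q) * σ (Iio x) ^ (r / q') ∂σ) ^ (q / r) *
        (∫⁻ s, g s ^ p ∂σ) ^ (q / p) := by
  have hp0 := hp.pos
  have hq0 := hq.pos
  have hq'0 := hq.symm.pos
  have hq1 := hq.sub_one_pos
  have hqq : q / q' = q - 1 := hq.div_conj_eq_sub_one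
  set P := ∫⁻ s, g s ^ p ∂σ with hPdef
  set V : ℝ → ℝ≥0∞ := fun x => σ (Iio x) with hV
  have hVm : Measurable V := measurable_measure_Iio σ
  set G : ℝ → ℝ≥0∞ := fun x => ∫⁻ s in Iio x, g s ∂σ with hG
  have hGm : Measurable G := (monotone_setLIntegral_Iio σ g).measurable
  have hRm : Measurable fun s => ρ (Ioi s) := measurable_measure_Ioi ρ
  have hV0 : ∀ᵐ s ∂σ, V s ≠ 0 := ae_measure_Iio_ne_zero σ fun x => measure_ne_top _ _
  have hGt : ∀ x, G x ≠ ∞ := setLIntegral_Iio_ne_top σ hp hg hP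
  have h3 := lintegral_average_rpow_le σ (fun x => measure_ne_top _ _) hp hg
  set f : Fin 3 → ℝ → ℝ≥0∞ := ![fun s => g s ^ p, fun s => (G s / V s) ^ p,
    fun s => ρ (Ioi s) ^ (r / q) * V s ^ (r / q')] with hf
  set e : Fin 3 → ℝ := ![1 / p, (q - 1) / p, q / r] with he
  have hsum : ∑ i, e i = 1 := by
    simp only [he, Fin.sum_univ_three, Matrix.cons_val_zero, Matrix.cons_val_one,
      Matrix.cons_val]
    have : q / r = q * r⁻¹ := rfl
    rw [this, hr]; field_simp; ring
  have hfm : ∀ i ∈ Finset.univ, AEMeasurable (f i) σ := by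
    intro i _
    fin_cases i
    · exact (hg.pow_const _).aemeasurable
    · exact ((hGm.div hVm).pow_const _).aemeasurable
    · exact ((hRm.pow_const _).mul (hVm.pow_const _)).aemeasurable
  have hen : ∀ i ∈ Finset.univ, 0 ≤ e i := by
    intro i _
    fin_cases i
    · exact hp.one_div_nonneg
    · exact div_nonneg hq1.le hp0.le
    · exact div_nonneg hq0.le hr0.le
  have hHolder := ENNReal.lintegral_prod_norm_pow_le Finset.univ hfm hsum hen
  simp only [Fin.prod_univ_three] at hHolder
  rw [lintegral_Iio_rpow_eq σ ρ hg hGt hq0]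
  have h1 : ∫⁻ s, g s * (G s ^ (q - 1) * ρ (Ioi s)) ∂σ
      = ∫⁻ s, f 0 s ^ e 0 * f 1 s ^ e 1 * f 2 s ^ e 2 ∂σ := by
    refine lintegral_congr_ae ?_
    filter_upwards [hV0] with s hs
    have hst : V s ≠ ∞ := measure_ne_top _ _
    have e0 : f 0 s ^ e 0 = g s := by
      change (g s ^ p) ^ (1 / p) = g s
      rw [rpow_mul_eq _ (c := 1) (by field_simp), ENNReal.rpow_one]
    have e1 : f 1 s ^ e 1 = G s ^ (q - 1) * V s ^ (-(q - 1)) := by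
      change ((G s / V s) ^ p) ^ ((q - 1) / p) = _
      rw [rpow_mul_eq _ (c := q - 1) (by field_simp), ENNReal.div_rpow_of_nonneg _ _ hq1.le,
        ENNReal.rpow_neg, div_eq_mul_inv]
    have e2 : f 2 s ^ e 2 = ρ (Ioi s) * V s ^ (q - 1) := by
      change (ρ (Ioi s) ^ (r / q) * V s ^ (r / q')) ^ (q / r) = _
      rw [ENNReal.mul_rpow_of_nonneg _ _ (by positivity), rpow_mul_eq _ (c := 1) (by field_simp),
        ENNReal.rpow_one, rpow_mul_eq _ (c := q - 1) (by rw [← hqq]; field_simp)]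
    rw [e0, e1, e2]
    calc g s * (G s ^ (q - 1) * ρ (Ioi s))
        = g s * (G s ^ (q - 1) * ρ (Ioi s)) * (V s ^ (-(q - 1)) * V s ^ (q - 1)) := by
          rw [rpow_add_eq hs hst (neg_add_cancel _), ENNReal.rpow_zero, mul_one]
      _ = _ := by ring
  rw [h1]
  calc ENNReal.ofReal q * ∫⁻ s, f 0 s ^ e 0 * f 1 s ^ e 1 * f 2 s ^ e 2 ∂σ
      ≤ ENNReal.ofReal q * (P ^ (1 / p) * (∫⁻ s, (G s / V s) ^ p ∂σ) ^ ((q - 1) / p) *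
        (∫⁻ x, ρ (Ioi x) ^ (r / q) * V x ^ (r / q') ∂σ) ^ (q / r)) :=
        mul_le_mul_right hHolder _
    _ ≤ ENNReal.ofReal q * (P ^ (1 / p) * (ENNReal.ofReal p' ^ p * P) ^ ((q - 1) / p) *
        (∫⁻ x, ρ (Ioi x) ^ (r / q) * V x ^ (r / q') ∂σ) ^ (q / r)) := by
        gcongr
    _ = _ := by
        rw [ENNReal.mul_rpow_of_nonneg _ _ (div_nonneg hq1.le hp0.le),
          rpow_mul_eq _ (c := q - 1) (by field_simp)]
        have : P ^ (q / p) = P ^ (1 / p) * P ^ ((q - 1) / p) := by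
          rw [← ENNReal.rpow_add_of_nonneg _ _ hp.one_div_nonneg (div_nonneg hq1.le hp0.le)]
          congr 1; field_simp; ring
        rw [this]; ring

/-! ### Reflection of the line, exchanging left and right -/

section Reflection

/-- The image of a measure under `x ↦ -x`. -/
def reflect (μ : Measure ℝ) : Measure ℝ := μ.map (MeasurableEquiv.neg ℝ)

lemma lintegral_reflect (μ : Measure ℝ) (f : ℝ → ℝ≥0∞) :
    ∫⁻ x, f x ∂(reflect μ) = ∫⁻ x, f (-x) ∂μ := lintegral_map_equiv f _

lemma reflect_apply (μ : Measure ℝ) (s : Set ℝ) : reflect μ s = μ (Neg.neg ⁻¹' s) :=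
  MeasurableEquiv.map_apply _ s

lemma reflect_Iio (μ : Measure ℝ) (x : ℝ) : reflect μ (Iio x) = μ (Ioi (-x)) := by
  rw [reflect_apply]; congr 1; ext y; simp

lemma reflect_Ioi (μ : Measure ℝ) (x : ℝ) : reflect μ (Ioi x) = μ (Iio (-x)) := by
  rw [reflect_apply]; congr 1; ext y; simp

lemma setLIntegral_reflect_Iio (μ : Measure ℝ) (f : ℝ → ℝ≥0∞) (x : ℝ) :
    ∫⁻ s in Iio x, f s ∂(reflect μ) = ∫⁻ s in Ioi (-x), f (-s) ∂μ := by
  rw [← lintegral_indicator measurableSet_Iio, lintegral_reflect,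
    ← lintegral_indicator measurableSet_Ioi]
  refine lintegral_congr fun s => ?_
  by_cases h : -s < x
  · have h' : -x < s := by linarith
    simp [h, h']
  · have h' : ¬ -x < s := by intro h2; exact h (by linarith)
    simp [h, h']

lemma setLIntegral_reflect_Ioi (μ : Measure ℝ) (f : ℝ → ℝ≥0∞) (x : ℝ) :
    ∫⁻ s in Ioi x, f s ∂(reflect μ) = ∫⁻ s in Iio (-x), f (-s) ∂μ := by
  rw [← lintegral_indicator measurableSet_Ioi, lintegral_reflect,
    ← lintegral_indicator measurableSet_Iio]
  refine lintegral_congr fun s => ?_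
  by_cases h : x < -s
  · have h' : s < -x := by linarith
    simp [h, h']
  · have h' : ¬ s < -x := by intro h2; exact h (by linarith)
    simp [h, h']

instance (μ : Measure ℝ) [NullSingletonClass μ] : NullSingletonClass (reflect μ) :=
  ⟨fun x => by
    have : Neg.neg ⁻¹' {x} = {-x} := by ext y; simp
    rw [reflect_apply, this, measure_singleton]⟩

instance (μ : Measure ℝ) [SigmaFinite μ] : SigmaFinite (reflect μ) :=
  (MeasurableEquiv.neg ℝ).sigmaFinite_map

lemma rpow_eq_mul_setLIntegral_Ioi (σ : Measure ℝ) [NullSingletonClass σ] {x : ℝ}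
    (hx : σ (Ioi x) ≠ ∞) {α : ℝ} (hα : 0 < α) :
    σ (Ioi x) ^ α = ENNReal.ofReal α * ∫⁻ s in Ioi x, σ (Ioi s) ^ (α - 1) ∂σ := by
  have := rpow_eq_mul_setLIntegral (reflect σ) (x := -x) (by simpa [reflect_Iio] using hx) hα
  rw [reflect_Iio, neg_neg, setLIntegral_reflect_Iio, neg_neg] at this
  simpa only [reflect_Iio, neg_neg] using this

end Reflection

/-- Integration by parts for the Hardy functional. -/
lemma lintegral_hardy_by_parts (σ ρ : Measure ℝ) [IsFiniteMeasure σ] [IsFiniteMeasure ρ]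
    [NullSingletonClass σ] [NullSingletonClass ρ] {p p' q q' r : ℝ} (hp : p.HolderConjugate p')
    (hq : q.HolderConjugate q') (hr : r⁻¹ = q⁻¹ - p⁻¹) (hr0 : 0 < r) :
    ∫⁻ x, ρ (Ioi x) ^ (r / q) * σ (Iio x) ^ (r / q') ∂σ =
      ENNReal.ofReal (r / q) * (ENNReal.ofReal (r / p'))⁻¹ *
        ∫⁻ y, ρ (Ioi y) ^ (r / p) * σ (Iio y) ^ (r / p') ∂ρ := by
  have hp0 := hp.pos
  have hp'0 := hp.symm.pos
  have hq0 := hq.pos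
  have hinvp : p⁻¹ + p'⁻¹ = 1 := hp.inv_add_inv_eq_one
  have hinvq : q⁻¹ + q'⁻¹ = 1 := hq.inv_add_inv_eq_one
  have hrr : r * r⁻¹ = 1 := mul_inv_cancel₀ hr0.ne'
  -- These two identities, both forms of 1/r = 1/q - 1/p, make the exponents match: the ρ-power is
  -- expanded by its chain rule, the integrals are swapped, and the σ-power is integrated back
  -- exactly.
  have e1 : r / q - 1 = r / p := by
    rw [div_eq_mul_inv, div_eq_mul_inv]; linear_combination hrr - r * hr
  have e2 : r / p' - 1 = r / q' := by
    rw [div_eq_mul_inv, div_eq_mul_inv]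
    linear_combination hrr - r * hr - r * hinvq + r * hinvp
  have hσm := measurable_measure_Iio σ
  have hρm := measurable_measure_Ioi ρ
  have h1 : ∀ x, ρ (Ioi x) ^ (r / q) * σ (Iio x) ^ (r / q') = ENNReal.ofReal (r / q) *
      ∫⁻ y in Ioi x, ρ (Ioi y) ^ (r / p) * σ (Iio x) ^ (r / q') ∂ρ := by
    intro x
    rw [rpow_eq_mul_setLIntegral_Ioi ρ (measure_ne_top _ _) (div_pos hr0 hq0), e1,
      lintegral_mul_const _ (hρm.pow_const _), mul_assoc]
  simp_rw [h1]
  rw [lintegral_const_mul' _ _ ENNReal.ofReal_ne_top, ← lintegral_setLIntegral_swap σ ρ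
    (F := fun x y => ρ (Ioi y) ^ (r / p) * σ (Iio x) ^ (r / q'))
    (((hρm.comp measurable_snd).pow_const _).mul ((hσm.comp measurable_fst).pow_const _)),
    mul_assoc]
  congr 1
  have hct : (ENNReal.ofReal (r / p'))⁻¹ ≠ ∞ := by simpa using div_pos hr0 hp'0
  rw [← lintegral_const_mul' _ _ hct]
  refine lintegral_congr fun y => ?_
  rw [lintegral_const_mul _ (hσm.pow_const _), ← e2,
    setLIntegral_Iio_rpow σ (measure_ne_top _ _) (div_pos hr0 hp'0)]
  ring

/-! ### Passage from finite to σ-finite measures -/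

section Truncation

lemma setLIntegral_iUnion_iSup {μ : Measure ℝ} {E : ℕ → Set ℝ} (hE : Monotone E)
    (hEm : ∀ n, MeasurableSet (E n)) (hcov : ∀ᵐ x ∂μ, x ∈ ⋃ n, E n) {f : ℕ → ℝ → ℝ≥0∞}
    (hf : ∀ n, Measurable (f n)) (hmono : Monotone f) :
    ∫⁻ x, ⨆ n, f n x ∂μ = ⨆ n, ∫⁻ x in E n, f n x ∂μ := by
  have h1 : ∀ n, ∫⁻ x in E n, f n x ∂μ = ∫⁻ x, (E n).indicator (f n) x ∂μ :=
    fun n => (lintegral_indicator (hEm n) _).symm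
  simp_rw [h1]
  have hmono' : Monotone fun n => (E n).indicator (f n) := by
    intro m n hmn x
    dsimp only
    by_cases hx : x ∈ E m
    · rw [indicator_of_mem hx, indicator_of_mem (hE hmn hx)]
      exact hmono hmn x
    · rw [indicator_of_notMem hx]; exact zero_le
  rw [← lintegral_iSup (fun n => (hf n).indicator (hEm n)) hmono']
  refine lintegral_congr_ae ?_
  filter_upwards [hcov] with x hx
  obtain ⟨n₀, hn₀⟩ := mem_iUnion.mp hx
  apply le_antisymm
  · refine iSup_le fun n => le_iSup_of_le (max n n₀) ?_
    rw [indicator_of_mem (hE (le_max_right _ _) hn₀)]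
    exact hmono (le_max_left _ _) x
  · exact iSup_mono fun n => indicator_le_self _ _ _

lemma setLIntegral_iUnion_eq_iSup {μ : Measure ℝ} {E : ℕ → Set ℝ} (hE : Monotone E)
    (hcov : ∀ᵐ x ∂μ, x ∈ ⋃ n, E n) {f : ℝ → ℝ≥0∞} :
    ∫⁻ x, f x ∂μ = ⨆ n, ∫⁻ x in E n, f x ∂μ := by
  rw [← setLIntegral_iUnion_of_directed _ (hE.directed_le), Measure.restrict_eq_self_of_ae_mem hcov]

lemma measure_iUnion_eq_iSup_inter {μ : Measure ℝ} {E : ℕ → Set ℝ} (hE : Monotone E)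
    (hcov : ∀ᵐ x ∂μ, x ∈ ⋃ n, E n) {A : Set ℝ}
    (hA : MeasurableSet A) : μ A = ⨆ n, (μ.restrict (E n)) A := by
  have := setLIntegral_iUnion_eq_iSup (μ := μ) hE hcov (f := A.indicator 1)
  simpa only [lintegral_indicator_one hA] using this

lemma rpow_iSup {ι : Type*} (f : ι → ℝ≥0∞) {q : ℝ} (hq : 0 < q) :
    (⨆ i, f i) ^ q = ⨆ i, f i ^ q :=
  (ENNReal.orderIsoRpow q hq).map_iSup f

lemma iSup_mul_iSup_of_monotone {f g : ℕ → ℝ≥0∞} (hf : Monotone f) (hg : Monotone g) :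
    (⨆ n, f n) * (⨆ n, g n) = ⨆ n, f n * g n := by
  rw [ENNReal.iSup_mul]
  simp_rw [ENNReal.mul_iSup]
  apply le_antisymm
  · refine iSup_le fun i => iSup_le fun j => le_iSup_of_le (max i j) ?_
    exact mul_le_mul' (hf (le_max_left _ _)) (hg (le_max_right _ _))
  · exact iSup_le fun n => le_iSup_of_le n (le_iSup_of_le n le_rfl)

lemma restrict_mono_apply {μ : Measure ℝ} {E : ℕ → Set ℝ} (hE : Monotone E) (A : Set ℝ) :
    Monotone fun n => (μ.restrict (E n)) A :=
  fun _ _ h => Measure.restrict_mono_set μ (hE h) A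

lemma setLIntegral_mono_restrict {μ : Measure ℝ} {E : ℕ → Set ℝ} (hE : Monotone E)
    (f : ℝ → ℝ≥0∞) (A : Set ℝ) : Monotone fun n => ∫⁻ s in A, f s ∂(μ.restrict (E n)) :=
  fun _ _ h => lintegral_mono' (Measure.restrict_mono_measure (Measure.restrict_mono_set μ (hE h)) A)
    le_rfl

/-- Monotone convergence in both measures simultaneously; it works because M does not depend on n.
Finiteness assumptions can thus be made in every sufficiency proof. -/
lemma IsBddKernel.of_restrict {p q : ℝ} (hp : 0 < p) (hq : 0 < q) {σ ν : Measure ℝ} [SFinite σ]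
    {k : ℝ → ℝ → ℝ≥0∞} (hk : Measurable (Function.uncurry k)) {M : ℝ≥0∞} {E F : ℕ → Set ℝ}
    (hE : Monotone E) (hEm : ∀ n, MeasurableSet (E n)) (hEc : ∀ᵐ x ∂σ, x ∈ ⋃ n, E n)
    (hF : Monotone F) (hFm : ∀ n, MeasurableSet (F n)) (hFc : ∀ᵐ x ∂ν, x ∈ ⋃ n, F n)
    (h : ∀ n, IsBddKernel p q (σ.restrict (E n)) (ν.restrict (F n)) k M) :
    IsBddKernel p q σ ν k M := by
  intro g hg hP
  have hEc' : ∀ t, ∀ᵐ x ∂(σ.restrict (Iio t)), x ∈ ⋃ n, E n := fun t => ae_restrict_of_ae hEc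
  have hcomm : ∀ n t, ∫⁻ s in Iio t, k s t * g s ∂(σ.restrict (E n))
      = ∫⁻ s in E n, k s t * g s ∂(σ.restrict (Iio t)) := by
    intro n t
    rw [Measure.restrict_restrict measurableSet_Iio, Measure.restrict_restrict (hEm n), inter_comm]
  have h1 : ∀ t, (∫⁻ s in Iio t, k s t * g s ∂σ) ^ q
      = ⨆ n, (∫⁻ s in Iio t, k s t * g s ∂(σ.restrict (E n))) ^ q := by
    intro t
    rw [setLIntegral_iUnion_eq_iSup hE (hEc' t), rpow_iSup _ hq]
    simp_rw [hcomm]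
  simp_rw [h1]
  rw [setLIntegral_iUnion_iSup hF hFm hFc, rpow_iSup _ (one_div_pos.mpr hq)]
  · refine iSup_le fun n => (h n g hg ?_).trans ?_
    · exact ne_top_of_le_ne_top hP (lintegral_mono' Measure.restrict_le_self le_rfl)
    · refine mul_le_mul_right (ENNReal.rpow_le_rpow ?_ (one_div_nonneg.mpr hp.le)) _
      exact lintegral_mono' Measure.restrict_le_self le_rfl
  · intro n
    refine (measurable_setLIntegral_Iio _ (F := fun s t => k s t * g s) ?_).pow_const _
    exact hk.mul (hg.comp measurable_fst)
  · exact fun m n hmn t => ENNReal.rpow_le_rpow (setLIntegral_mono_restrict hE _ _ hmn) hq.le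

lemma ae_mem_iUnion_spanningSets (μ : Measure ℝ) [SigmaFinite μ] :
    ∀ᵐ x ∂μ, x ∈ ⋃ n, spanningSets μ n := by
  simp [iUnion_spanningSets]

instance (μ : Measure ℝ) [SigmaFinite μ] (n : ℕ) :
    IsFiniteMeasure (μ.restrict (spanningSets μ n)) :=
  ⟨by simpa using measure_spanningSets_lt_top μ n⟩

end Truncation

/-! ### Hardy's inequality for σ-finite measures -/

lemma rpow_root_le {X P A S C : ℝ≥0∞} {p q : ℝ} (hp : 0 < p) (hq : 0 < q)
    (h : X ≤ A * S ^ q * P ^ (q / p)) (hA : A ^ (1 / q) ≤ C) :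
    X ^ (1 / q) ≤ C * S * P ^ (1 / p) := by
  refine (ENNReal.rpow_le_rpow h (one_div_nonneg.mpr hq.le)).trans ?_
  rw [ENNReal.mul_rpow_of_nonneg _ _ (one_div_nonneg.mpr hq.le),
    ENNReal.mul_rpow_of_nonneg _ _ (one_div_nonneg.mpr hq.le),
    rpow_mul_eq S (c := 1) (by field_simp), rpow_mul_eq P (c := 1 / p) (by field_simp),
    ENNReal.rpow_one]
  gcongr

/-- Hardy's inequality for two measures, `p ≤ q`. -/
theorem exists_hardy_of_le {p p' q : ℝ} (hp : p.HolderConjugate p') (hpq : p ≤ q) :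
    ∃ C : ℝ≥0, ∀ (σ ν : Measure ℝ) [SigmaFinite σ] [SigmaFinite ν] [NullSingletonClass σ]
      (S : ℝ≥0∞), (∀ x, ν (Ioi x) ^ (1 / q) * σ (Iio x) ^ (1 / p') ≤ S) →
      IsBddKernel p q σ ν (fun _ _ => 1) (C * S) := by
  have hq0 : 0 < q := hp.pos.trans_le hpq
  refine ⟨((ENNReal.ofReal q * ENNReal.ofReal p' ^ (p - 1)) ^ (1 / q)).toNNReal, ?_⟩
  intro σ ν _ _ _ S hS
  refine IsBddKernel.of_restrict hp.pos hq0 (by fun_prop) (monotone_spanningSets σ)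
    (measurableSet_spanningSets σ) (ae_mem_iUnion_spanningSets σ) (monotone_spanningSets ν)
    (measurableSet_spanningSets ν) (ae_mem_iUnion_spanningSets ν) fun n g hg hP => ?_
  simp only [one_mul]
  refine rpow_root_le hp.pos hq0 (hardy_lintegral_le_of_le _ _ hp hpq (S := S) ?_ hg hP)
    (le_of_eq ?_)
  · intro x
    refine le_trans (mul_le_mul' ?_ ?_) (hS x)
    · exact ENNReal.rpow_le_rpow (Measure.restrict_le_self _) (one_div_nonneg.mpr hq0.le)
    · exact ENNReal.rpow_le_rpow (Measure.restrict_le_self _) hp.symm.one_div_nonneg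
  · rw [ENNReal.coe_toNNReal]
    refine ENNReal.rpow_ne_top_of_nonneg (one_div_nonneg.mpr hq0.le) (ENNReal.mul_ne_top
      ENNReal.ofReal_ne_top (ENNReal.rpow_ne_top_of_nonneg hp.sub_one_pos.le ENNReal.ofReal_ne_top))

/-- Hardy's inequality for two measures, `q < p`. -/
theorem exists_hardy_of_lt {p p' q q' r : ℝ} (hp : p.HolderConjugate p')
    (hq : q.HolderConjugate q') (hr : r⁻¹ = q⁻¹ - p⁻¹) (hr0 : 0 < r) :
    ∃ C : ℝ≥0, ∀ (σ ν : Measure ℝ) [SigmaFinite σ] [SigmaFinite ν] [NullSingletonClass σ]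
      [NullSingletonClass ν],
      IsBddKernel p q σ ν (fun _ _ => 1)
        (C * (∫⁻ y, ν (Ioi y) ^ (r / p) * σ (Iio y) ^ (r / p') ∂ν) ^ (1 / r)) := by
  have hq0 := hq.pos
  have hqr : 0 ≤ q / r := div_nonneg hq0.le hr0.le
  set D : ℝ≥0∞ := ENNReal.ofReal (r / q) * (ENNReal.ofReal (r / p'))⁻¹ with hD
  have hDt : D ≠ ∞ := ENNReal.mul_ne_top ENNReal.ofReal_ne_top
    (by simpa using div_pos hr0 hp.symm.pos)
  refine ⟨((ENNReal.ofReal q * ENNReal.ofReal p' ^ (q - 1) * D ^ (q / r)) ^ (1 / q)).toNNReal, ?_⟩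
  intro σ ν _ _ _ _
  refine IsBddKernel.of_restrict hp.pos hq0 (by fun_prop) (monotone_spanningSets σ)
    (measurableSet_spanningSets σ) (ae_mem_iUnion_spanningSets σ) (monotone_spanningSets ν)
    (measurableSet_spanningSets ν) (ae_mem_iUnion_spanningSets ν) fun n g hg hP => ?_
  simp only [one_mul]
  refine rpow_root_le hp.pos hq0 ?_ (le_of_eq ?_)
    (A := ENNReal.ofReal q * ENNReal.ofReal p' ^ (q - 1) * D ^ (q / r))
  · refine (hardy_lintegral_le_of_lt _ _ hp hq hr hr0 hg hP).trans ?_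
    rw [lintegral_hardy_by_parts _ _ hp hq hr hr0, ← hD, ENNReal.mul_rpow_of_nonneg _ _ hqr,
      rpow_mul_eq _ (c := q / r) (by field_simp), ← mul_assoc]
    have h1 : 0 ≤ r / p := div_nonneg hr0.le hp.pos.le
    have h2 : 0 ≤ r / p' := div_nonneg hr0.le hp.symm.pos.le
    gcongr <;> first | assumption | exact Measure.restrict_le_self
  · rw [ENNReal.coe_toNNReal]
    refine ENNReal.rpow_ne_top_of_nonneg (one_div_nonneg.mpr hq0.le) (ENNReal.mul_ne_top
      (ENNReal.mul_ne_top ENNReal.ofReal_ne_top (ENNReal.rpow_ne_top_of_nonneg hq.sub_one_pos.le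
        ENNReal.ofReal_ne_top)) (ENNReal.rpow_ne_top_of_nonneg hqr hDt))

/-! ### The kernel operator: decomposition into blocks and upper bounds -/

lemma exists_measure_Iio_eq (η : Measure ℝ) [NullSingletonClass η] {x : ℝ} (hx : η (Iio x) ≠ ∞)
    {c : ℝ≥0∞} (h0 : c ≠ 0) (hc : c < η (Iio x)) : ∃ y, η (Iio y) = c := by
  have : IsFiniteMeasure (η.restrict (Iio x)) := ⟨by simpa using hx.lt_top⟩
  have hct : c ≠ ∞ := hc.ne_top
  obtain ⟨y, hy⟩ := exists_real_Iio_eq (η.restrict (Iio x)) (c := c.toReal)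
    (ENNReal.toReal_pos h0 hct) (by
      rw [Measure.real, Measure.restrict_apply_univ]
      exact (ENNReal.toReal_lt_toReal hct hx).mpr hc)
  rw [Measure.real, Measure.restrict_apply measurableSet_Iio, Iio_inter_Iio] at hy
  have hyt : η (Iio (y ⊓ x)) ≠ ∞ :=
    ne_top_of_le_ne_top hx (monotone_measure_Iio η inf_le_right)
  exact ⟨y ⊓ x, (ENNReal.toReal_eq_toReal_iff' hyt hct).mp hy⟩

lemma measurable_measure_Ioo (κ : Measure ℝ) [SFinite κ] :
    Measurable (Function.uncurry fun s x => κ (Ioo s x)) := by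
  have h : (Function.uncurry fun s x => κ (Ioo s x))
      = fun z : ℝ × ℝ => ∫⁻ τ, {w : (ℝ × ℝ) × ℝ | w.1.1 < w.2 ∧ w.2 < w.1.2}.indicator 1 (z, τ)
          ∂κ := by
    ext ⟨s, x⟩
    rw [Function.uncurry_apply_pair, ← lintegral_indicator_one measurableSet_Ioo]
    rfl
  rw [h]
  refine (measurable_one.indicator ?_).lintegral_prod_right'
  exact (measurableSet_lt measurable_fst.fst measurable_snd).inter
    (measurableSet_lt measurable_snd measurable_fst.snd)

/-- Fubini exhibits the kernel operator as the distribution function of the measure G dκ. That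
measure is atomless when κ is, so intermediate values exist without any assumption on atoms of σ. -/
lemma setLIntegral_primitive_eq (σ κ : Measure ℝ) [SFinite σ] [SFinite κ]
    {g : ℝ → ℝ≥0∞} (hg : Measurable g) (x : ℝ) :
    ∫⁻ τ in Iio x, ∫⁻ s in Iio τ, g s ∂σ ∂κ = ∫⁻ s in Iio x, κ (Ioo s x) * g s ∂σ := by
  rw [lintegral_setLIntegral_swap σ (κ.restrict (Iio x)) (F := fun s _ => g s)
    (hg.comp measurable_fst), ← lintegral_indicator measurableSet_Iio]
  refine lintegral_congr fun s => ?_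
  rw [setLIntegral_const, Measure.restrict_apply measurableSet_Ioi, Ioi_inter_Iio, mul_comm]
  by_cases hs : s ∈ Iio x
  · rw [indicator_of_mem hs]
  · rw [indicator_of_notMem hs, Ioo_eq_empty (by simpa using hs), measure_empty, zero_mul]

/-- The Oinarov property of the kernel; it is the only structural fact about κ(s,x), besides
monotonicity, behind the block estimate. -/
lemma measure_Ioo_le_add (κ : Measure ℝ) [NullSingletonClass κ] (s a b : ℝ) :
    κ (Ioo s b) ≤ κ (Ioo s a) + κ (Ioo a b) := by
  have h : Ioo s b ⊆ Ioo s a ∪ Ioo a b ∪ {a} := by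
    intro t ht
    rcases lt_trichotomy t a with h | h | h
    · exact Or.inl (Or.inl ⟨ht.1, h⟩)
    · exact Or.inr h
    · exact Or.inl (Or.inr ⟨h, ht.2⟩)
  refine (measure_mono h).trans ((measure_union_le _ _).trans ?_)
  rw [measure_singleton, add_zero]
  exact measure_union_le _ _

/-- Blocks on which the iterated integral `∫_{s<x} κ(s,x) g(s) dσ(s)` is comparable to a power
of four. -/
lemma exists_blocks (σ κ : Measure ℝ) [SFinite σ] [SFinite κ] [NullSingletonClass κ]
    {g : ℝ → ℝ≥0∞} (hg : Measurable g)
    (hF : ∀ x, ∫⁻ s in Iio x, κ (Ioo s x) * g s ∂σ ≠ ∞) :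
    ∃ (y : ℤ → ℝ) (I : ℤ → Set ℝ), (∀ j, MeasurableSet (I j)) ∧ Pairwise (Function.onFun Disjoint I) ∧
      (∀ j, ∀ x ∈ I j, y (j - 1) < y j ∧ y j < x) ∧
      (∀ i j, i < j → (I j).Nonempty → y i ≤ y (j - 1)) ∧
      (∀ x, ∫⁻ s in Iio x, κ (Ioo s x) * g s ∂σ ≠ 0 → ∃ j, x ∈ I j) ∧
      ∀ j, ∀ x ∈ I j, ∫⁻ s in Iio x, κ (Ioo s x) * g s ∂σ ≤
        6 * (κ (Ioo (y (j - 1)) x) * ∫⁻ s in Iio (y (j - 1)), g s ∂σ +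
          ∫⁻ s in Ico (y (j - 1)) (y j), κ (Ioo s (y j)) * g s ∂σ) := by
  set η := κ.withDensity fun τ => ∫⁻ s in Iio τ, g s ∂σ with hη
  have hηF : ∀ x, η (Iio x) = ∫⁻ s in Iio x, κ (Ioo s x) * g s ∂σ := fun x => by
    rw [hη, withDensity_Iio, setLIntegral_primitive_eq σ κ hg]
  simp_rw [← hηF] at hF ⊢
  set F : ℝ → ℝ≥0∞ := fun x => η (Iio x) with hFdef
  have hFmono : Monotone F := monotone_measure_Iio η
  have h40 : (4 : ℝ≥0∞) ≠ 0 := by norm_num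
  have h4t : (4 : ℝ≥0∞) ≠ ∞ := by norm_num
  have hpow0 : ∀ j : ℤ, (4 : ℝ≥0∞) ^ j ≠ 0 := fun j => (ENNReal.zpow_pos h40 h4t j).ne'
  have hpowt : ∀ j : ℤ, (4 : ℝ≥0∞) ^ j ≠ ∞ := fun j => (ENNReal.zpow_lt_top h40 h4t j).ne
  have hstep : ∀ j : ℤ, (4 : ℝ≥0∞) ^ (j + 1) = 4 * 4 ^ j := fun j => by
    rw [ENNReal.zpow_add h40 h4t, zpow_one, mul_comm]
  have hstrict : ∀ {i j : ℤ}, i < j → (4 : ℝ≥0∞) ^ i < 4 ^ j := by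
    intro i j hij
    refine lt_of_lt_of_le ?_ (ENNReal.zpow_le_of_le (by norm_num) (Int.add_one_le_iff.mpr hij))
    rw [hstep]
    have := ENNReal.mul_lt_mul_left (hpow0 i) (hpowt i) (b := 1) (c := 4) (by norm_num)
    rwa [one_mul] at this
  set I : ℤ → Set ℝ := fun j => F ⁻¹' Ioc (4 ^ j) (4 ^ (j + 1)) with hI
  -- A level 4^j that is never attained receives the junk point 0. Such points play no role: if I_j
  -- is nonempty, the levels up to j are attained by the intermediate value theorem.
  choose y hy using fun j : ℤ => (by
    by_cases h : ∃ z, F z = 4 ^ j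
    · obtain ⟨z, hz⟩ := h; exact ⟨z, fun _ => hz⟩
    · exact ⟨0, fun h' => absurd h' h⟩ : ∃ y, (∃ z, F z = 4 ^ j) → F y = 4 ^ j)
  have hval : ∀ i j, i ≤ j → (I j).Nonempty → F (y i) = 4 ^ i := by
    rintro i j hij ⟨x, hx⟩
    refine hy i (exists_measure_Iio_eq η (hF x) (hpow0 i) ?_)
    exact (ENNReal.zpow_le_of_le (by norm_num) hij).trans_lt hx.1
  have hlt : ∀ {a b}, F a < F b → a < b := fun {a b} h => by
    by_contra hc
    exact absurd (hFmono (not_lt.mp hc)) (not_le.mpr h)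
  refine ⟨y, I, fun j => (measurable_measure_Iio η) measurableSet_Ioc, ?_, ?_, ?_, ?_, ?_⟩
  · refine (pairwise_disjoint_on I).mpr fun i j hij => ?_
    refine Disjoint.preimage _ (disjoint_left.mpr fun z h1 h2 => ?_)
    have := ENNReal.zpow_le_of_le (x := (4 : ℝ≥0∞)) (by norm_num) (Int.add_one_le_iff.mpr hij)
    exact absurd (h2.1.trans_le h1.2) (not_lt.mpr this)
  · intro j x hx
    refine ⟨hlt ?_, hlt ?_⟩
    · rw [hval (j - 1) j (by omega) ⟨x, hx⟩, hval j j le_rfl ⟨x, hx⟩]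
      exact hstrict (by omega)
    · rw [hval j j le_rfl ⟨x, hx⟩]
      exact hx.1
  · intro i j hij hne
    rcases eq_or_lt_of_le (by omega : i ≤ j - 1) with h | h
    · rw [h]
    · refine (hlt ?_).le
      rw [hval i j hij.le hne, hval (j - 1) j (by omega) hne]
      exact hstrict h
  · intro x hx
    exact ENNReal.exists_mem_Ioc_zpow hx (hF x) (by norm_num) h4t
  · intro j x hx
    set a := y (j - 1)
    set b := y j
    have hFa : F a = 4 ^ (j - 1) := hval (j - 1) j (by omega) ⟨x, hx⟩
    have hFb : F b = 4 ^ j := hval j j le_rfl ⟨x, hx⟩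
    have hab : a < b := hlt (by rw [hFa, hFb]; exact hstrict (by omega))
    have hbx : b < x := hlt (by rw [hFb]; exact hx.1)
    set T := κ (Ioo a x) * ∫⁻ s in Iio a, g s ∂σ +
          ∫⁻ s in Ico a b, κ (Ioo s b) * g s ∂σ with hT
    -- Split at a. For s < a use κ(s,b) ≤ κ(s,a) + κ(a,b) and b < x; the first summand rebuilds F a
    -- and the rest is T.
    have h1 : F b ≤ F a + T := by
      have hsplit : F b = ∫⁻ s in Iio a, κ (Ioo s b) * g s ∂σ +
          ∫⁻ s in Ico a b, κ (Ioo s b) * g s ∂σ := by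
        rw [hFdef]
        simp only
        rw [hηF, ← Iio_union_Ico_eq_Iio hab.le, lintegral_union measurableSet_Ico]
        exact disjoint_left.mpr fun z hz hz' => absurd hz'.1 (not_le.mpr hz)
      have hle : ∫⁻ s in Iio a, κ (Ioo s b) * g s ∂σ ≤
          F a + κ (Ioo a x) * ∫⁻ s in Iio a, g s ∂σ := by
        rw [hFdef]
        simp only
        rw [hηF, ← lintegral_const_mul _ hg, ← lintegral_add_right _ (by fun_prop)]
        refine lintegral_mono fun s => ?_
        rw [← add_mul]
        refine mul_le_mul_left ((measure_Ioo_le_add κ s a b).trans ?_) _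
        gcongr
      rw [hsplit, hT, ← add_assoc]
      gcongr
    -- Since F b = 4 · F a, the increment T carries at least 3 · 4^(j-1), while F x ≤ 16 · 4^(j-1).
    -- The constant 6 rounds 16/3 up.
    have h2 : (3 : ℝ≥0∞) * 4 ^ (j - 1) ≤ T := by
      rw [hFa, hFb, show j = j - 1 + 1 by ring, hstep, add_sub_cancel_right] at h1
      rw [show (4 : ℝ≥0∞) = 1 + 3 by norm_num, add_mul, one_mul,
        show (1 + 3 : ℝ≥0∞) = 4 by norm_num] at h1
      exact (ENNReal.add_le_add_iff_left (hpowt _)).mp h1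
    calc F x ≤ 4 ^ (j + 1) := hx.2
      _ = 16 * 4 ^ (j - 1) := by
        rw [hstep, show j = j - 1 + 1 by ring, hstep, add_sub_cancel_right, ← mul_assoc]
        norm_num
      _ ≤ 18 * 4 ^ (j - 1) := by gcongr; norm_num
      _ = 6 * (3 * 4 ^ (j - 1)) := by rw [← mul_assoc]; norm_num
      _ ≤ 6 * T := by gcongr

/-- Reduction of the kernel inequality to a Hardy inequality and a block-diagonal part. -/
lemma exists_kernel_lintegral_le (σ κ ν : Measure ℝ) [IsFiniteMeasure σ] [SFinite κ]
    [NullSingletonClass κ] [SFinite ν] {p p' q : ℝ} (hp : p.HolderConjugate p') (hq0 : 0 < q)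
    (hκ : ∀ x, κ (Iio x) ≠ ∞) {g : ℝ → ℝ≥0∞} (hg : Measurable g)
    (hP : ∫⁻ s, g s ^ p ∂σ ≠ ∞) :
    ∃ (ρ : Measure ℝ) (y : ℤ → ℝ) (I D : ℤ → Set ℝ), SFinite ρ ∧
      (∀ x, ρ (Ioi x) ≤ ∫⁻ t in Ioi x, κ (Ioo x t) ^ q ∂ν) ∧
      (∀ j, MeasurableSet (I j)) ∧ Pairwise (Function.onFun Disjoint I) ∧
      (∀ j, I j ⊆ Ioi (y j)) ∧
      (∀ j, MeasurableSet (D j)) ∧ Pairwise (Function.onFun Disjoint D) ∧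
      ∫⁻ x, (∫⁻ s in Iio x, κ (Ioo s x) * g s ∂σ) ^ q ∂ν ≤
        6 ^ q * 2 ^ q * (∫⁻ x, (∫⁻ s in Iio x, g s ∂σ) ^ q ∂ρ +
          ∑' j, ν (I j) * ((∫⁻ s in Iio (y j), κ (Ioo s (y j)) ^ p' ∂σ) ^ (1 / p') *
            (∫⁻ s in D j, g s ^ p ∂σ) ^ (1 / p)) ^ q) := by
  have hκm : Measurable (Function.uncurry fun s x => κ (Ioo s x)) := measurable_measure_Ioo κ
  have hκ1 : ∀ s, Measurable fun x => κ (Ioo s x) := fun s => hκm.of_uncurry_left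
  have hκ2 : ∀ x, Measurable fun s => κ (Ioo s x) := fun x => hκm.of_uncurry_right
  have hF : ∀ x, ∫⁻ s in Iio x, κ (Ioo s x) * g s ∂σ ≠ ∞ := by
    intro x
    refine ne_top_of_le_ne_top (ENNReal.mul_ne_top (hκ x)
      (setLIntegral_Iio_ne_top σ hp hg hP x)) ?_
    rw [← lintegral_const_mul _ hg]
    refine lintegral_mono fun s => ?_
    gcongr
    exact Ioo_subset_Iio_self
  obtain ⟨y, I, hIm, hId, hIy, hyy, hcov, hle⟩ := exists_blocks σ κ hg hF
  classical
  -- Empty I_j gets an empty block because junk points y_j are not ordered, and disjointness would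
  -- otherwise fail.
  set D : ℤ → Set ℝ := fun j => if (I j).Nonempty then Ico (y (j - 1)) (y j) else ∅ with hD
  set c : ℤ → ℝ≥0∞ := fun j => ∫⁻ x in I j, κ (Ioo (y (j - 1)) x) ^ q ∂ν with hc
  set F : ℝ → ℝ≥0∞ := fun x => ∫⁻ s in Iio x, κ (Ioo s x) * g s ∂σ with hFdef
  set G : ℝ → ℝ≥0∞ := fun x => ∫⁻ s in Iio x, g s ∂σ with hG
  have hGm : Measurable G := (monotone_setLIntegral_Iio σ g).measurable
  set Z : ℤ → ℝ≥0∞ := fun j => (∫⁻ s in Iio (y j), κ (Ioo s (y j)) ^ p' ∂σ) ^ (1 / p') *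
            (∫⁻ s in D j, g s ^ p ∂σ) ^ (1 / p) with hZ
  -- The off-diagonal part sums to Σ c_j G(y_{j-1})^q, that is, to ∫ G^q against this atomic
  -- measure. Its tails are dominated because y_{j-1} > x gives κ(y_{j-1},t) ≤ κ(x,t) and t > x on
  -- I_j.
  refine ⟨Measure.sum fun j => c j • Measure.dirac (y (j - 1)), y, I, D, inferInstance, ?_, hIm,
    hId, fun j x hx => (hIy j x hx).2, ?_, ?_, ?_⟩
  · intro x
    rw [Measure.sum_apply _ measurableSet_Ioi]
    calc ∑' j, (c j • Measure.dirac (y (j - 1))) (Ioi x)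
        ≤ ∑' j, ∫⁻ t in I j, (Ioi x).indicator (fun t => κ (Ioo x t) ^ q) t ∂ν := by
          refine ENNReal.tsum_le_tsum fun j => ?_
          rw [Measure.smul_apply, Measure.dirac_apply' _ measurableSet_Ioi, smul_eq_mul]
          by_cases hx : y (j - 1) ∈ Ioi x
          · rw [indicator_of_mem hx, Pi.one_apply, mul_one, hc]
            refine setLIntegral_mono' (hIm j) fun t ht => ?_
            have ht' : t ∈ Ioi x := (mem_Ioi.mp hx).trans ((hIy j t ht).1.trans (hIy j t ht).2)
            rw [indicator_of_mem ht']
            refine ENNReal.rpow_le_rpow (measure_mono (Ioo_subset_Ioo_left (le_of_lt hx))) hq0.le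
          · rw [indicator_of_notMem hx, mul_zero]; exact zero_le
      _ = ∫⁻ t in ⋃ j, I j, (Ioi x).indicator (fun t => κ (Ioo x t) ^ q) t ∂ν :=
          (lintegral_iUnion hIm hId _).symm
      _ ≤ ∫⁻ t, (Ioi x).indicator (fun t => κ (Ioo x t) ^ q) t ∂ν :=
          lintegral_mono' Measure.restrict_le_self le_rfl
      _ = _ := lintegral_indicator measurableSet_Ioi _
  · intro j
    rw [hD]; dsimp only
    split_ifs
    exacts [measurableSet_Ico, MeasurableSet.empty]
  · refine (pairwise_disjoint_on D).mpr fun i j hij => ?_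
    rw [hD]; dsimp only
    split_ifs with h1 h2
    · refine disjoint_left.mpr fun z hz hz' => ?_
      exact absurd (hz.2.trans_le (hyy i j hij h2)) (not_lt.mpr hz'.1)
    all_goals simp
  · have hpoint : ∀ j, ∀ x ∈ I j, F x ^ q ≤ 6 ^ q * 2 ^ q *
        (κ (Ioo (y (j - 1)) x) ^ q * G (y (j - 1)) ^ q + Z j ^ q) := by
      intro j x hx
      have hDj : D j = Ico (y (j - 1)) (y j) := if_pos ⟨x, hx⟩
      -- Hölder on the block. Only the kernel factor is enlarged to all s < y_j; the g-factor stays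
      -- on D_j so that it can be summed.
      have hZj : ∫⁻ s in Ico (y (j - 1)) (y j), κ (Ioo s (y j)) * g s ∂σ ≤ Z j := by
        refine (lintegral_mul_le_rpow _ hp.symm (hκ2 (y j)).aemeasurable hg.aemeasurable).trans ?_
        rw [hZ]; dsimp only
        rw [hDj]
        refine mul_le_mul_left (ENNReal.rpow_le_rpow ?_ hp.symm.one_div_nonneg) _
        exact lintegral_mono_set fun z hz => hz.2
      calc F x ^ q ≤ (6 * (κ (Ioo (y (j - 1)) x) * G (y (j - 1)) + Z j)) ^ q := by
            refine ENNReal.rpow_le_rpow ((hle j x hx).trans ?_) hq0.le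
            gcongr
        _ = 6 ^ q * (κ (Ioo (y (j - 1)) x) * G (y (j - 1)) + Z j) ^ q :=
            ENNReal.mul_rpow_of_nonneg _ _ hq0.le
        _ ≤ 6 ^ q * (2 ^ q * ((κ (Ioo (y (j - 1)) x) * G (y (j - 1))) ^ q + Z j ^ q)) := by
            gcongr
            exact ENNReal.add_rpow_le_two_rpow_mul_rpow_add_rpow _ _ hq0.le
        _ = _ := by rw [ENNReal.mul_rpow_of_nonneg _ _ hq0.le, mul_assoc]
    have h0 : ∫⁻ x, F x ^ q ∂ν = ∫⁻ x in ⋃ j, I j, F x ^ q ∂ν := by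
      rw [← lintegral_indicator (MeasurableSet.iUnion hIm)]
      refine lintegral_congr fun x => ?_
      by_cases hx : x ∈ ⋃ j, I j
      · rw [indicator_of_mem hx]
      · rw [indicator_of_notMem hx]
        have : F x = 0 := by
          by_contra h
          exact hx (mem_iUnion.mpr (hcov x h))
        rw [this, ENNReal.zero_rpow_of_pos hq0]
    rw [h0, lintegral_iUnion hIm hId, lintegral_sum_measure, ← ENNReal.tsum_add,
      ← ENNReal.tsum_mul_left]
    refine ENNReal.tsum_le_tsum fun j => ?_
    refine (setLIntegral_mono' (hIm j) (hpoint j)).trans (le_of_eq ?_)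
    rw [lintegral_const_mul _ ((((hκ1 _).pow_const _).mul_const _).add_const _),
      lintegral_add_right _ measurable_const, lintegral_mul_const _ ((hκ1 _).pow_const _),
      setLIntegral_const, lintegral_smul_measure, lintegral_dirac' _ (hGm.pow_const _), smul_eq_mul,
      mul_comm (Z j ^ q)]

lemma ofNat_rpow_ne_top (n : ℕ) [n.AtLeastTwo] {q : ℝ} (hq : 0 ≤ q) :
    (OfNat.ofNat n : ℝ≥0∞) ^ q ≠ ∞ := ENNReal.rpow_ne_top_of_nonneg hq (by simp)

/-- Extension of a kernel inequality from truncated measures on the half-line. -/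
lemma IsBddKernel.of_truncated {p q : ℝ} (hp : 0 < p) (hq : 0 < q) {σ ν κ : Measure ℝ}
    [SigmaFinite σ] [SigmaFinite ν] [SFinite κ] (hσ0 : σ (Iic 0) = 0) {M : ℝ≥0∞}
    (h : ∀ n : ℕ, IsBddKernel p q
      (σ.restrict (spanningSets σ n ∩ Ioi ((1 : ℝ) / (n + 1)))) (ν.restrict (spanningSets ν n))
      (fun s x => (κ.restrict (Ioi ((1 : ℝ) / (n + 1)))) (Ioo s x)) M) :
    IsBddKernel p q σ ν (fun s x => κ (Ioo s x)) M := by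
  refine IsBddKernel.of_restrict hp hq (measurable_measure_Ioo κ)
    (E := fun n => spanningSets σ n ∩ Ioi ((1 : ℝ) / (n + 1))) ?_ ?_ ?_
    (monotone_spanningSets ν) (measurableSet_spanningSets ν) (ae_mem_iUnion_spanningSets ν) ?_
  · intro m n hmn
    refine inter_subset_inter (monotone_spanningSets σ hmn) (Ioi_subset_Ioi ?_)
    exact one_div_le_one_div_of_le (by positivity) (by gcongr)
  · exact fun n => (measurableSet_spanningSets σ n).inter measurableSet_Ioi
  · have h0 : ∀ᵐ x ∂σ, x ∉ Iic (0 : ℝ) := measure_eq_zero_iff_ae_notMem.mp hσ0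
    filter_upwards [h0] with x hx
    have hx0 : 0 < x := by simpa using hx
    obtain ⟨m, hm⟩ := exists_nat_one_div_lt hx0
    have hx' : x ∈ ⋃ n, spanningSets σ n := by simp [iUnion_spanningSets]
    obtain ⟨n, hn⟩ := mem_iUnion.mp hx'
    refine mem_iUnion.mpr ⟨max m n, monotone_spanningSets σ (le_max_right m n) hn, ?_⟩
    refine lt_of_le_of_lt ?_ hm
    refine one_div_le_one_div_of_le (by positivity) ?_
    gcongr
    exact le_max_left _ _
  · intro n g hg hP
    -- κ may have infinite mass near 0, hence its truncation. For s beyond 1/(n+1) the interval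
    -- (s,t) lies inside the truncated region, so the kernel is unchanged where the truncated σ
    -- lives.
    refine le_trans (le_of_eq ?_) (h n g hg hP)
    congr 1
    refine lintegral_congr fun t => ?_
    congr 1
    rw [Measure.restrict_restrict measurableSet_Iio]
    refine setLIntegral_congr_fun (measurableSet_Iio.inter
      ((measurableSet_spanningSets σ n).inter measurableSet_Ioi)) fun s hs => ?_
    simp only
    rw [Measure.restrict_apply measurableSet_Ioo, inter_eq_left.mpr]
    exact fun z hz => lt_trans (mem_Ioi.mp hs.2.2) hz.1

lemma restrict_setLIntegral_le (μ : Measure ℝ) (E A : Set ℝ) {f f' : ℝ → ℝ≥0∞}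
    (h : ∀ x, f x ≤ f' x) : ∫⁻ x in A, f x ∂(μ.restrict E) ≤ ∫⁻ x in A, f' x ∂μ :=
  lintegral_mono' (Measure.restrict_mono_measure Measure.restrict_le_self A) h

/-- Upper bound for the kernel operator, `p ≤ q`. -/
theorem exists_kernel_bdd_of_le {p p' q : ℝ} (hp : p.HolderConjugate p') (hpq : p ≤ q) :
    ∃ C : ℝ≥0, ∀ (σ ν κ : Measure ℝ) [SigmaFinite σ] [SigmaFinite ν] [SFinite κ]
      [NullSingletonClass σ] [NullSingletonClass κ], σ (Iic 0) = 0 →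
      (∀ s x, 0 < s → κ (Ioo s x) ≠ ∞) → ∀ S : ℝ≥0∞,
      (∀ x, (∫⁻ t in Ioi x, κ (Ioo x t) ^ q ∂ν) ^ (1 / q) * σ (Iio x) ^ (1 / p') ≤ S) →
      (∀ x, ν (Ioi x) ^ (1 / q) *
        (∫⁻ s in Iio x, κ (Ioo s x) ^ p' ∂σ) ^ (1 / p') ≤ S) →
      IsBddKernel p q σ ν (fun s x => κ (Ioo s x)) (C * S) := by
  have hp0 := hp.pos
  have hq0 : 0 < q := hp.pos.trans_le hpq
  have hqn : 0 ≤ 1 / q := one_div_nonneg.mpr hq0.le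
  set B : ℝ≥0∞ := ENNReal.ofReal q * ENNReal.ofReal p' ^ (p - 1) with hB
  have hBt : B ≠ ∞ := ENNReal.mul_ne_top
      ENNReal.ofReal_ne_top (ENNReal.rpow_ne_top_of_nonneg hp.sub_one_pos.le ENNReal.ofReal_ne_top)
  refine ⟨((6 ^ q * 2 ^ q * (B + 1)) ^ (1 / q)).toNNReal, ?_⟩
  intro σ ν κ _ _ _ _ _ hσ0 hκ S hS1 hS2
  refine IsBddKernel.of_truncated hp0 hq0 hσ0 fun n g hg hP => ?_
  set e := (1 : ℝ) / (n + 1)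
  have he : 0 < e := by positivity
  set κ' := κ.restrict (Ioi e) with hκ'
  set σ' := σ.restrict (spanningSets σ n ∩ Ioi e) with hσ'
  set ν' := ν.restrict (spanningSets ν n) with hν'
  have : IsFiniteMeasure σ' := ⟨by
    rw [hσ', Measure.restrict_apply_univ]
    exact (measure_mono inter_subset_left).trans_lt (measure_spanningSets_lt_top σ n)⟩
  have hκt : ∀ x, κ' (Iio x) ≠ ∞ := by
    intro x
    rw [hκ', Measure.restrict_apply measurableSet_Iio, Iio_inter_Ioi]
    exact hκ e x he
  have hκle : ∀ A, κ' A ≤ κ A := fun A => Measure.restrict_le_self A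
  have hσle : ∀ A, σ' A ≤ σ A := fun A => Measure.restrict_le_self A
  have hνle : ∀ A, ν' A ≤ ν A := fun A => Measure.restrict_le_self A
  obtain ⟨ρ, y, I, D, hρ, hρle, hIm, hId, hIy, hDm, hDd, hle⟩ :=
    exists_kernel_lintegral_le σ' κ' ν' hp hq0 hκt hg hP
  set P := ∫⁻ s, g s ^ p ∂σ' with hPdef
  refine rpow_root_le hp0 hq0 (A := 6 ^ q * 2 ^ q * (B + 1)) ?_ (le_of_eq ?_)
  · refine hle.trans ?_
    rw [mul_assoc (6 ^ q * 2 ^ q * (B + 1)), mul_assoc (6 ^ q * 2 ^ q) (B + 1)]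
    refine mul_le_mul_right ?_ _
    rw [add_mul, one_mul]
    refine add_le_add ?_ ?_
    · refine (hardy_lintegral_le_of_le σ' ρ hp hpq (S := S) ?_ hg hP).trans_eq (mul_assoc _ _ _)
      intro x
      refine le_trans (mul_le_mul' (ENNReal.rpow_le_rpow ?_ hqn)
        (ENNReal.rpow_le_rpow (hσle _) hp.symm.one_div_nonneg)) (hS1 x)
      exact (hρle x).trans (restrict_setLIntegral_le _ _ _ fun t =>
        ENNReal.rpow_le_rpow (hκle _) hq0.le)
    -- The second condition at x = y_j bounds the coefficient by S^q. As q/p ≥ 1, one power of the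
    -- local norm is kept for summation over the disjoint D_j and the others are bounded by P.
    · have hterm : ∀ j, ν' (I j) * ((∫⁻ s in Iio (y j), κ' (Ioo s (y j)) ^ p' ∂σ') ^ (1 / p') *
            (∫⁻ s in D j, g s ^ p ∂σ') ^ (1 / p)) ^ q ≤
            S ^ q * P ^ (q / p - 1) * ∫⁻ s in D j, g s ^ p ∂σ' := by
        intro j
        set Φ := ∫⁻ s in Iio (y j), κ' (Ioo s (y j)) ^ p' ∂σ' with hΦ
        set π := ∫⁻ s in D j, g s ^ p ∂σ' with hπ
        have hπP : π ≤ P := lintegral_mono' Measure.restrict_le_self le_rfl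
        have h1 : ν' (I j) ^ (1 / q) * Φ ^ (1 / p') ≤ S := by
          refine le_trans (mul_le_mul' (ENNReal.rpow_le_rpow
            ((measure_mono (hIy j)).trans (hνle _)) hqn)
            (ENNReal.rpow_le_rpow ?_ hp.symm.one_div_nonneg)) (hS2 (y j))
          exact restrict_setLIntegral_le _ _ _ fun t =>
            ENNReal.rpow_le_rpow (hκle _) hp.symm.nonneg
        calc ν' (I j) * (Φ ^ (1 / p') * π ^ (1 / p)) ^ q
            = (ν' (I j) ^ (1 / q) * Φ ^ (1 / p')) ^ q * π ^ (q / p) := by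
              rw [ENNReal.mul_rpow_of_nonneg _ _ hq0.le, ENNReal.mul_rpow_of_nonneg _ _ hq0.le,
                rpow_mul_eq (ν' (I j)) (c := 1) (by field_simp), ENNReal.rpow_one,
                rpow_mul_eq π (c := q / p) (by ring), mul_assoc]
          _ ≤ S ^ q * (π ^ (q / p - 1) * π) := by
              have : π ^ (q / p) = π ^ (q / p - 1) * π := by
                nth_rw 3 [← ENNReal.rpow_one π]
                rw [← ENNReal.rpow_add_of_nonneg _ _ (sub_nonneg.mpr ((one_le_div hp0).mpr hpq))
                  zero_le_one, sub_add_cancel]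
              rw [this]
              gcongr
          _ ≤ S ^ q * (P ^ (q / p - 1) * π) := by
              gcongr
              exact sub_nonneg.mpr ((one_le_div hp0).mpr hpq)
          _ = _ := by rw [mul_assoc]
      calc _ ≤ ∑' j, S ^ q * P ^ (q / p - 1) * ∫⁻ s in D j, g s ^ p ∂σ' :=
            ENNReal.tsum_le_tsum hterm
        _ = S ^ q * P ^ (q / p - 1) * ∫⁻ s in ⋃ j, D j, g s ^ p ∂σ' := by
            rw [ENNReal.tsum_mul_left, lintegral_iUnion hDm hDd]
        _ ≤ S ^ q * P ^ (q / p - 1) * P := by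
            gcongr
            exact lintegral_mono' Measure.restrict_le_self le_rfl
        _ = S ^ q * P ^ (q / p) := by
            rw [mul_assoc]
            congr 1
            nth_rw 2 [← ENNReal.rpow_one P]
            rw [← ENNReal.rpow_add_of_nonneg _ _ (sub_nonneg.mpr ((one_le_div hp0).mpr hpq))
                  zero_le_one, sub_add_cancel]
  · rw [ENNReal.coe_toNNReal]
    refine ENNReal.rpow_ne_top_of_nonneg hqn (ENNReal.mul_ne_top (ENNReal.mul_ne_top
      (ofNat_rpow_ne_top 6 hq0.le) (ofNat_rpow_ne_top 2 hq0.le)) (by simp [hBt]))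

/-- Upper bound for the kernel operator, `q < p`. -/
theorem exists_kernel_bdd_of_lt {p p' q q' r : ℝ} (hp : p.HolderConjugate p')
    (hq : q.HolderConjugate q') (hr : r⁻¹ = q⁻¹ - p⁻¹) (hr0 : 0 < r) :
    ∃ C : ℝ≥0, ∀ (σ ν κ : Measure ℝ) [SigmaFinite σ] [SigmaFinite ν] [SFinite κ]
      [NullSingletonClass σ] [NullSingletonClass ν] [NullSingletonClass κ], σ (Iic 0) = 0 →
      (∀ s x, 0 < s → κ (Ioo s x) ≠ ∞) →
      IsBddKernel p q σ ν (fun s x => κ (Ioo s x))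
        (C * ((∫⁻ x, ν (Ioi x) ^ (r / p) *
            (∫⁻ s in Iio x, κ (Ioo s x) ^ p' ∂σ) ^ (r / p') ∂ν) ^ (1 / r) +
          (∫⁻ x, (∫⁻ t in Ioi x, κ (Ioo x t) ^ q ∂ν) ^ (r / q) *
            σ (Iio x) ^ (r / q') ∂σ) ^ (1 / r))) := by
  have hp0 := hp.pos
  have hq0 := hq.pos
  have hqn : 0 ≤ 1 / q := one_div_nonneg.mpr hq0.le
  have hqr : 0 < q / r := div_pos hq0 hr0
  have hrq : 0 < r / q := div_pos hr0 hq0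
  have hrp : 0 ≤ r / p := div_nonneg hr0.le hp0.le
  have hrp' : 0 ≤ r / p' := div_nonneg hr0.le hp.symm.pos.le
  have hrq' : 0 ≤ r / q' := div_nonneg hr0.le hq.symm.pos.le
  have hrr : r * r⁻¹ = 1 := mul_inv_cancel₀ hr0.ne'
  have e1 : r / q - 1 = r / p := by
    rw [div_eq_mul_inv, div_eq_mul_inv]; linear_combination hrr - r * hr
  have e2 : q / r + q / p = 1 := by
    have : q * q⁻¹ = 1 := mul_inv_cancel₀ hq0.ne'
    rw [div_eq_mul_inv, div_eq_mul_inv]; linear_combination q * hr + this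
  set B : ℝ≥0∞ := ENNReal.ofReal q * ENNReal.ofReal p' ^ (q - 1) with hB
  have hBt : B ≠ ∞ := ENNReal.mul_ne_top
      ENNReal.ofReal_ne_top (ENNReal.rpow_ne_top_of_nonneg hq.sub_one_pos.le ENNReal.ofReal_ne_top)
  set R : ℝ≥0∞ := ENNReal.ofReal (r / q) ^ (q / r) with hR
  have hRt : R ≠ ∞ := ENNReal.rpow_ne_top_of_nonneg hqr.le ENNReal.ofReal_ne_top
  refine ⟨((6 ^ q * 2 ^ q * (B + R)) ^ (1 / q)).toNNReal, ?_⟩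
  intro σ ν κ _ _ _ _ _ _ hσ0 hκ
  set J₁ := ∫⁻ x, ν (Ioi x) ^ (r / p) *
            (∫⁻ s in Iio x, κ (Ioo s x) ^ p' ∂σ) ^ (r / p') ∂ν with hJ₁
  set J₂ := ∫⁻ x, (∫⁻ t in Ioi x, κ (Ioo x t) ^ q ∂ν) ^ (r / q) *
            σ (Iio x) ^ (r / q') ∂σ with hJ₂
  refine IsBddKernel.of_truncated hp0 hq0 hσ0 fun n g hg hP => ?_
  set e := (1 : ℝ) / (n + 1)
  have he : 0 < e := by positivity
  set κ' := κ.restrict (Ioi e) with hκ'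
  set σ' := σ.restrict (spanningSets σ n ∩ Ioi e) with hσ'
  set ν' := ν.restrict (spanningSets ν n) with hν'
  have : IsFiniteMeasure σ' := ⟨by
    rw [hσ', Measure.restrict_apply_univ]
    exact (measure_mono inter_subset_left).trans_lt (measure_spanningSets_lt_top σ n)⟩
  have hκt : ∀ x, κ' (Iio x) ≠ ∞ := by
    intro x
    rw [hκ', Measure.restrict_apply measurableSet_Iio, Iio_inter_Ioi]
    exact hκ e x he
  have hκle : ∀ A, κ' A ≤ κ A := fun A => Measure.restrict_le_self A
  have hσle : ∀ A, σ' A ≤ σ A := fun A => Measure.restrict_le_self A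
  have hνle : ∀ A, ν' A ≤ ν A := fun A => Measure.restrict_le_self A
  obtain ⟨ρ, y, I, D, hρ, hρle, hIm, hId, hIy, hDm, hDd, hle⟩ :=
    exists_kernel_lintegral_le σ' κ' ν' hp hq0 hκt hg hP
  set P := ∫⁻ s, g s ^ p ∂σ' with hPdef
  set Φ : ℝ → ℝ≥0∞ := fun x => ∫⁻ s in Iio x, κ' (Ioo s x) ^ p' ∂σ' with hΦ
  have hΦmono : Monotone Φ := by
    intro x x' hx
    refine (lintegral_mono fun s => ?_).trans (lintegral_mono_set (Iio_subset_Iio hx))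
    exact ENNReal.rpow_le_rpow (measure_mono (Ioo_subset_Ioo_right hx)) hp.symm.nonneg
  have hJ₁le : ∫⁻ x, ν' (Ioi x) ^ (r / p) * Φ x ^ (r / p') ∂ν' ≤ J₁ := by
    refine lintegral_mono' Measure.restrict_le_self fun x => ?_
    refine mul_le_mul' (ENNReal.rpow_le_rpow (hνle _) hrp) (ENNReal.rpow_le_rpow ?_ hrp')
    exact restrict_setLIntegral_le _ _ _ fun t => ENNReal.rpow_le_rpow (hκle _) hp.symm.nonneg
  have hJ₂le : ∫⁻ x, ρ (Ioi x) ^ (r / q) * σ' (Iio x) ^ (r / q') ∂σ' ≤ J₂ := by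
    refine lintegral_mono' Measure.restrict_le_self fun x => ?_
    refine mul_le_mul' (ENNReal.rpow_le_rpow ((hρle x).trans ?_) hrq.le)
      (ENNReal.rpow_le_rpow (hσle _) hrq')
    exact restrict_setLIntegral_le _ _ _ fun t => ENNReal.rpow_le_rpow (hκle _) hq0.le
  set S := J₁ ^ (1 / r) + J₂ ^ (1 / r) with hS
  have hJ₁S : J₁ ^ (q / r) ≤ S ^ q := by
    rw [← rpow_mul_eq J₁ (show 1 / r * q = q / r by ring)]
    exact ENNReal.rpow_le_rpow le_self_add hq0.le
  have hJ₂S : J₂ ^ (q / r) ≤ S ^ q := by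
    rw [← rpow_mul_eq J₂ (show 1 / r * q = q / r by ring)]
    exact ENNReal.rpow_le_rpow le_add_self hq0.le
  refine rpow_root_le hp0 hq0 (A := 6 ^ q * 2 ^ q * (B + R)) ?_ (le_of_eq ?_)
  · refine hle.trans ?_
    rw [mul_assoc (6 ^ q * 2 ^ q * (B + R)), mul_assoc (6 ^ q * 2 ^ q) (B + R)]
    refine mul_le_mul_right ?_ _
    rw [add_mul]
    refine add_le_add ?_ ?_
    -- Here ρ is purely atomic, so the form of the criterion integrated against σ is used.
    · refine (hardy_lintegral_le_of_lt σ' ρ hp hq hr hr0 hg hP).trans ?_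
      rw [mul_assoc]
      refine mul_le_mul_right (mul_le_mul_left ?_ _) _
      exact (ENNReal.rpow_le_rpow hJ₂le hqr.le).trans hJ₂S
    · set π : ℤ → ℝ≥0∞ := fun j => ∫⁻ s in D j, g s ^ p ∂σ' with hπ
      set N : ℤ → ℝ≥0∞ := fun j => ν' (I j) ^ (r / q) * Φ (y j) ^ (r / p') with hN
      have hterm : ∀ j, ν' (I j) * (Φ (y j) ^ (1 / p') * π j ^ (1 / p)) ^ q =
          N j ^ (q / r) * π j ^ (q / p) := by
        intro j
        rw [hN]; dsimp only
        rw [ENNReal.mul_rpow_of_nonneg _ _ hq0.le, ENNReal.mul_rpow_of_nonneg _ _ hqr.le,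
          rpow_mul_eq (ν' (I j)) (c := 1) (by field_simp), ENNReal.rpow_one,
          rpow_mul_eq (π j) (c := q / p) (by ring), rpow_mul_eq (Φ _) (c := q / p') (by ring),
          rpow_mul_eq (Φ _) (c := q / p') (by field_simp), mul_assoc]
      -- For q < p single blocks cannot be bounded uniformly; Hölder for series with q/r + q/p = 1
      -- separates coefficients from local norms.
      have hHolder : ∑' j, N j ^ (q / r) * π j ^ (q / p) ≤
          (∑' j, N j) ^ (q / r) * (∑' j, π j) ^ (q / p) := by
        have := ENNReal.lintegral_mul_norm_pow_le (μ := (Measure.count : Measure ℤ))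
          (f := N) (g := π) (by fun_prop) (by fun_prop) hqr.le (div_nonneg hq0.le hp0.le) e2
        simpa only [lintegral_count] using this
      -- The power ν(I_j)^(r/q) is unfolded by the chain rule for ν restricted to I_j, and Φ(y_j) ≤
      -- Φ(x) there. The sum over j is thereby dominated by a multiple of J₁.
      have hNj : ∀ j, N j ≤ ENNReal.ofReal (r / q) *
          ∫⁻ x in I j, ν' (Ioi x) ^ (r / p) * Φ x ^ (r / p') ∂ν' := by
        intro j
        have h1 := rpow_eq_mul_setLIntegral_Ioi (ν'.restrict (I j)) (x := y j)
          (measure_ne_top _ _) hrq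
        have hI : Ioi (y j) ∩ I j = I j := inter_eq_right.mpr (hIy j)
        rw [Measure.restrict_apply measurableSet_Ioi, hI,
          Measure.restrict_restrict measurableSet_Ioi, hI, e1] at h1
        rw [hN]; dsimp only
        rw [h1, mul_assoc]
        refine mul_le_mul_right ?_ _
        rw [← lintegral_mul_const _ (((measurable_measure_Ioi _)).pow_const _)]
        refine setLIntegral_mono' (hIm j) fun x hx => ?_
        refine mul_le_mul' (ENNReal.rpow_le_rpow (Measure.restrict_le_self _) hrp)
          (ENNReal.rpow_le_rpow (hΦmono (le_of_lt (hIy j hx))) hrp')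
      have hNsum : ∑' j, N j ≤ ENNReal.ofReal (r / q) * J₁ := by
        refine (ENNReal.tsum_le_tsum hNj).trans ?_
        rw [ENNReal.tsum_mul_left, ← lintegral_iUnion hIm hId]
        refine mul_le_mul_right (le_trans ?_ hJ₁le) _
        exact lintegral_mono' Measure.restrict_le_self le_rfl
      have hπsum : ∑' j, π j ≤ P := by
        rw [hπ, ← lintegral_iUnion hDm hDd]
        exact lintegral_mono' Measure.restrict_le_self le_rfl
      calc _ = ∑' j, N j ^ (q / r) * π j ^ (q / p) := by simp_rw [← hterm]; rfl
        _ ≤ _ := hHolder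
        _ ≤ (ENNReal.ofReal (r / q) * J₁) ^ (q / r) * P ^ (q / p) := by gcongr
        _ ≤ R * (S ^ q * P ^ (q / p)) := by
          rw [ENNReal.mul_rpow_of_nonneg _ _ hqr.le, mul_assoc]
          gcongr
  · rw [ENNReal.coe_toNNReal]
    refine ENNReal.rpow_ne_top_of_nonneg hqn (ENNReal.mul_ne_top (ENNReal.mul_ne_top
      (ofNat_rpow_ne_top 6 hq0.le) (ofNat_rpow_ne_top 2 hq0.le))
      (by simp [hBt, hRt]))

/-! ### Duality and pointwise necessary conditions -/

/-- The absorption step that ends a test-function argument. It divides by J^θ, which is why the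
functionals are truncated to be finite before they are tested. -/
lemma rpow_le_of_le_mul_rpow {J D : ℝ≥0∞} {θ θ' : ℝ} (hJ : J ≠ ∞) (hθ' : 0 < θ')
    (hsum : θ + θ' = 1) (h : J ≤ D * J ^ θ) : J ^ θ' ≤ D := by
  rcases eq_or_ne J 0 with h0 | h0
  · rw [h0, ENNReal.zero_rpow_of_pos hθ']; exact zero_le
  calc J ^ θ' = J * J ^ (-θ) := by
        nth_rw 2 [← ENNReal.rpow_one J]
        exact (rpow_add_eq h0 hJ (by linarith)).symm
    _ ≤ D * J ^ θ * J ^ (-θ) := by gcongr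
    _ = D := by rw [mul_assoc, rpow_add_eq h0 hJ (add_neg_cancel θ), ENNReal.rpow_zero, mul_one]

/-- Converse of Hölder's inequality. -/
lemma rpow_lintegral_le_of_forall (σ : Measure ℝ) [SigmaFinite σ] {p p' : ℝ}
    (hp : p.HolderConjugate p') {φ : ℝ → ℝ≥0∞} (hφ : Measurable φ) {c : ℝ≥0∞}
    (h : ∀ g : ℝ → ℝ≥0∞, Measurable g → ∫⁻ s, g s ^ p ∂σ ≠ ∞ →
      ∫⁻ s, φ s * g s ∂σ ≤ c * (∫⁻ s, g s ^ p ∂σ) ^ (1 / p)) :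
    (∫⁻ s, φ s ^ p' ∂σ) ^ (1 / p') ≤ c := by
  have hp'0 := hp.symm.pos
  have hpp : p' / p = p' - 1 := hp.symm.div_conj_eq_sub_one
  have hp0 := hp.pos
  have h1 : ∀ s, φ s ^ p' = ⨆ n : ℕ, (min (φ s) n) ^ p' := by
    intro s
    rw [← rpow_iSup _ hp'0]
    congr 1
    rw [← inf_iSup_eq, ENNReal.iSup_natCast, inf_top_eq]
  simp_rw [h1]
  rw [setLIntegral_iUnion_iSup (monotone_spanningSets σ) (measurableSet_spanningSets σ)
    (ae_mem_iUnion_spanningSets σ) (fun n => by fun_prop),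
    rpow_iSup _ (one_div_pos.mpr hp'0)]
  · refine iSup_le fun n => ?_
    set E := spanningSets σ n
    have hE : MeasurableSet E := measurableSet_spanningSets σ n
    set J := ∫⁻ s in E, (min (φ s) n) ^ p' ∂σ with hJ
    have hJt : J ≠ ∞ := by
      refine ne_top_of_le_ne_top (ENNReal.mul_ne_top (ENNReal.rpow_ne_top_of_nonneg hp'0.le
        (ENNReal.natCast_ne_top n)) (measure_spanningSets_lt_top σ n).ne) ?_
      rw [← setLIntegral_const]
      exact lintegral_mono fun s => ENNReal.rpow_le_rpow (min_le_right _ _) hp'0.le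
    -- The extremal function of Hölder's inequality, truncated in height and support to keep J
    -- finite.
    set g := E.indicator fun s => (min (φ s) n) ^ (p' - 1) with hg
    have hgm : Measurable g := Measurable.indicator (by fun_prop) hE
    have hgp : ∫⁻ s, g s ^ p ∂σ = J := by
      rw [hJ, ← lintegral_indicator hE]
      refine lintegral_congr fun s => ?_
      by_cases hs : s ∈ E
      · rw [hg, indicator_of_mem hs, indicator_of_mem hs]
        refine rpow_mul_eq _ ?_
        rw [← hpp]; field_simp
      · rw [hg, indicator_of_notMem hs, indicator_of_notMem hs, ENNReal.zero_rpow_of_pos hp0]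
    have h2 : J ≤ ∫⁻ s, φ s * g s ∂σ := by
      rw [hJ, ← lintegral_indicator hE]
      refine lintegral_mono fun s => ?_
      by_cases hs : s ∈ E
      · rw [hg, indicator_of_mem hs, indicator_of_mem hs]
        have : (min (φ s) n) ^ p' = min (φ s) n * (min (φ s) n) ^ (p' - 1) := by
          nth_rw 2 [← ENNReal.rpow_one (min (φ s) n)]
          rw [← ENNReal.rpow_add_of_nonneg _ _ zero_le_one hp.symm.sub_one_pos.le,
            add_sub_cancel]
        rw [this]
        gcongr
        exact min_le_left _ _
      · rw [indicator_of_notMem hs]; exact zero_le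
    have h3 := h2.trans (h g hgm (by rwa [hgp]))
    rw [hgp] at h3
    exact rpow_le_of_le_mul_rpow hJt (one_div_pos.mpr hp'0)
      (by rw [one_div, one_div]; exact hp.inv_add_inv_eq_one) h3
  · intro m n hmn s
    refine ENNReal.rpow_le_rpow (min_le_min le_rfl ?_) hp'0.le
    exact_mod_cast hmn

/-- The reflected adjoint of a bounded kernel operator is bounded. -/
lemma IsBddKernel.adjoint {p p' q q' : ℝ} (hp : p.HolderConjugate p') (hq : q.HolderConjugate q')
    {σ ν : Measure ℝ} [SigmaFinite σ] [SigmaFinite ν] {k : ℝ → ℝ → ℝ≥0∞}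
    (hk : Measurable (Function.uncurry k)) {M : ℝ≥0∞} (h : IsBddKernel p q σ ν k M) :
    IsBddKernel q' p' (reflect ν) (reflect σ) (fun s t => k (-t) (-s)) M := by
  intro h₀ hh hH
  rw [lintegral_reflect] at hH
  rw [lintegral_reflect, lintegral_reflect]
  set h' : ℝ → ℝ≥0∞ := fun t => h₀ (-t) with hh'
  have hm : Measurable h' := hh.comp measurable_neg
  have h1 : ∀ s, ∫⁻ t in Iio (-s), k (- -s) (-t) * h₀ t ∂(reflect ν)
      = ∫⁻ t in Ioi s, k s t * h' t ∂ν := by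
    intro s
    rw [setLIntegral_reflect_Iio]
    simp [hh']
  simp_rw [h1]
  have hkh : Measurable (Function.uncurry fun s t => k s t * h' t) :=
    hk.mul (hm.comp measurable_snd)
  -- By the converse of Hölder it suffices to pair with g in L^p(σ). Fubini then moves the operator
  -- onto g, where the hypothesis applies.
  refine rpow_lintegral_le_of_forall σ hp (measurable_setLIntegral_Ioi ν hkh) fun g hg hP => ?_
  have hkg : Measurable (Function.uncurry fun s t => k s t * g s) :=
    hk.mul (hg.comp measurable_fst)
  have hK := measurable_setLIntegral_Iio σ hkg
  calc ∫⁻ s, (∫⁻ t in Ioi s, k s t * h' t ∂ν) * g s ∂σ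
      = ∫⁻ s, ∫⁻ t in Ioi s, k s t * h' t * g s ∂ν ∂σ := by
        refine lintegral_congr fun s => (lintegral_mul_const _ ?_).symm
        exact hkh.of_uncurry_left
    _ = ∫⁻ t, ∫⁻ s in Iio t, k s t * h' t * g s ∂σ ∂ν :=
        (lintegral_setLIntegral_swap σ ν (F := fun s t => k s t * h' t * g s)
          (hkh.mul (hg.comp measurable_fst))).symm
    _ = ∫⁻ t, h' t * ∫⁻ s in Iio t, k s t * g s ∂σ ∂ν := by
        refine lintegral_congr fun t => ?_
        rw [← lintegral_const_mul _ hkg.of_uncurry_right]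
        refine lintegral_congr fun s => by ring
    _ ≤ _ := lintegral_mul_le_rpow ν hq.symm hm.aemeasurable hK.aemeasurable
    _ ≤ (∫⁻ t, h' t ^ q' ∂ν) ^ (1 / q') * (M * (∫⁻ s, g s ^ p ∂σ) ^ (1 / p)) :=
        mul_le_mul_right (h g hg hP) _
    _ = _ := by ring

/-- First necessary condition for boundedness. -/
lemma IsBddKernel.tail_mul_le {p p' q : ℝ} (hp : p.HolderConjugate p') (hq : 0 < q)
    {σ ν : Measure ℝ} [SigmaFinite σ] {k : ℝ → ℝ → ℝ≥0∞}
    (hanti : ∀ t, Antitone fun s => k s t) {M : ℝ≥0∞} (h : IsBddKernel p q σ ν k M) (x : ℝ) :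
    (∫⁻ t in Ioi x, k x t ^ q ∂ν) ^ (1 / q) * σ (Iio x) ^ (1 / p') ≤ M := by
  have hp0 := hp.pos
  have hp'0 := hp.symm.pos
  set Ψ := ∫⁻ t in Ioi x, k x t ^ q ∂ν with hΨ
  rw [measure_iUnion_eq_iSup_inter (monotone_spanningSets σ) (ae_mem_iUnion_spanningSets σ)
    measurableSet_Iio, rpow_iSup _ (one_div_pos.mpr hp'0), ENNReal.mul_iSup]
  refine iSup_le fun n => ?_
  set E := spanningSets σ n ∩ Iio x with hE
  have hEm : MeasurableSet E := (measurableSet_spanningSets σ n).inter measurableSet_Iio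
  rw [Measure.restrict_apply measurableSet_Iio, inter_comm, ← hE]
  set m := σ E with hm
  have hmt : m ≠ ∞ :=
    ((measure_mono inter_subset_left).trans_lt (measure_spanningSets_lt_top σ n)).ne
  -- The test function is the indicator of a finite-measure part of (-∞,x). For s < x < t the kernel
  -- is at least k(x,t), so the output at t is at least k(x,t) σ(E).
  set g : ℝ → ℝ≥0∞ := E.indicator 1 with hg
  have hgm : Measurable g := measurable_one.indicator hEm
  have hgp : ∫⁻ s, g s ^ p ∂σ = m := by
    rw [hm, ← lintegral_indicator_one hEm]
    refine lintegral_congr fun s => ?_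
    by_cases hs : s ∈ E <;> simp [hg, hs, hp0]
  have h1 := h g hgm (by rwa [hgp])
  rw [hgp] at h1
  have h2 : Ψ ^ (1 / q) * m ≤ M * m ^ (1 / p) := by
    refine le_trans ?_ h1
    have : Ψ ^ (1 / q) * m = (Ψ * m ^ q) ^ (1 / q) := by
      rw [ENNReal.mul_rpow_of_nonneg _ _ (one_div_nonneg.mpr hq.le),
        rpow_mul_eq m (c := 1) (by field_simp), ENNReal.rpow_one]
    rw [this]
    refine ENNReal.rpow_le_rpow ?_ (one_div_nonneg.mpr hq.le)
    rw [hΨ, ← lintegral_mul_const' _ _ (ENNReal.rpow_ne_top_of_nonneg hq.le hmt)]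
    refine le_trans (setLIntegral_mono' measurableSet_Ioi fun t ht => ?_)
      (setLIntegral_le_lintegral (Ioi x) _)
    rw [← ENNReal.mul_rpow_of_nonneg _ _ hq.le]
    refine ENNReal.rpow_le_rpow ?_ hq.le
    calc k x t * m = ∫⁻ s in E, k x t ∂σ := by rw [setLIntegral_const]
      _ ≤ ∫⁻ s in E, k s t ∂σ := setLIntegral_mono' hEm fun s hs => hanti t (le_of_lt hs.2)
      _ = ∫⁻ s in E, k s t * g s ∂σ := by
          refine setLIntegral_congr_fun hEm fun s hs => ?_
          simp [hg, hs]
      _ ≤ ∫⁻ s in Iio t, k s t * g s ∂σ := lintegral_mono_set fun s hs =>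
          lt_trans (mem_Iio.mp hs.2) (mem_Ioi.mp ht)
  rcases eq_or_ne m 0 with h0 | h0
  · rw [h0, ENNReal.zero_rpow_of_pos (one_div_pos.mpr hp'0), mul_zero]; exact zero_le
  · have hs : 1 + -(1 / p) = 1 / p' := by
      have := hp.inv_add_inv_eq_one
      rw [one_div, one_div]; linarith
    calc Ψ ^ (1 / q) * m ^ (1 / p') = Ψ ^ (1 / q) * m * m ^ (-(1 / p)) := by
          rw [mul_assoc]
          congr 1
          nth_rw 2 [← ENNReal.rpow_one m]
          exact (rpow_add_eq h0 hmt hs).symm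
      _ ≤ M * m ^ (1 / p) * m ^ (-(1 / p)) := by gcongr
      _ = M := by
          rw [mul_assoc, rpow_add_eq h0 hmt (add_neg_cancel _), ENNReal.rpow_zero, mul_one]

/-- Second necessary condition for boundedness. -/
lemma IsBddKernel.mul_head_le {p p' q q' : ℝ} (hp : p.HolderConjugate p')
    (hq : q.HolderConjugate q')
    {σ ν : Measure ℝ} [SigmaFinite σ] [SigmaFinite ν] {k : ℝ → ℝ → ℝ≥0∞}
    (hk : Measurable (Function.uncurry k))
    (hmono : ∀ s, Monotone fun t => k s t) {M : ℝ≥0∞} (h : IsBddKernel p q σ ν k M) (x : ℝ) :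
    ν (Ioi x) ^ (1 / q) * (∫⁻ s in Iio x, k s x ^ p' ∂σ) ^ (1 / p') ≤ M := by
  -- This is the first condition for the reflected adjoint, whose kernel is non-increasing in its
  -- first variable because k is non-decreasing in its second.
  have := (h.adjoint hp hq hk).tail_mul_le hq.symm hp.symm.pos
    (fun t s s' hs => hmono (-t) (neg_le_neg hs)) (-x)
  rw [setLIntegral_reflect_Ioi, reflect_Iio, mul_comm] at this
  simpa only [neg_neg] using this

/-! ### Integral necessary conditions for q < p -/

section IntegralCondition

variable {p p' q q' r : ℝ}

/-- Test with g = Ψ^(r/(pq)) V^(r/(pq')), for which g^p is the integrand of the functional J. The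
chain rule writes (∫ k g)^q as q ∫ k g (∫_{z<s} k g)^(q-1), and monotonicity of k and Ψ bounds the
inner integral below by k(s,t) Ψ(s)^α ∫_{z<s} V^β. Fubini gives c₀ J ≤ (M J^(1/p))^q, and J is
absorbed; finite measures and a bounded kernel make J finite. -/
lemma IsBddKernel.integral_condition_of_finite (hp : p.HolderConjugate p')
    (hq : q.HolderConjugate q') (hr : r⁻¹ = q⁻¹ - p⁻¹) (hr0 : 0 < r)
    {σ ν : Measure ℝ} [IsFiniteMeasure σ] [IsFiniteMeasure ν] [NullSingletonClass σ]
    {k : ℝ → ℝ → ℝ≥0∞} (hk : Measurable (Function.uncurry k))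
    (hanti : ∀ t, Antitone fun s => k s t) {c : ℝ≥0∞} (hc : c ≠ ∞) (hkc : ∀ s t, k s t ≤ c)
    {M : ℝ≥0∞} (h : IsBddKernel p q σ ν k M) :
    ∫⁻ x, (∫⁻ t in Ioi x, k x t ^ q ∂ν) ^ (r / q) * σ (Iio x) ^ (r / q') ∂σ ≤
      ((ENNReal.ofReal q * (ENNReal.ofReal (r / (p * q') + 1))⁻¹ ^ (q - 1))⁻¹ ^ (1 / q) * M) ^ r := by
  have hp0 := hp.pos
  have hq0 := hq.pos
  have hq'0 := hq.symm.pos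
  have hq1 := hq.sub_one_pos
  have hqq : q / q' = q - 1 := hq.div_conj_eq_sub_one
  have hrr : r * r⁻¹ = 1 := mul_inv_cancel₀ hr0.ne'
  have e2 : q / p + q / r = 1 := by
    have : q * q⁻¹ = 1 := mul_inv_cancel₀ hq0.ne'
    rw [div_eq_mul_inv, div_eq_mul_inv]; linear_combination q * hr + this
  have e3 : r / p + 1 = r / q := by
    rw [div_eq_mul_inv, div_eq_mul_inv]; linear_combination -hrr + r * hr
  set β := r / (p * q') with hβ
  have hβ0 : 0 ≤ β := by positivity
  set α := r / (p * q) with hα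
  have hα0 : 0 ≤ α := by positivity
  -- The powers of V, one β from g and q - 1 copies of β + 1 from the integrated lower bound,
  -- combine to the exponent of the functional.
  have e4 : β + (β + 1) * (q - 1) = r / q' := by
    have h1 : r / q' = r / q * (q / q') := by field_simp
    rw [h1, ← e3, hqq, hβ, show r / (p * q') = r / p * (1 / q') by field_simp,
      show 1 / q' = (q - 1) / q by rw [← hqq]; field_simp]
    field_simp
    ring
  set V : ℝ → ℝ≥0∞ := fun x => σ (Iio x) with hV
  have hVm : Measurable V := measurable_measure_Iio σ
  set Ψ : ℝ → ℝ≥0∞ := fun x => ∫⁻ t in Ioi x, k x t ^ q ∂ν with hΨ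
  have hΨm : Measurable Ψ := measurable_setLIntegral_Ioi ν (hk.pow_const q)
  have hΨanti : Antitone Ψ := by
    intro x x' hx
    refine (lintegral_mono fun t => ?_).trans (lintegral_mono_set (Ioi_subset_Ioi hx))
    exact ENNReal.rpow_le_rpow (hanti t hx) hq0.le
  have hVt : ∀ x, V x ≠ ∞ := fun x => measure_ne_top _ _
  set g : ℝ → ℝ≥0∞ := fun s => Ψ s ^ α * V s ^ β with hg
  have hgm : Measurable g := by fun_prop
  set J := ∫⁻ x, Ψ x ^ (r / q) * V x ^ (r / q') ∂σ with hJ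
  have hgp : ∫⁻ s, g s ^ p ∂σ = J := by
    refine lintegral_congr fun s => ?_
    rw [hg]; dsimp only
    rw [ENNReal.mul_rpow_of_nonneg _ _ hp0.le, rpow_mul_eq _ (c := r / q) (by rw [hα]; field_simp),
      rpow_mul_eq _ (c := r / q') (by rw [hβ]; field_simp)]
  have hJt : J ≠ ∞ := by
    have hb : (c ^ q * ν univ) ^ (r / q) * (σ univ) ^ (r / q') * σ univ ≠ ∞ := by
      refine ENNReal.mul_ne_top (ENNReal.mul_ne_top ?_ ?_) (measure_ne_top _ _)
      · exact ENNReal.rpow_ne_top_of_nonneg (by positivity) (ENNReal.mul_ne_top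
          (ENNReal.rpow_ne_top_of_nonneg hq0.le hc) (measure_ne_top _ _))
      · exact ENNReal.rpow_ne_top_of_nonneg (by positivity) (measure_ne_top _ _)
    refine ne_top_of_le_ne_top hb ?_
    rw [← lintegral_const]
    refine lintegral_mono fun x => mul_le_mul' (ENNReal.rpow_le_rpow ?_ (by positivity))
      (ENNReal.rpow_le_rpow (measure_mono (subset_univ _)) (by positivity))
    rw [← lintegral_const]
    refine (setLIntegral_le_lintegral (Ioi x) _).trans (lintegral_mono fun t => ?_)
    exact ENNReal.rpow_le_rpow (hkc x t) hq0.le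
  set b := (ENNReal.ofReal (β + 1))⁻¹ with hb
  have hb0 : b ≠ 0 := by simp [hb]
  have hbt : b ≠ ∞ := by
    simp only [hb, ne_eq, ENNReal.inv_eq_top, ENNReal.ofReal_eq_zero, not_le]
    linarith
  set c₀ := ENNReal.ofReal q * b ^ (q - 1) with hc₀
  have hc₀0 : c₀ ≠ 0 := mul_ne_zero (by simpa using hq0)
    (ENNReal.rpow_pos (pos_iff_ne_zero.mpr hb0) hbt).ne'
  have hc₀t : c₀ ≠ ∞ := ENNReal.mul_ne_top ENNReal.ofReal_ne_top
    (ENNReal.rpow_ne_top_of_nonneg hq1.le hbt)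
  have hkt : ∀ t, Measurable fun s => k s t := fun t => hk.of_uncurry_right
  have hKt : ∀ t x, ∫⁻ s in Iio x, k s t * g s ∂σ ≠ ∞ := by
    intro t x
    refine ne_top_of_le_ne_top (ENNReal.mul_ne_top hc (setLIntegral_Iio_ne_top σ hp hgm
      (by rwa [hgp]) x)) ?_
    rw [← lintegral_const_mul _ hgm]
    exact lintegral_mono fun s => mul_le_mul_left (hkc s t) _
  have hlow : ∀ t, c₀ * ∫⁻ s in Iio t, k s t ^ q * Ψ s ^ (r / p) * V s ^ (r / q') ∂σ ≤
      (∫⁻ s in Iio t, k s t * g s ∂σ) ^ q := by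
    intro t
    have hd : Measurable fun s => k s t * g s := (hkt t).mul hgm
    have h1 := rpow_eq_mul_setLIntegral (σ.withDensity fun s => k s t * g s) (x := t)
      (by rw [withDensity_Iio]; exact hKt t t) hq0
    simp_rw [withDensity_Iio] at h1
    rw [restrict_withDensity measurableSet_Iio, lintegral_withDensity_eq_lintegral_mul _ hd
      ((monotone_setLIntegral_Iio σ _).measurable.pow_const _)] at h1
    rw [h1, hc₀, mul_assoc, ← lintegral_const_mul' _ _
      (ENNReal.rpow_ne_top_of_nonneg hq1.le hbt)]
    refine mul_le_mul_right (lintegral_mono fun s => ?_) _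
    have h2 : k s t * Ψ s ^ α * (b * V s ^ (β + 1)) ≤ ∫⁻ z in Iio s, k z t * g z ∂σ := by
      rw [hb, ← setLIntegral_Iio_rpow σ (hVt s) (by linarith : 0 < β + 1), add_sub_cancel_right,
        ← lintegral_const_mul _ (hVm.pow_const _)]
      refine setLIntegral_mono' measurableSet_Iio fun z hz => ?_
      rw [hg, mul_assoc]
      exact mul_le_mul' (hanti t (le_of_lt hz))
        (mul_le_mul_left (ENNReal.rpow_le_rpow (hΨanti (le_of_lt hz)) hα0) _)
    have hx : ∀ x : ℝ≥0∞, x ^ q = x * x ^ (q - 1) := by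
      intro x
      nth_rw 2 [← ENNReal.rpow_one x]
      rw [← ENNReal.rpow_add_of_nonneg _ _ zero_le_one hq1.le, add_sub_cancel]
    calc b ^ (q - 1) * (k s t ^ q * Ψ s ^ (r / p) * V s ^ (r / q'))
        = k s t * g s * (k s t * Ψ s ^ α * (b * V s ^ (β + 1))) ^ (q - 1) := by
          have h3 : Ψ s ^ (r / p) = Ψ s ^ α * (Ψ s ^ α) ^ (q - 1) := by
            rw [← hx, rpow_mul_eq]; rw [hα]; field_simp
          have h4 : V s ^ (r / q') = V s ^ β * (V s ^ (β + 1)) ^ (q - 1) := by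
            rw [rpow_mul_eq _ rfl, ← ENNReal.rpow_add_of_nonneg _ _ hβ0 (by positivity), e4]
          rw [ENNReal.mul_rpow_of_nonneg _ _ hq1.le, ENNReal.mul_rpow_of_nonneg _ _ hq1.le,
            ENNReal.mul_rpow_of_nonneg _ _ hq1.le, h3, h4, hx (k s t), hg]
          ring
      _ ≤ k s t * g s * (∫⁻ z in Iio s, k z t * g z ∂σ) ^ (q - 1) := by gcongr
  have hswap : ∫⁻ t, ∫⁻ s in Iio t, k s t ^ q * Ψ s ^ (r / p) * V s ^ (r / q') ∂σ ∂ν = J := by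
    have hm : Measurable (Function.uncurry
        fun s t => k s t ^ q * Ψ s ^ (r / p) * V s ^ (r / q')) :=
      ((hk.pow_const q).mul ((hΨm.pow_const _).comp measurable_fst)).mul
        ((hVm.pow_const _).comp measurable_fst)
    rw [lintegral_setLIntegral_swap σ ν hm]
    refine lintegral_congr fun s => ?_
    have hks : Measurable fun t => k s t ^ q := hk.of_uncurry_left.pow_const q
    rw [lintegral_mul_const _ (hks.mul_const _), lintegral_mul_const _ hks, ← e3,
      ENNReal.rpow_add_of_nonneg _ _ (by positivity) zero_le_one, ENNReal.rpow_one,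
      mul_comm (Ψ s ^ (r / p))]
  have hmain : c₀ * J ≤ (M * J ^ (1 / p)) ^ q := by
    have h5 := h g hgm (by rwa [hgp])
    rw [hgp, rpow_le_iff hq0] at h5
    refine le_trans ?_ h5
    rw [← hswap, ← lintegral_const_mul' _ _ hc₀t]
    exact lintegral_mono hlow
  have h6 : J ≤ c₀⁻¹ * M ^ q * J ^ (q / p) := by
    rw [ENNReal.mul_rpow_of_nonneg _ _ hq0.le, rpow_mul_eq J (c := q / p) (by ring)] at hmain
    rw [mul_assoc, mul_comm, ← div_eq_mul_inv, ENNReal.le_div_iff_mul_le (Or.inl hc₀0)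
      (Or.inl hc₀t), mul_comm]
    exact hmain
  have h7 := rpow_le_of_le_mul_rpow hJt (by positivity) e2 h6
  calc J = (J ^ (q / r)) ^ (r / q) := by
        rw [rpow_mul_eq _ (c := 1) (by field_simp), ENNReal.rpow_one]
    _ ≤ (c₀⁻¹ * M ^ q) ^ (r / q) := by gcongr
    _ = _ := by
        rw [ENNReal.mul_rpow_of_nonneg _ _ (by positivity), ENNReal.mul_rpow_of_nonneg _ _ hr0.le,
          rpow_mul_eq M (c := r) (by field_simp), rpow_mul_eq _ (c := r / q) (by ring)]

/-- Third necessary condition for boundedness. -/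
lemma exists_integral_condition (hp : p.HolderConjugate p') (hq : q.HolderConjugate q')
    (hr : r⁻¹ = q⁻¹ - p⁻¹) (hr0 : 0 < r) :
    ∃ C : ℝ≥0, ∀ (σ ν : Measure ℝ) [SigmaFinite σ] [SigmaFinite ν] [NullSingletonClass σ]
      (k : ℝ → ℝ → ℝ≥0∞), Measurable (Function.uncurry k) → (∀ t, Antitone fun s => k s t) →
      ∀ M, IsBddKernel p q σ ν k M →
      (∫⁻ x, (∫⁻ t in Ioi x, k x t ^ q ∂ν) ^ (r / q) * σ (Iio x) ^ (r / q') ∂σ) ^ (1 / r) ≤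
        C * M := by
  have hp0 := hp.pos
  have hq0 := hq.pos
  have hq'0 := hq.symm.pos
  set C := (ENNReal.ofReal q * (ENNReal.ofReal (r / (p * q') + 1))⁻¹ ^ (q - 1))⁻¹ ^ (1 / q) with hC
  have hCt : C ≠ ∞ := by
    refine ENNReal.rpow_ne_top_of_nonneg (by positivity) (ENNReal.inv_ne_top.mpr ?_)
    refine mul_ne_zero (by simpa using hq0) ?_
    refine (ENNReal.rpow_pos (ENNReal.inv_pos.mpr ENNReal.ofReal_ne_top) ?_).ne'
    simp only [ne_eq, ENNReal.inv_eq_top, ENNReal.ofReal_eq_zero, not_le]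
    positivity
  refine ⟨C.toNNReal, ?_⟩
  intro σ ν _ _ _ k hk hanti M h
  rw [ENNReal.coe_toNNReal hCt, rpow_le_iff hr0]
  set E := spanningSets σ with hE
  have hEmono : Monotone E := monotone_spanningSets σ
  have hEm : ∀ n, MeasurableSet (E n) := measurableSet_spanningSets σ
  set F := spanningSets ν with hF
  have hFmono : Monotone F := monotone_spanningSets ν
  have hFm : ∀ n, MeasurableSet (F n) := measurableSet_spanningSets ν
  -- Cutting the kernel at height n keeps it antitone and makes the finite case applicable; a
  -- smaller kernel on smaller measures keeps the bound M.
  set kn : ℕ → ℝ → ℝ → ℝ≥0∞ := fun n s t => min (k s t) n with hkn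
  have hknm : ∀ n, Measurable (Function.uncurry (kn n)) := fun n => hk.min measurable_const
  have hknmono : ∀ s t, Monotone fun n => kn n s t := fun s t m n hmn =>
    min_le_min le_rfl (by exact_mod_cast hmn)
  have hΨ : ∀ x, ∫⁻ t in Ioi x, k x t ^ q ∂ν
      = ⨆ n, ∫⁻ t in Ioi x, kn n x t ^ q ∂(ν.restrict (F n)) := by
    intro x
    have h1 : ∀ t, k x t ^ q = ⨆ n, kn n x t ^ q := by
      intro t
      rw [← rpow_iSup _ hq0]
      congr 1
      rw [← inf_iSup_eq, ENNReal.iSup_natCast, inf_top_eq]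
    simp_rw [h1]
    rw [setLIntegral_iUnion_iSup hFmono hFm (ae_restrict_of_ae (ae_mem_iUnion_spanningSets ν))]
    · refine iSup_congr fun n => ?_
      rw [Measure.restrict_restrict (hFm n), Measure.restrict_restrict measurableSet_Ioi,
        inter_comm]
    · exact fun n => (hknm n).of_uncurry_left.pow_const q
    · exact fun m n hmn t => ENNReal.rpow_le_rpow (hknmono x t hmn) hq0.le
  have hΨmono : ∀ x, Monotone fun n => ∫⁻ t in Ioi x, kn n x t ^ q ∂(ν.restrict (F n)) := by
    intro x m n hmn
    refine (lintegral_mono fun t => ENNReal.rpow_le_rpow (hknmono x t hmn) hq0.le).trans ?_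
    exact setLIntegral_mono_restrict hFmono _ _ hmn
  have hV : ∀ x, σ (Iio x) = ⨆ n, (σ.restrict (E n)) (Iio x) := fun x =>
    measure_iUnion_eq_iSup_inter hEmono (ae_mem_iUnion_spanningSets σ) measurableSet_Iio
  have hint : ∀ x, (∫⁻ t in Ioi x, k x t ^ q ∂ν) ^ (r / q) * σ (Iio x) ^ (r / q') =
      ⨆ n, (∫⁻ t in Ioi x, kn n x t ^ q ∂(ν.restrict (F n))) ^ (r / q) *
        (σ.restrict (E n)) (Iio x) ^ (r / q') := by
    intro x
    rw [hΨ, hV, rpow_iSup _ (by positivity), rpow_iSup _ (by positivity)]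
    refine iSup_mul_iSup_of_monotone ?_ ?_
    · exact fun m n hmn => ENNReal.rpow_le_rpow (hΨmono x hmn) (by positivity)
    · exact fun m n hmn => ENNReal.rpow_le_rpow (restrict_mono_apply hEmono _ hmn) (by positivity)
  simp_rw [hint]
  rw [setLIntegral_iUnion_iSup hEmono hEm (ae_mem_iUnion_spanningSets σ)]
  · refine iSup_le fun n => ?_
    have hfin := IsBddKernel.integral_condition_of_finite (M := M) hp hq hr hr0
      (σ := σ.restrict (E n)) (ν := ν.restrict (F n))
      (hknm n) (fun t s s' hs => min_le_min (hanti t hs) le_rfl) (ENNReal.natCast_ne_top n)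
      (fun s t => min_le_right _ _) ?_
    · exact hfin
    · intro g hg hP
      have hgE : ∫⁻ s, (E n).indicator g s ^ p ∂σ = ∫⁻ s in E n, g s ^ p ∂σ := by
        rw [← lintegral_indicator (hEm n)]
        refine lintegral_congr fun s => ?_
        by_cases hs : s ∈ E n
        · rw [indicator_of_mem hs, indicator_of_mem hs]
        · rw [indicator_of_notMem hs, indicator_of_notMem hs, ENNReal.zero_rpow_of_pos hp0]
      have h1 := h _ (hg.indicator (hEm n)) (by rwa [hgE])
      rw [hgE] at h1
      refine le_trans (ENNReal.rpow_le_rpow ?_ (by positivity)) h1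
      refine lintegral_mono' Measure.restrict_le_self fun t => ENNReal.rpow_le_rpow ?_ hq0.le
      rw [Measure.restrict_restrict measurableSet_Iio, inter_comm,
        ← Measure.restrict_restrict (hEm n), ← lintegral_indicator (hEm n)]
      refine lintegral_mono fun s => ?_
      by_cases hs : s ∈ E n
      · rw [indicator_of_mem hs, indicator_of_mem hs]
        exact mul_le_mul_left (min_le_left _ _) _
      · rw [indicator_of_notMem hs]; exact zero_le
  · intro n
    refine Measurable.mul ?_ ((measurable_measure_Iio _).pow_const _)
    exact (measurable_setLIntegral_Ioi _ (F := fun x t => kn n x t ^ q)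
      ((hknm n).pow_const q)).pow_const _
  · exact fun m n hmn x => mul_le_mul' (ENNReal.rpow_le_rpow (hΨmono x hmn) (by positivity))
      (ENNReal.rpow_le_rpow (restrict_mono_apply hEmono _ hmn) (by positivity))

/-- Fourth necessary condition for boundedness. -/
lemma exists_integral_condition_adjoint (hp : p.HolderConjugate p') (hq : q.HolderConjugate q')
    (hr : r⁻¹ = q⁻¹ - p⁻¹) (hr0 : 0 < r) :
    ∃ C : ℝ≥0, ∀ (σ ν : Measure ℝ) [SigmaFinite σ] [SigmaFinite ν] [NullSingletonClass ν]
      (k : ℝ → ℝ → ℝ≥0∞), Measurable (Function.uncurry k) → (∀ s, Monotone fun t => k s t) →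
      ∀ M, IsBddKernel p q σ ν k M →
      (∫⁻ x, ν (Ioi x) ^ (r / p) * (∫⁻ s in Iio x, k s x ^ p' ∂σ) ^ (r / p') ∂ν) ^ (1 / r) ≤
        C * M := by
  -- The exponent r is unchanged when the pair (p,q) is replaced by (q',p'), so the previous
  -- condition can be applied to the adjoint.
  have hr' : r⁻¹ = p'⁻¹ - q'⁻¹ := by
    have h1 := hp.inv_add_inv_eq_one
    have h2 := hq.inv_add_inv_eq_one
    linarith
  obtain ⟨C, hC⟩ := exists_integral_condition hq.symm hp.symm hr' hr0
  refine ⟨C, fun σ ν _ _ _ k hk hmono M h => ?_⟩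
  have := hC (reflect ν) (reflect σ) (fun s t => k (-t) (-s))
    (hk.comp ((measurable_snd.neg).prodMk (measurable_fst.neg)))
    (fun t s s' hs => hmono (-t) (neg_le_neg hs)) M (h.adjoint hp hq hk)
  rw [lintegral_reflect] at this
  simp_rw [setLIntegral_reflect_Ioi, reflect_Iio, neg_neg] at this
  simp_rw [mul_comm (ν _ ^ (r / p))]
  exact this

end IntegralCondition

/-! ### Weighted forms of the Hardy and kernel criteria -/

section Weighted

/-- Boundedness, with constant `M`, of `g ↦ ∫_{s<t} k(s,t) γ(s) g(s) dμ(s)` from `L^p(μ)` to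
`L^q(ν)`. -/
def IsBddWeighted (p q : ℝ) (μ ν : Measure ℝ) (γ : ℝ → ℝ≥0∞) (k : ℝ → ℝ → ℝ≥0∞) (M : ℝ≥0∞) :
    Prop :=
  ∀ g : ℝ → ℝ≥0∞, Measurable g → ∫⁻ s, g s ^ p ∂μ ≠ ∞ →
    (∫⁻ t, (∫⁻ s in Iio t, k s t * (γ s * g s) ∂μ) ^ q ∂ν) ^ (1 / q) ≤
      M * (∫⁻ s, g s ^ p ∂μ) ^ (1 / p)

variable {p p' q q' r : ℝ}

/-- With dσ = γ^(p') dμ and g = g' γ^(p'-1), one has γ g dμ = g' dσ and g^p dμ = g'^p dσ wherever 0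
< γ < ∞. Where γ = 0 both operators vanish and the norm can only drop. -/
lemma IsBddKernel.weighted (hp : p.HolderConjugate p') {μ ν : Measure ℝ} {γ : ℝ → ℝ≥0∞}
    (hγ : Measurable γ) (hγt : ∀ᵐ s ∂μ, γ s ≠ ∞) {k : ℝ → ℝ → ℝ≥0∞}
    (hk : Measurable (Function.uncurry k)) {M : ℝ≥0∞}
    (h : IsBddKernel p q (μ.withDensity fun s => γ s ^ p') ν k M) :
    IsBddWeighted p q μ ν γ k M := by
  intro g hg hP
  have hp0 := hp.pos
  have hp'0 := hp.symm.pos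
  have hp1 := hp.sub_one_pos
  have hp'1 := hp.symm.sub_one_pos
  have hpp : p' / p = p' - 1 := hp.symm.div_conj_eq_sub_one
  have hγp : Measurable fun s => γ s ^ p' := hγ.pow_const _
  set g' : ℝ → ℝ≥0∞ := fun s => g s * γ s ^ (-(p' - 1)) with hg'
  have hgm : Measurable g' := by fun_prop
  have hle : ∫⁻ s, g' s ^ p ∂(μ.withDensity fun s => γ s ^ p') ≤ ∫⁻ s, g s ^ p ∂μ := by
    rw [lintegral_withDensity_eq_lintegral_mul _ hγp (hgm.pow_const _)]
    refine lintegral_mono_ae ?_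
    filter_upwards [hγt] with s hs
    rw [Pi.mul_apply, hg']; dsimp only
    rcases eq_or_ne (γ s) 0 with h0 | h0
    · rw [h0, ENNReal.zero_rpow_of_pos hp'0, zero_mul]; exact zero_le
    · rw [ENNReal.mul_rpow_of_nonneg _ _ hp0.le, rpow_mul_eq _ (c := -p')
        (by rw [← hpp]; field_simp), mul_left_comm, rpow_add_eq h0 hs (add_neg_cancel _),
        ENNReal.rpow_zero, mul_one]
  have heq : ∀ t, ∫⁻ s in Iio t, k s t * g' s ∂(μ.withDensity fun s => γ s ^ p') =
      ∫⁻ s in Iio t, k s t * (γ s * g s) ∂μ := by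
    intro t
    rw [restrict_withDensity measurableSet_Iio, lintegral_withDensity_eq_lintegral_mul _ hγp
      (g := fun s => k s t * g' s) (hk.of_uncurry_right.mul hgm)]
    refine lintegral_congr_ae ?_
    filter_upwards [ae_restrict_of_ae hγt] with s hs
    rw [Pi.mul_apply, hg']; dsimp only
    rcases eq_or_ne (γ s) 0 with h0 | h0
    · rw [h0, ENNReal.zero_rpow_of_pos hp'0]; simp
    · calc γ s ^ p' * (k s t * (g s * γ s ^ (-(p' - 1))))
          = k s t * ((γ s ^ p' * γ s ^ (-(p' - 1))) * g s) := by ring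
        _ = _ := by
          rw [rpow_add_eq h0 hs (c := 1) (by ring), ENNReal.rpow_one]
  have := h g' hgm (ne_top_of_le_ne_top hP hle)
  simp_rw [heq] at this
  exact this.trans (mul_le_mul_right (ENNReal.rpow_le_rpow hle hp.one_div_nonneg) _)

/-- The same substitution in reverse. It multiplies by a nonnegative power of γ, so finiteness of γ
is not needed. -/
lemma IsBddWeighted.kernel (hp : p.HolderConjugate p') {μ ν : Measure ℝ} {γ : ℝ → ℝ≥0∞}
    (hγ : Measurable γ) {k : ℝ → ℝ → ℝ≥0∞}
    (hk : Measurable (Function.uncurry k)) {M : ℝ≥0∞} (h : IsBddWeighted p q μ ν γ k M) :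
    IsBddKernel p q (μ.withDensity fun s => γ s ^ p') ν k M := by
  intro g hg hP
  have hp'1 := hp.symm.sub_one_pos
  have hpp : p' / p = p' - 1 := hp.symm.div_conj_eq_sub_one
  have hp0 := hp.pos
  have hγp : Measurable fun s => γ s ^ p' := hγ.pow_const _
  set g' : ℝ → ℝ≥0∞ := fun s => g s * γ s ^ (p' - 1) with hg'
  have hgm : Measurable g' := by fun_prop
  have hle : ∫⁻ s, g s ^ p ∂(μ.withDensity fun s => γ s ^ p') = ∫⁻ s, g' s ^ p ∂μ := by
    rw [lintegral_withDensity_eq_lintegral_mul _ hγp (hg.pow_const _)]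
    refine lintegral_congr fun s => ?_
    rw [Pi.mul_apply, hg']; dsimp only
    rw [ENNReal.mul_rpow_of_nonneg _ _ hp0.le, rpow_mul_eq _ (c := p')
        (by rw [← hpp]; field_simp), mul_comm]
  have heq : ∀ t, ∫⁻ s in Iio t, k s t * g s ∂(μ.withDensity fun s => γ s ^ p') =
      ∫⁻ s in Iio t, k s t * (γ s * g' s) ∂μ := by
    intro t
    rw [restrict_withDensity measurableSet_Iio, lintegral_withDensity_eq_lintegral_mul _ hγp
      (g := fun s => k s t * g s) (hk.of_uncurry_right.mul hg)]
    refine lintegral_congr fun s => ?_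
    have : γ s ^ p' = γ s * γ s ^ (p' - 1) := by
      nth_rw 2 [← ENNReal.rpow_one (γ s)]
      rw [← ENNReal.rpow_add_of_nonneg _ _ zero_le_one hp'1.le, add_sub_cancel]
    rw [Pi.mul_apply, hg', this]; dsimp only
    ring
  rw [hle] at hP ⊢
  have := h g' hgm hP
  simp_rw [heq]
  exact this

/-- Boundedness, with constant `M`, of `g ↦ ∫_{s>t} γ(s) g(s) dμ(s)` from `L^p(μ)` to `L^q(ν)`. -/
def IsBddTail (p q : ℝ) (μ ν : Measure ℝ) (γ : ℝ → ℝ≥0∞) (M : ℝ≥0∞) : Prop :=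
  ∀ g : ℝ → ℝ≥0∞, Measurable g → ∫⁻ s, g s ^ p ∂μ ≠ ∞ →
    (∫⁻ t, (∫⁻ s in Ioi t, γ s * g s ∂μ) ^ q ∂ν) ^ (1 / q) ≤ M * (∫⁻ s, g s ^ p ∂μ) ^ (1 / p)

lemma isBddTail_iff {μ ν : Measure ℝ} {γ : ℝ → ℝ≥0∞} {M : ℝ≥0∞} :
    IsBddTail p q μ ν γ M ↔
      IsBddWeighted p q (reflect μ) (reflect ν) (fun s => γ (-s)) (fun _ _ => 1) M := by
  constructor
  · intro h g hg hP
    rw [lintegral_reflect] at hP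
    have := h (fun s => g (-s)) (hg.comp measurable_neg) hP
    rw [lintegral_reflect, lintegral_reflect]
    simpa [setLIntegral_reflect_Iio] using this
  · intro h g hg hP
    have := h (fun s => g (-s)) (hg.comp measurable_neg) (by simpa [lintegral_reflect] using hP)
    rw [lintegral_reflect, lintegral_reflect] at this
    simpa [setLIntegral_reflect_Iio] using this

lemma withDensity_Iio_rpow (μ : Measure ℝ) (γ : ℝ → ℝ≥0∞) (x : ℝ) :
    (μ.withDensity fun s => γ s ^ p') (Iio x) = ∫⁻ s in Iio x, γ s ^ p' ∂μ :=
  withDensity_apply _ measurableSet_Iio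

lemma sigmaFinite_withDensity_rpow (μ : Measure ℝ) [SigmaFinite μ] (hp : 0 ≤ p')
    {γ : ℝ → ℝ≥0∞} (hγt : ∀ᵐ s ∂μ, γ s ≠ ∞) : SigmaFinite (μ.withDensity fun s => γ s ^ p') := by
  refine SigmaFinite.withDensity_of_ne_top ?_
  filter_upwards [hγt] with s hs using ENNReal.rpow_ne_top_of_nonneg hp hs

lemma ae_reflect {μ : Measure ℝ} {P : ℝ → Prop} (h : ∀ᵐ s ∂μ, P s) :
    ∀ᵐ s ∂(reflect μ), P (-s) := by
  rw [ae_iff] at h ⊢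
  rw [reflect_apply]
  convert h using 2
  ext s
  simp

/-- Equivalence for the weighted Hardy operator, `p ≤ q`. -/
lemma exists_weighted_hardy_of_le (hp : p.HolderConjugate p') (hq : q.HolderConjugate q')
    (hpq : p ≤ q) :
    ∃ C : ℝ≥0, ∀ (μ ν : Measure ℝ) [SigmaFinite μ] [SigmaFinite ν] [NullSingletonClass μ]
      (γ : ℝ → ℝ≥0∞), Measurable γ → (∀ᵐ s ∂μ, γ s ≠ ∞) →
      (∀ S : ℝ≥0∞, (∀ x, ν (Ioi x) ^ (1 / q) * (∫⁻ s in Iio x, γ s ^ p' ∂μ) ^ (1 / p') ≤ S) →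
        IsBddWeighted p q μ ν γ (fun _ _ => 1) (C * S)) ∧
      ∀ M : ℝ≥0∞, IsBddWeighted p q μ ν γ (fun _ _ => 1) M →
        ∀ x, ν (Ioi x) ^ (1 / q) * (∫⁻ s in Iio x, γ s ^ p' ∂μ) ^ (1 / p') ≤ M := by
  obtain ⟨C, hC⟩ := exists_hardy_of_le hp hpq
  refine ⟨C, fun μ ν _ _ _ γ hγ hγt => ?_⟩
  have hσ := sigmaFinite_withDensity_rpow μ hp.symm.nonneg hγt
  refine ⟨fun S hS => ?_, fun M h x => ?_⟩
  · refine (hC _ ν S fun x => ?_).weighted hp hγ hγt measurable_const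
    rw [withDensity_Iio_rpow]; exact hS x
  · have := (h.kernel hp hγ measurable_const).mul_head_le hp hq measurable_const
      (fun s => monotone_const) x
    simpa [withDensity_Iio_rpow] using this

/-- Equivalence for the weighted Hardy operator, `q < p`. -/
lemma exists_weighted_hardy_of_lt (hp : p.HolderConjugate p') (hq : q.HolderConjugate q')
    (hr : r⁻¹ = q⁻¹ - p⁻¹) (hr0 : 0 < r) :
    ∃ C : ℝ≥0, ∀ (μ ν : Measure ℝ) [SigmaFinite μ] [SigmaFinite ν] [NullSingletonClass μ]
      [NullSingletonClass ν] (γ : ℝ → ℝ≥0∞), Measurable γ → (∀ᵐ s ∂μ, γ s ≠ ∞) →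
      IsBddWeighted p q μ ν γ (fun _ _ => 1) (C * (∫⁻ x, ν (Ioi x) ^ (r / p) *
        (∫⁻ s in Iio x, γ s ^ p' ∂μ) ^ (r / p') ∂ν) ^ (1 / r)) ∧
      ∀ M : ℝ≥0∞, IsBddWeighted p q μ ν γ (fun _ _ => 1) M →
        (∫⁻ x, ν (Ioi x) ^ (r / p) * (∫⁻ s in Iio x, γ s ^ p' ∂μ) ^ (r / p') ∂ν) ^ (1 / r) ≤
          C * M := by
  obtain ⟨C, hC⟩ := exists_hardy_of_lt hp hq hr hr0
  obtain ⟨C', hC'⟩ := exists_integral_condition_adjoint hp hq hr hr0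
  refine ⟨max C C', fun μ ν _ _ _ _ γ hγ hγt => ?_⟩
  have hσ := sigmaFinite_withDensity_rpow μ hp.symm.nonneg hγt
  refine ⟨?_, fun M h => ?_⟩
  · refine ((hC (μ.withDensity fun s => γ s ^ p') ν).mono ?_).weighted hp hγ hγt measurable_const
    simp_rw [withDensity_Iio_rpow]
    gcongr
    exact le_max_left _ _
  · have := hC' _ ν _ measurable_const (fun s => monotone_const) M
      (h.kernel hp hγ measurable_const)
    simp only [ENNReal.one_rpow, lintegral_const, one_mul, Measure.restrict_apply MeasurableSet.univ,
      univ_inter, withDensity_Iio_rpow] at this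
    refine this.trans ?_
    gcongr
    exact le_max_right _ _

/-- Equivalence for the adjoint Hardy operator, `p ≤ q`. -/
lemma exists_tail_hardy_of_le (hp : p.HolderConjugate p') (hq : q.HolderConjugate q')
    (hpq : p ≤ q) :
    ∃ C : ℝ≥0, ∀ (μ ν : Measure ℝ) [SigmaFinite μ] [SigmaFinite ν] [NullSingletonClass μ]
      (γ : ℝ → ℝ≥0∞), Measurable γ → (∀ᵐ s ∂μ, γ s ≠ ∞) →
      (∀ S : ℝ≥0∞, (∀ x, ν (Iio x) ^ (1 / q) * (∫⁻ s in Ioi x, γ s ^ p' ∂μ) ^ (1 / p') ≤ S) →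
        IsBddTail p q μ ν γ (C * S)) ∧
      ∀ M : ℝ≥0∞, IsBddTail p q μ ν γ M →
        ∀ x, ν (Iio x) ^ (1 / q) * (∫⁻ s in Ioi x, γ s ^ p' ∂μ) ^ (1 / p') ≤ M := by
  obtain ⟨C, hC⟩ := exists_weighted_hardy_of_le hp hq hpq
  refine ⟨C, fun μ ν _ _ _ γ hγ hγt => ?_⟩
  obtain ⟨h1, h2⟩ := hC (reflect μ) (reflect ν) (fun s => γ (-s)) (hγ.comp measurable_neg)
    (ae_reflect hγt)
  refine ⟨fun S hS => isBddTail_iff.mpr (h1 S fun x => ?_), fun M h x => ?_⟩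
  · simpa [setLIntegral_reflect_Iio, reflect_Ioi] using hS (-x)
  · simpa [setLIntegral_reflect_Iio, reflect_Ioi] using h2 M (isBddTail_iff.mp h) (-x)

/-- Equivalence for the adjoint Hardy operator, `q < p`. -/
lemma exists_tail_hardy_of_lt (hp : p.HolderConjugate p') (hq : q.HolderConjugate q')
    (hr : r⁻¹ = q⁻¹ - p⁻¹) (hr0 : 0 < r) :
    ∃ C : ℝ≥0, ∀ (μ ν : Measure ℝ) [SigmaFinite μ] [SigmaFinite ν] [NullSingletonClass μ]
      [NullSingletonClass ν] (γ : ℝ → ℝ≥0∞), Measurable γ → (∀ᵐ s ∂μ, γ s ≠ ∞) →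
      IsBddTail p q μ ν γ (C * (∫⁻ x, ν (Iio x) ^ (r / p) *
        (∫⁻ s in Ioi x, γ s ^ p' ∂μ) ^ (r / p') ∂ν) ^ (1 / r)) ∧
      ∀ M : ℝ≥0∞, IsBddTail p q μ ν γ M →
        (∫⁻ x, ν (Iio x) ^ (r / p) * (∫⁻ s in Ioi x, γ s ^ p' ∂μ) ^ (r / p') ∂ν) ^ (1 / r) ≤
          C * M := by
  obtain ⟨C, hC⟩ := exists_weighted_hardy_of_lt hp hq hr hr0
  refine ⟨C, fun μ ν _ _ _ _ γ hγ hγt => ?_⟩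
  have h := hC (reflect μ) (reflect ν) (fun s => γ (-s)) (hγ.comp measurable_neg)
    (ae_reflect hγt)
  rw [lintegral_reflect] at h
  simp only [setLIntegral_reflect_Iio, reflect_Ioi, neg_neg] at h
  exact ⟨isBddTail_iff.mpr h.1, fun M hM => h.2 M (isBddTail_iff.mp hM)⟩

/-- Equivalence for the weighted kernel operator, `p ≤ q`. -/
lemma exists_weighted_kernel_of_le (hp : p.HolderConjugate p') (hq : q.HolderConjugate q')
    (hpq : p ≤ q) :
    ∃ C : ℝ≥0, ∀ (μ ν κ : Measure ℝ) [SigmaFinite μ] [SigmaFinite ν] [SFinite κ]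
      [NullSingletonClass μ] [NullSingletonClass κ], μ (Iic 0) = 0 →
      (∀ s x, 0 < s → κ (Ioo s x) ≠ ∞) →
      ∀ γ : ℝ → ℝ≥0∞, Measurable γ → (∀ᵐ s ∂μ, γ s ≠ ∞) →
      (∀ S : ℝ≥0∞,
        (∀ x, (∫⁻ t in Ioi x, κ (Ioo x t) ^ q ∂ν) ^ (1 / q) *
          (∫⁻ s in Iio x, γ s ^ p' ∂μ) ^ (1 / p') ≤ S) →
        (∀ x, ν (Ioi x) ^ (1 / q) *
          (∫⁻ s in Iio x, κ (Ioo s x) ^ p' * γ s ^ p' ∂μ) ^ (1 / p') ≤ S) →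
        IsBddWeighted p q μ ν γ (fun s x => κ (Ioo s x)) (C * S)) ∧
      ∀ M : ℝ≥0∞, IsBddWeighted p q μ ν γ (fun s x => κ (Ioo s x)) M →
        (∀ x, (∫⁻ t in Ioi x, κ (Ioo x t) ^ q ∂ν) ^ (1 / q) *
          (∫⁻ s in Iio x, γ s ^ p' ∂μ) ^ (1 / p') ≤ M) ∧
        (∀ x, ν (Ioi x) ^ (1 / q) *
          (∫⁻ s in Iio x, κ (Ioo s x) ^ p' * γ s ^ p' ∂μ) ^ (1 / p') ≤ M) := by
  obtain ⟨C, hC⟩ := exists_kernel_bdd_of_le hp hpq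
  refine ⟨C, fun μ ν κ _ _ _ _ _ hμ0 hκ γ hγ hγt => ?_⟩
  have hσ := sigmaFinite_withDensity_rpow μ hp.symm.nonneg hγt
  have hκm := measurable_measure_Ioo κ
  have hσ0 : (μ.withDensity fun s => γ s ^ p') (Iic 0) = 0 :=
    withDensity_absolutelyContinuous _ _ hμ0
  have hint : ∀ x, ∫⁻ s in Iio x, κ (Ioo s x) ^ p' ∂(μ.withDensity fun s => γ s ^ p') =
      ∫⁻ s in Iio x, κ (Ioo s x) ^ p' * γ s ^ p' ∂μ := by
    intro x
    rw [restrict_withDensity measurableSet_Iio, lintegral_withDensity_eq_lintegral_mul _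
      (hγ.pow_const _) (hκm.of_uncurry_right.pow_const _)]
    exact lintegral_congr fun s => mul_comm _ _
  refine ⟨fun S h1 h2 => ?_, fun M h => ⟨fun x => ?_, fun x => ?_⟩⟩
  · refine (hC _ ν κ hσ0 hκ S (fun x => ?_) fun x => ?_).weighted hp hγ hγt hκm
    · rw [withDensity_Iio_rpow]; exact h1 x
    · rw [hint]; exact h2 x
  · have := (h.kernel hp hγ hκm).tail_mul_le (k := fun s x => κ (Ioo s x)) hp hq.pos
      (fun t s s' hs => measure_mono (Ioo_subset_Ioo_left hs)) x
    rwa [withDensity_Iio_rpow] at this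
  · have := (h.kernel hp hγ hκm).mul_head_le hp hq hκm
      (fun s t t' ht => measure_mono (Ioo_subset_Ioo_right ht)) x
    rwa [hint] at this

/-- Equivalence for the weighted kernel operator, `q < p`. -/
lemma exists_weighted_kernel_of_lt (hp : p.HolderConjugate p') (hq : q.HolderConjugate q')
    (hr : r⁻¹ = q⁻¹ - p⁻¹) (hr0 : 0 < r) :
    ∃ C : ℝ≥0, ∀ (μ ν κ : Measure ℝ) [SigmaFinite μ] [SigmaFinite ν] [SFinite κ]
      [NullSingletonClass μ] [NullSingletonClass ν] [NullSingletonClass κ], μ (Iic 0) = 0 →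
      (∀ s x, 0 < s → κ (Ioo s x) ≠ ∞) →
      ∀ γ : ℝ → ℝ≥0∞, Measurable γ → (∀ᵐ s ∂μ, γ s ≠ ∞) → ∀ J₁ J₂ : ℝ≥0∞,
      J₁ = (∫⁻ x, ν (Ioi x) ^ (r / p) *
          (∫⁻ s in Iio x, κ (Ioo s x) ^ p' * γ s ^ p' ∂μ) ^ (r / p') ∂ν) ^ (1 / r) →
      J₂ = (∫⁻ x, (∫⁻ t in Ioi x, κ (Ioo x t) ^ q ∂ν) ^ (r / q) *
          (∫⁻ s in Iio x, γ s ^ p' ∂μ) ^ (r / q') * γ x ^ p' ∂μ) ^ (1 / r) →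
      IsBddWeighted p q μ ν γ (fun s x => κ (Ioo s x)) (C * (J₁ + J₂)) ∧
      ∀ M : ℝ≥0∞, IsBddWeighted p q μ ν γ (fun s x => κ (Ioo s x)) M →
        J₁ ≤ C * M ∧ J₂ ≤ C * M := by
  obtain ⟨C, hC⟩ := exists_kernel_bdd_of_lt hp hq hr hr0
  obtain ⟨C₁, hC₁⟩ := exists_integral_condition_adjoint hp hq hr hr0
  obtain ⟨C₂, hC₂⟩ := exists_integral_condition hp hq hr hr0
  refine ⟨max C (max C₁ C₂), fun μ ν κ _ _ _ _ _ _ hμ0 hκ γ hγ hγt J₁ J₂ hJ₁ hJ₂ => ?_⟩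
  have hσ := sigmaFinite_withDensity_rpow μ hp.symm.nonneg hγt
  have hκm := measurable_measure_Ioo κ
  have hσ0 : (μ.withDensity fun s => γ s ^ p') (Iic 0) = 0 :=
    withDensity_absolutelyContinuous _ _ hμ0
  have hint : ∀ x, ∫⁻ s in Iio x, κ (Ioo s x) ^ p' ∂(μ.withDensity fun s => γ s ^ p') =
      ∫⁻ s in Iio x, κ (Ioo s x) ^ p' * γ s ^ p' ∂μ := by
    intro x
    rw [restrict_withDensity measurableSet_Iio, lintegral_withDensity_eq_lintegral_mul _
      (hγ.pow_const _) (hκm.of_uncurry_right.pow_const _)]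
    exact lintegral_congr fun s => mul_comm _ _
  have hJ₂' : J₂ = (∫⁻ x, (∫⁻ t in Ioi x, κ (Ioo x t) ^ q ∂ν) ^ (r / q) *
            (μ.withDensity fun s => γ s ^ p') (Iio x) ^ (r / q')
            ∂(μ.withDensity fun s => γ s ^ p')) ^ (1 / r) := by
    rw [hJ₂, lintegral_withDensity_eq_lintegral_mul _ (hγ.pow_const _)]
    · congr 1
      refine lintegral_congr fun x => ?_
      rw [Pi.mul_apply, withDensity_Iio_rpow]; ring
    · exact ((measurable_setLIntegral_Ioi ν (F := fun x t => κ (Ioo x t) ^ q)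
        (hκm.pow_const q)).pow_const _).mul ((measurable_measure_Iio _).pow_const _)
  refine ⟨?_, fun M h => ⟨?_, ?_⟩⟩
  · refine ((hC (μ.withDensity fun s => γ s ^ p') ν κ hσ0 hκ).mono ?_).weighted hp hγ hγt hκm
    simp_rw [hint]
    rw [← hJ₁, ← hJ₂']
    gcongr
    exact le_max_left _ _
  · have := hC₁ _ ν _ hκm (fun s t t' ht => measure_mono (Ioo_subset_Ioo_right ht)) M
      (h.kernel hp hγ hκm)
    simp_rw [hint] at this
    rw [← hJ₁] at this
    refine this.trans ?_
    gcongr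
    exact (le_max_left _ _).trans (le_max_right _ _)
  · have := hC₂ _ ν _ hκm (fun t s s' hs => measure_mono (Ioo_subset_Ioo_left hs)) M
      (h.kernel hp hγ hκm)
    rw [← hJ₂'] at this
    refine this.trans ?_
    gcongr
    exact (le_max_right _ _).trans (le_max_right _ _)

end Weighted

/-! ### The iterated operator on tail averages -/

section Reduction

/-- The iterated integral `x ↦ ∫_{t<x} ∫_{s<t} f dβ dκ`. -/
def iterOp (β κ : Measure ℝ) (f : ℝ → ℝ≥0∞) (x : ℝ) : ℝ≥0∞ :=
  ∫⁻ t in Iio x, ∫⁻ s in Iio t, f s ∂β ∂κ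

/-- The tail average `s ↦ ∫_{y>s} g(y)/μ(Iio y) dμ(y)`. -/
def tailAvg (μ : Measure ℝ) (g : ℝ → ℝ≥0∞) (s : ℝ) : ℝ≥0∞ :=
  ∫⁻ y in Ioi s, (μ (Iio y))⁻¹ * g y ∂μ

variable {p p' q q' r : ℝ} {μ ν β κ : Measure ℝ}

lemma antitone_tailAvg (g : ℝ → ℝ≥0∞) : Antitone (tailAvg μ g) :=
  antitone_setLIntegral_Ioi _ _

lemma setLIntegral_tail_eq [SFinite μ] [SFinite β] {h : ℝ → ℝ≥0∞} (hh : Measurable h) (t : ℝ) :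
    ∫⁻ s in Iio t, ∫⁻ y in Ioi s, h y ∂μ ∂β = ∫⁻ y, h y * β (Iio (min y t)) ∂μ := by
  rw [← lintegral_setLIntegral_swap (β.restrict (Iio t)) μ (F := fun _ y => h y)
    (hh.comp measurable_snd)]
  refine lintegral_congr fun y => ?_
  rw [setLIntegral_const, Measure.restrict_apply measurableSet_Iio, Iio_inter_Iio]

lemma setLIntegral_measure_Iio_min [NullSingletonClass κ] {x y : ℝ} (hyx : y < x) :
    ∫⁻ t in Iio x, β (Iio (min y t)) ∂κ =
      ∫⁻ t in Iio y, β (Iio t) ∂κ + β (Iio y) * κ (Ioo y x) := by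
  have : Iio x = Iio y ∪ Ico y x := (Iio_union_Ico_eq_Iio hyx.le).symm
  have hd : Disjoint (Iio y) (Ico y x) :=
    Set.disjoint_left.mpr fun z hz hz' => not_lt.mpr hz'.1 hz
  rw [this, lintegral_union measurableSet_Ico hd]
  congr 1
  · exact setLIntegral_congr_fun measurableSet_Iio fun t ht => by
      rw [min_eq_right (le_of_lt ht)]
  · rw [setLIntegral_congr_fun (g := fun _ => β (Iio y)) measurableSet_Ico fun t ht => by
      rw [min_eq_left ht.1], setLIntegral_const, measure_congr Ioo_ae_eq_Ico]

/-- Fubini gives ∫ h(y) ∫_{t<x} β(Iio (min y t)) dκ dμ(y). For y < x, splitting at t = y yields A(y)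
+ B(y) κ(y,x); for y > x the minimum is always t and the inner integral is A(x). -/
lemma iterOp_tail_eq [SFinite μ] [SFinite β] [SFinite κ] [NullSingletonClass κ]
    [NullSingletonClass μ] {h : ℝ → ℝ≥0∞} (hh : Measurable h) (x : ℝ) :
    iterOp β κ (fun s => ∫⁻ y in Ioi s, h y ∂μ) x =
      ∫⁻ y in Iio x, h y * (∫⁻ t in Iio y, β (Iio t) ∂κ) ∂μ +
      ∫⁻ y in Iio x, h y * (β (Iio y) * κ (Ioo y x)) ∂μ +
      (∫⁻ t in Iio x, β (Iio t) ∂κ) * ∫⁻ y in Ioi x, h y ∂μ := by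
  unfold iterOp
  simp_rw [setLIntegral_tail_eq hh]
  have hBm : Measurable fun x => β (Iio x) := measurable_measure_Iio β
  have hBmin : ∀ y, Measurable fun t => β (Iio (min y t)) :=
    fun y => hBm.comp (measurable_const.min measurable_id)
  have hAm : Measurable fun x => ∫⁻ t in Iio x, β (Iio t) ∂κ :=
    (monotone_setLIntegral_Iio κ _).measurable
  rw [lintegral_lintegral_swap (by
    refine Measurable.aemeasurable ?_
    exact (hh.comp measurable_snd).mul (hBm.comp (measurable_snd.min measurable_fst)))]
  rw [← lintegral_add_compl _ (measurableSet_Iio (a := x)), compl_Iio]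
  congr 1
  · rw [← lintegral_add_left (f := fun y => h y * ∫⁻ t in Iio y, β (Iio t) ∂κ) (hh.mul hAm)]
    refine setLIntegral_congr_fun measurableSet_Iio fun y hy => ?_
    rw [lintegral_const_mul _ (hBmin y),
      setLIntegral_measure_Iio_min hy, mul_add]
  · rw [setLIntegral_congr (Ioi_ae_eq_Ici (μ := μ) (a := x)).symm, ← lintegral_const_mul _ hh]
    refine setLIntegral_congr_fun measurableSet_Ioi fun y hy => ?_
    rw [lintegral_const_mul _ (hBmin y),
      mul_comm]
    congr 1
    refine setLIntegral_congr_fun measurableSet_Iio fun t ht => ?_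
    rw [min_eq_right (le_of_lt (lt_trans ht hy))]

/-- The iterated integral of a tail average is the sum of a kernel operator, a Hardy operator and
an adjoint Hardy operator. -/
lemma iterOp_tailAvg [SFinite μ] [SFinite β] [SFinite κ] [NullSingletonClass κ]
    [NullSingletonClass μ] {A : ℝ → ℝ≥0∞} (hA : ∀ x, ∫⁻ t in Iio x, β (Iio t) ∂κ = A x)
    {g : ℝ → ℝ≥0∞} (hg : Measurable g) (x : ℝ) :
    iterOp β κ (tailAvg μ g) x =
      ∫⁻ y in Iio x, 1 * (A y / μ (Iio y) * g y) ∂μ +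
      ∫⁻ y in Iio x, κ (Ioo y x) * (β (Iio y) / μ (Iio y) * g y) ∂μ +
      A x * ∫⁻ y in Ioi x, (μ (Iio y))⁻¹ * g y ∂μ := by
  have := iterOp_tail_eq (β := β) (κ := κ) (μ := μ) ((measurable_measure_Iio μ).inv.mul hg) x
  simp only [hA] at this
  refine this.trans ?_
  congr 2
  · refine lintegral_congr fun y => ?_
    simp only [Pi.mul_apply, Pi.inv_apply, div_eq_mul_inv]; ring
  · refine lintegral_congr fun y => ?_
    simp only [Pi.mul_apply, Pi.inv_apply, div_eq_mul_inv]; ring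

/-- Boundedness of the iterated integral operator on tail averages. -/
def IsBddIter (p q : ℝ) (μ ν β κ : Measure ℝ) (M : ℝ≥0∞) : Prop :=
  ∀ g : ℝ → ℝ≥0∞, Measurable g → ∫⁻ s, g s ^ p ∂μ ≠ ∞ →
    (∫⁻ x, iterOp β κ (tailAvg μ g) x ^ q ∂ν) ^ (1 / q) ≤ M * (∫⁻ s, g s ^ p ∂μ) ^ (1 / p)

/-- The outer factor A is absorbed into the target measure, so the third summand becomes a plain
adjoint Hardy operator. -/
lemma lintegral_tail_withDensity (hq : 0 ≤ q) {A : ℝ → ℝ≥0∞} (hAm : Measurable A)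
    (h : ℝ → ℝ≥0∞) :
    ∫⁻ t, (∫⁻ s in Ioi t, h s ∂μ) ^ q ∂(ν.withDensity fun x => A x ^ q) =
      ∫⁻ t, (A t * ∫⁻ s in Ioi t, h s ∂μ) ^ q ∂ν := by
  rw [lintegral_withDensity_eq_lintegral_mul _ (hAm.pow_const _)
    ((antitone_setLIntegral_Ioi μ h).measurable.pow_const _)]
  exact lintegral_congr fun t => (ENNReal.mul_rpow_of_nonneg _ _ hq).symm

variable [SFinite μ] [SFinite β] [SFinite κ] [NullSingletonClass κ] [NullSingletonClass μ]

/-- Minkowski's inequality applied twice to the three summands. -/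
lemma IsBddIter.of_parts (hq : 1 ≤ q) {A : ℝ → ℝ≥0∞} (hAm : Measurable A)
    (hA : ∀ x, ∫⁻ t in Iio x, β (Iio t) ∂κ = A x) {M₁ M₂ M₃ : ℝ≥0∞}
    (h₁ : IsBddTail p q μ (ν.withDensity fun x => A x ^ q) (fun s => (μ (Iio s))⁻¹) M₁)
    (h₂ : IsBddWeighted p q μ ν (fun s => A s / μ (Iio s)) (fun _ _ => 1) M₂)
    (h₃ : IsBddWeighted p q μ ν (fun s => β (Iio s) / μ (Iio s)) (fun s x => κ (Ioo s x)) M₃) :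
    IsBddIter p q μ ν β κ (M₁ + M₂ + M₃) := by
  intro g hg hP
  have hq0 : 0 ≤ q := zero_le_one.trans hq
  have hVm := measurable_measure_Iio μ
  have hBm := measurable_measure_Iio β
  have hκm := measurable_measure_Ioo κ
  have e₁ := h₁ g hg hP
  have e₂ := h₂ g hg hP
  have e₃ := h₃ g hg hP
  rw [lintegral_tail_withDensity hq0 hAm] at e₁
  simp_rw [iterOp_tailAvg hA hg]
  have m₂ : Measurable fun x => ∫⁻ y in Iio x, 1 * (A y / μ (Iio y) * g y) ∂μ :=
    (monotone_setLIntegral_Iio μ _).measurable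
  have m₃ : Measurable fun x =>
      ∫⁻ y in Iio x, κ (Ioo y x) * (β (Iio y) / μ (Iio y) * g y) ∂μ :=
    measurable_setLIntegral_Iio μ (F := fun y x => κ (Ioo y x) * (β (Iio y) / μ (Iio y) * g y))
      (hκm.mul (((hBm.div hVm).mul hg).comp measurable_fst))
  have m₁ : Measurable fun x => A x * ∫⁻ y in Ioi x, (μ (Iio y))⁻¹ * g y ∂μ :=
    hAm.mul (antitone_setLIntegral_Ioi μ _).measurable
  refine (ENNReal.lintegral_Lp_add_le (m₂.add m₃).aemeasurable m₁.aemeasurable hq).trans ?_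
  refine (add_le_add_left (ENNReal.lintegral_Lp_add_le m₂.aemeasurable m₃.aemeasurable hq) _).trans
    ?_
  calc _ ≤ M₂ * (∫⁻ s, g s ^ p ∂μ) ^ (1 / p) + M₃ * (∫⁻ s, g s ^ p ∂μ) ^ (1 / p) +
        M₁ * (∫⁻ s, g s ^ p ∂μ) ^ (1 / p) := add_le_add (add_le_add e₂ e₃) e₁
    _ = _ := by ring

/-- The three summands are nonnegative, so each is pointwise below the whole; this and the next two
lemmas discard the other two. -/
lemma IsBddIter.tail (hq : 0 < q) {A : ℝ → ℝ≥0∞} (hAm : Measurable A)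
    (hA : ∀ x, ∫⁻ t in Iio x, β (Iio t) ∂κ = A x) {M : ℝ≥0∞} (h : IsBddIter p q μ ν β κ M) :
    IsBddTail p q μ (ν.withDensity fun x => A x ^ q) (fun s => (μ (Iio s))⁻¹) M := by
  intro g hg hP
  rw [lintegral_tail_withDensity hq.le hAm]
  refine le_trans ?_ (h g hg hP)
  gcongr with x
  rw [iterOp_tailAvg hA hg]
  exact le_add_self

lemma IsBddIter.hardy (hq : 0 < q) {A : ℝ → ℝ≥0∞}
    (hA : ∀ x, ∫⁻ t in Iio x, β (Iio t) ∂κ = A x) {M : ℝ≥0∞} (h : IsBddIter p q μ ν β κ M) :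
    IsBddWeighted p q μ ν (fun s => A s / μ (Iio s)) (fun _ _ => 1) M := by
  intro g hg hP
  refine le_trans ?_ (h g hg hP)
  gcongr with x
  rw [iterOp_tailAvg hA hg, add_assoc]
  exact le_self_add

lemma IsBddIter.kernel (hq : 0 < q) {M : ℝ≥0∞} (h : IsBddIter p q μ ν β κ M) :
    IsBddWeighted p q μ ν (fun s => β (Iio s) / μ (Iio s)) (fun s x => κ (Ioo s x)) M := by
  intro g hg hP
  refine le_trans ?_ (h g hg hP)
  gcongr with x
  rw [iterOp_tailAvg (fun _ => rfl) hg]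
  exact le_add_self.trans le_self_add

end Reduction

/-! ### Passage between non-increasing functions and tail averages -/

section Copson

variable {p p' q : ℝ}

/-- Copson's inequality: tail averaging is bounded on `L^p(μ)`. -/
lemma exists_tailAvg_bdd (hp : p.HolderConjugate p') :
    ∃ C : ℝ≥0, ∀ (μ : Measure ℝ) [SigmaFinite μ] [NullSingletonClass μ], (∀ x, μ (Iio x) ≠ ∞) →
      ∀ g : ℝ → ℝ≥0∞, Measurable g → ∫⁻ s, g s ^ p ∂μ ≠ ∞ →
        (∫⁻ s, tailAvg μ g s ^ p ∂μ) ^ (1 / p) ≤ C * (∫⁻ s, g s ^ p ∂μ) ^ (1 / p) := by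
  obtain ⟨C, hC⟩ := exists_tail_hardy_of_le hp hp le_rfl
  have hp0 := hp.pos
  have hp'0 := hp.symm.pos
  have hβ := hp.symm.sub_one_pos
  set S : ℝ≥0∞ := ((ENNReal.ofReal (p' - 1))⁻¹) ^ (1 / p') with hS
  have hSt : S ≠ ∞ := ENNReal.rpow_ne_top_of_nonneg hp.symm.one_div_nonneg
    (ENNReal.inv_ne_top.mpr (ENNReal.ofReal_pos.mpr hβ).ne')
  refine ⟨C * S.toNNReal, fun μ _ _ hμ g hg hP => ?_⟩
  rw [ENNReal.coe_mul, ENNReal.coe_toNNReal hSt]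
  refine (hC μ μ (fun s => (μ (Iio s))⁻¹) (measurable_measure_Iio μ).inv ?_).1 S (fun x => ?_)
    g hg hP
  · filter_upwards [ae_measure_Iio_ne_zero μ hμ] with s hs using ENNReal.inv_ne_top.mpr hs
  -- The tail of V^(-p') is at most V(x)^(-(p'-1))/(p'-1), whose p'-th root is a multiple of
  -- V(x)^(-1/p). It cancels V(x)^(1/p), so the supremum in the criterion is a constant depending on
  -- p alone.
  · have h1 : ∫⁻ s in Ioi x, (μ (Iio s))⁻¹ ^ p' ∂μ ≤
        (ENNReal.ofReal (p' - 1))⁻¹ * μ (Iio x) ^ (-(p' - 1)) := by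
      refine le_trans ?_ (setLIntegral_Ici_rpow_neg_le μ hμ x hβ)
      refine (lintegral_mono_set Ioi_subset_Ici_self).trans (lintegral_mono fun s => ?_)
      rw [ENNReal.inv_rpow, ← ENNReal.rpow_neg]
      exact le_of_eq (by congr 1; ring)
    have hpp : p' / p = p' - 1 := hp.symm.div_conj_eq_sub_one
    calc _ ≤ μ (Iio x) ^ (1 / p) *
        ((ENNReal.ofReal (p' - 1))⁻¹ * μ (Iio x) ^ (-(p' - 1))) ^ (1 / p') := by gcongr
      _ = S * (μ (Iio x) ^ (1 / p) * μ (Iio x) ^ (-(1 / p))) := by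
        rw [ENNReal.mul_rpow_of_nonneg _ _ hp.symm.one_div_nonneg,
          rpow_mul_eq (c := -(1 / p)) _ (by rw [← hpp]; field_simp)]
        ring
      _ ≤ S * 1 := by
        gcongr
        rcases eq_or_ne (μ (Iio x)) 0 with h0 | h0
        · rw [h0, ENNReal.zero_rpow_of_pos hp.one_div_pos, zero_mul]; exact zero_le
        · rw [rpow_add_eq h0 (hμ x) (add_neg_cancel _), ENNReal.rpow_zero]
      _ = S := mul_one _

/-- A non-increasing function is dominated by the tail average of its running average, up to a
constant that vanishes when `μ` is infinite. -/
lemma Antitone.le_tailAvg (hp : p.HolderConjugate p') {μ : Measure ℝ} [SFinite μ]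
    [NullSingletonClass μ] (hμ : ∀ x, μ (Iio x) ≠ ∞) {f : ℝ → ℝ≥0∞} (hf : Antitone f) {s : ℝ}
    (hs : μ (Iio s) ≠ 0) :
    f s ≤ tailAvg μ (fun y => (∫⁻ z in Iio y, f z ∂μ) / μ (Iio y)) s +
      (∫⁻ z, f z ^ p ∂μ) ^ (1 / p) * μ univ ^ (-(1 / p)) := by
  have hp0 := hp.pos
  have hle : ∀ y, f y * μ (Iio y) ≤ ∫⁻ z in Iio y, f z ∂μ := by
    intro y
    rw [← setLIntegral_const]
    exact setLIntegral_mono hf.measurable fun z hz => hf (le_of_lt hz)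
  calc f s = f s * μ (Iio s) * (μ (Iio s))⁻¹ := by
        rw [mul_assoc, ENNReal.mul_inv_cancel hs (hμ s), mul_one]
    _ ≤ f s * μ (Iio s) * (∫⁻ y in Ioi s, μ (Iio y) ^ (-2 : ℝ) ∂μ + (μ univ)⁻¹) := by
        gcongr; exact inv_measure_Iio_le μ hμ s hs
    _ ≤ _ := by
      rw [mul_add]
      refine add_le_add ?_ ?_
      -- For y > s, f(s) V(s) ≤ ∫_{z<s} f ≤ ∫_{z<y} f. One factor 1/V(y) makes this the running
      -- average and the other is the weight of the tail average.
      · rw [← lintegral_const_mul _ ((measurable_measure_Iio μ).pow_const _)]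
        refine setLIntegral_mono_ae' measurableSet_Ioi (ae_of_all _ fun y hy => ?_)
        have h2 : μ (Iio y) ^ (-2 : ℝ) = (μ (Iio y))⁻¹ * (μ (Iio y))⁻¹ := by
          rw [ENNReal.rpow_neg, ENNReal.rpow_ofNat, sq, ENNReal.mul_inv (Or.inr (hμ y))
            (Or.inl (hμ y))]
        simp only [h2, div_eq_mul_inv]
        calc _ = (μ (Iio y))⁻¹ * (f s * μ (Iio s) * (μ (Iio y))⁻¹) := by ring
          _ ≤ _ := by
            gcongr
            exact (hle s).trans (lintegral_mono_set (Iio_subset_Iio (le_of_lt hy)))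
      -- The boundary term: Hölder gives V(∞)^(1/p'), and dividing by V(∞) leaves V(∞)^(-1/p). For
      -- infinite total mass the term is zero.
      · calc f s * μ (Iio s) * (μ univ)⁻¹
            ≤ (∫⁻ z, f z ^ p ∂μ) ^ (1 / p) * μ univ ^ (1 / p') * (μ univ)⁻¹ := by
              refine mul_le_mul_left ?_ _
              refine (hle s).trans ((setLIntegral_Iio_le_rpow μ hp hf.measurable.aemeasurable s).trans ?_)
              refine mul_le_mul_right (ENNReal.rpow_le_rpow (measure_mono (subset_univ _))
                hp.symm.one_div_nonneg) _
          _ ≤ _ := by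
            rw [mul_assoc]
            gcongr
            rcases eq_or_ne (μ univ) ∞ with ht | ht
            · simp [ht]
            · have h0 : μ univ ≠ 0 := fun h => hs (measure_mono_null (subset_univ _) h)
              rw [← ENNReal.rpow_neg_one, rpow_add_eq h0 ht (c := -(1 / p))]
              have := hp.inv_add_inv_eq_one
              rw [one_div, one_div]; linarith

/-- The upper bound for the iterated operator on non-increasing functions. -/
lemma IsBddIter.antitone_bdd (hp : p.HolderConjugate p') (hq : 1 ≤ q) {μ ν β κ : Measure ℝ}
    [SFinite μ] [SFinite β] [SFinite κ] [NullSingletonClass μ] (hμ : ∀ x, μ (Iio x) ≠ ∞)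
    (hβ : ∀ᵐ s ∂β, μ (Iio s) ≠ 0)
    {M : ℝ≥0∞} (h : IsBddIter p q μ ν β κ M) {f : ℝ → ℝ≥0∞} (hf : Antitone f)
    (hP : ∫⁻ s, f s ^ p ∂μ ≠ ∞) :
    (∫⁻ x, iterOp β κ f x ^ q ∂ν) ^ (1 / q) ≤
      (ENNReal.ofReal p' * M + μ univ ^ (-(1 / p)) *
        (∫⁻ x, (∫⁻ t in Iio x, β (Iio t) ∂κ) ^ q ∂ν) ^ (1 / q)) *
        (∫⁻ s, f s ^ p ∂μ) ^ (1 / p) := by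
  have hp0 := hp.pos
  have hq0 : 0 < q := zero_lt_one.trans_le hq
  set f' : ℝ → ℝ≥0∞ := fun y => (∫⁻ z in Iio y, f z ∂μ) / μ (Iio y) with hf'
  have hf'm : Measurable f' :=
    (monotone_setLIntegral_Iio μ f).measurable.div (measurable_measure_Iio μ)
  set c := (∫⁻ z, f z ^ p ∂μ) ^ (1 / p) * μ univ ^ (-(1 / p)) with hc
  have hf'n : (∫⁻ s, f' s ^ p ∂μ) ^ (1 / p) ≤
      ENNReal.ofReal p' * (∫⁻ s, f s ^ p ∂μ) ^ (1 / p) := by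
    calc _ ≤ (ENNReal.ofReal p' ^ p * ∫⁻ s, f s ^ p ∂μ) ^ (1 / p) := by
          gcongr
          exact lintegral_average_rpow_le μ hμ hp hf.measurable
      _ = _ := by
        rw [ENNReal.mul_rpow_of_nonneg _ _ hp.one_div_nonneg,
          rpow_mul_eq (c := 1) _ (by field_simp), ENNReal.rpow_one]
  have hf't : ∫⁻ s, f' s ^ p ∂μ ≠ ∞ :=
    ne_top_of_le_ne_top (ENNReal.mul_ne_top (ENNReal.rpow_ne_top_of_nonneg hp0.le
      ENNReal.ofReal_ne_top) hP) (lintegral_average_rpow_le μ hμ hp hf.measurable)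
  have hGm : Measurable (tailAvg μ f') := (antitone_tailAvg f').measurable
  have hAm : Measurable fun x => ∫⁻ t in Iio x, β (Iio t) ∂κ :=
    (monotone_setLIntegral_Iio κ _).measurable
  -- The pointwise majorant is integrated twice. The constant c is thereby multiplied by A(x), and
  -- Minkowski isolates it as the end term.
  have hiter : ∀ x, iterOp β κ f x ≤
      iterOp β κ (tailAvg μ f') x + c * ∫⁻ t in Iio x, β (Iio t) ∂κ := by
    intro x
    unfold iterOp
    rw [← lintegral_const_mul _ (measurable_measure_Iio β), ← lintegral_add_left
      (monotone_setLIntegral_Iio β (tailAvg μ f')).measurable]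
    refine lintegral_mono fun t => ?_
    rw [← setLIntegral_const, ← lintegral_add_left hGm]
    refine lintegral_mono_ae ?_
    filter_upwards [ae_restrict_of_ae hβ] with s hs using Antitone.le_tailAvg hp hμ hf hs
  have hTm : Measurable (iterOp β κ (tailAvg μ f')) :=
    (monotone_setLIntegral_Iio κ _).measurable
  calc _ ≤ (∫⁻ x, (iterOp β κ (tailAvg μ f') x + c * ∫⁻ t in Iio x, β (Iio t) ∂κ) ^ q ∂ν) ^
        (1 / q) := by
        gcongr with x; exact hiter x
    _ ≤ (∫⁻ x, iterOp β κ (tailAvg μ f') x ^ q ∂ν) ^ (1 / q) +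
        (∫⁻ x, (c * ∫⁻ t in Iio x, β (Iio t) ∂κ) ^ q ∂ν) ^ (1 / q) :=
      ENNReal.lintegral_Lp_add_le hTm.aemeasurable (hAm.const_mul c).aemeasurable hq
    _ ≤ M * (ENNReal.ofReal p' * (∫⁻ s, f s ^ p ∂μ) ^ (1 / p)) +
        c * (∫⁻ x, (∫⁻ t in Iio x, β (Iio t) ∂κ) ^ q ∂ν) ^ (1 / q) := by
      refine add_le_add ((h f' hf'm hf't).trans (by gcongr)) (le_of_eq ?_)
      simp_rw [ENNReal.mul_rpow_of_nonneg _ _ hq0.le]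
      rw [lintegral_const_mul _ (hAm.pow_const _), ENNReal.mul_rpow_of_nonneg _ _ (by positivity),
        rpow_mul_eq (c := 1) _ (by field_simp), ENNReal.rpow_one]
    _ = _ := by rw [hc]; ring

end Copson

/-! ### Translation between weights and measures -/

section WeightMeasure

/-- The measure on `(0,∞)` with density `v`. -/
def weightMeasure (v : ℝ → ℝ≥0∞) : Measure ℝ := (volume.restrict (Ioi 0)).withDensity v

variable {k v b a u w f : ℝ → ℝ≥0∞} {p p' q : ℝ}

instance : NullSingletonClass (weightMeasure k) := by unfold weightMeasure; infer_instance

instance : SFinite (weightMeasure k) := by unfold weightMeasure; infer_instance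

lemma setLIntegral_weightMeasure (hm : MeasPos k)
    (hf : ∀ᵐ t ∂(volume.restrict (Ioi (0 : ℝ))), k t < ∞) {S : Set ℝ} (hS : MeasurableSet S)
    (g : ℝ → ℝ≥0∞) :
    ∫⁻ t in S, g t ∂weightMeasure k = ∫⁻ t in S ∩ Ioi 0, g t * k t := by
  have hm' : AEMeasurable k (volume.restrict (Ioi (0 : ℝ))) := hm
  rw [weightMeasure, restrict_withDensity hS,
    lintegral_withDensity_eq_lintegral_mul_non_measurable₀ _ hm'.restrict
      (ae_restrict_of_ae hf), Measure.restrict_restrict hS]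
  exact lintegral_congr fun t => mul_comm _ _

lemma lintegral_weightMeasure (hm : MeasPos k)
    (hf : ∀ᵐ t ∂(volume.restrict (Ioi (0 : ℝ))), k t < ∞) (g : ℝ → ℝ≥0∞) :
    ∫⁻ t, g t ∂weightMeasure k = ∫⁻ t in Ioi 0, g t * k t := by
  have := setLIntegral_weightMeasure hm hf MeasurableSet.univ g
  rwa [Measure.restrict_univ, univ_inter] at this

lemma setLIntegral_weightMeasure_Iio (hm : MeasPos k)
    (hf : ∀ᵐ t ∂(volume.restrict (Ioi (0 : ℝ))), k t < ∞) (g : ℝ → ℝ≥0∞) (x : ℝ) :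
    ∫⁻ t in Iio x, g t ∂weightMeasure k = ∫⁻ t in Ioo 0 x, g t * k t := by
  rw [setLIntegral_weightMeasure hm hf measurableSet_Iio, inter_comm, Ioi_inter_Iio]

lemma setLIntegral_weightMeasure_Ioi (hm : MeasPos k)
    (hf : ∀ᵐ t ∂(volume.restrict (Ioi (0 : ℝ))), k t < ∞) (g : ℝ → ℝ≥0∞) {x : ℝ} (hx : 0 ≤ x) :
    ∫⁻ t in Ioi x, g t ∂weightMeasure k = ∫⁻ t in Ioi x, g t * k t := by
  rw [setLIntegral_weightMeasure hm hf measurableSet_Ioi,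
    inter_eq_left.mpr (Ioi_subset_Ioi hx)]

lemma weightMeasure_apply {S : Set ℝ} (hS : MeasurableSet S) :
    weightMeasure k S = ∫⁻ t in S ∩ Ioi 0, k t := by
  rw [weightMeasure, withDensity_apply _ hS, Measure.restrict_restrict hS]

lemma weightMeasure_Iio (x : ℝ) : weightMeasure k (Iio x) = prim k x := by
  rw [weightMeasure_apply measurableSet_Iio, inter_comm, Ioi_inter_Iio, prim]

lemma weightMeasure_Ioi {x : ℝ} (hx : 0 ≤ x) : weightMeasure k (Ioi x) = ∫⁻ t in Ioi x, k t := by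
  rw [weightMeasure_apply measurableSet_Ioi, inter_eq_left.mpr (Ioi_subset_Ioi hx)]

lemma weightMeasure_univ : weightMeasure k univ = ∫⁻ t in Ioi 0, k t := by
  rw [weightMeasure_apply MeasurableSet.univ, univ_inter]

lemma weightMeasure_Iic_zero : weightMeasure k (Iic 0) = 0 := by
  rw [weightMeasure_apply measurableSet_Iic, Iic_inter_Ioi, Ioc_self]; simp

lemma ae_weightMeasure {P : ℝ → Prop} (h : ∀ s, 0 < s → P s) : ∀ᵐ s ∂weightMeasure k, P s := by
  have : ∀ᵐ s ∂weightMeasure k, s ∉ Iic (0 : ℝ) := measure_eq_zero_iff_ae_notMem.mp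
    weightMeasure_Iic_zero
  filter_upwards [this] with s hs using h s (not_le.mp hs)

lemma prim_of_nonpos {x : ℝ} (hx : x ≤ 0) : prim k x = 0 := by
  rw [prim, Ioo_eq_empty (not_lt.mpr hx)]; simp

lemma monotone_prim : Monotone (prim k) := fun _ _ h => lintegral_mono_set (Ioo_subset_Ioo_right h)

lemma measurable_prim : Measurable (prim k) := monotone_prim.measurable

lemma IsWeight.prim_ne_top (hv : IsWeight v) (x : ℝ) : prim v x ≠ ∞ := by
  rcases le_or_gt x 0 with hx | hx
  · rw [prim_of_nonpos hx]; exact ENNReal.zero_ne_top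
  · exact (hv.2 x hx).2.ne

lemma IsWeight.prim_ne_zero (hv : IsWeight v) {x : ℝ} (hx : 0 < x) : prim v x ≠ 0 :=
  (hv.2 x hx).1.ne'

lemma IsWeight.ae_lt_top (hv : IsWeight v) : ∀ᵐ t ∂(volume.restrict (Ioi (0 : ℝ))), v t < ∞ := by
  have : Ioi (0 : ℝ) = ⋃ n : ℕ, Ioo 0 (n : ℝ) := by
    ext y
    simp only [mem_Ioi, mem_iUnion, mem_Ioo, exists_and_left, iff_self_and]
    exact fun _ => exists_nat_gt y
  rw [this, ae_restrict_iUnion_iff]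
  intro n
  refine ae_lt_top' (AEMeasurable.mono_measure hv.1 ?_) (hv.prim_ne_top n)
  exact Measure.restrict_mono Ioo_subset_Ioi_self le_rfl

lemma IsWeight.sigmaFinite (hv : IsWeight v) : SigmaFinite (weightMeasure v) :=
  SigmaFinite.withDensity_of_ne_top (hv.ae_lt_top.mono fun _ h => h.ne)

lemma IsWeight.weightMeasure_Iio_ne_top (hv : IsWeight v) (x : ℝ) :
    weightMeasure v (Iio x) ≠ ∞ := by
  rw [weightMeasure_Iio]; exact hv.prim_ne_top x

lemma lpNorm_eq (hv : IsWeight v) (f : ℝ → ℝ≥0∞) :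
    lpNorm p v f = (∫⁻ s, f s ^ p ∂weightMeasure v) ^ (1 / p) := by
  rw [lpNorm, lintegral_weightMeasure hv.1 hv.ae_lt_top]

/-- The density `a u / B`. -/
def quotDensity (a b u : ℝ → ℝ≥0∞) (τ : ℝ) : ℝ≥0∞ := a τ / prim b τ * u τ

lemma measPos_quotDensity (ha : IsWeight a) (hu : IsWeight u) : MeasPos (quotDensity a b u) := by
  have h1 : AEMeasurable a (volume.restrict (Ioi (0 : ℝ))) := ha.1
  have h2 : AEMeasurable u (volume.restrict (Ioi (0 : ℝ))) := hu.1
  exact (h1.div measurable_prim.aemeasurable).mul h2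

lemma quotDensity_lt_top (ha : IsWeight a) (hb : IsWeight b) (hu : IsContinuousFinite u) :
    ∀ᵐ t ∂(volume.restrict (Ioi (0 : ℝ))), quotDensity a b u t < ∞ := by
  filter_upwards [ha.ae_lt_top, ae_restrict_mem measurableSet_Ioi] with t ht ht0
  exact ENNReal.mul_lt_top (ENNReal.div_lt_top ht.ne (hb.prim_ne_zero ht0)) (hu.2 t ht0)

lemma IsContinuousFinite.exists_bound (hu : IsContinuousFinite u) {s : ℝ} (hs : 0 < s) (x : ℝ) :
    ∃ K : ℝ≥0∞, K ≠ ∞ ∧ ∀ t ∈ Icc s x, u t ≤ K := by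
  rcases (Icc s x).eq_empty_or_nonempty with he | hne
  · exact ⟨0, ENNReal.zero_ne_top, by simp [he]⟩
  · obtain ⟨y, hy, hmax⟩ := isCompact_Icc.exists_isMaxOn hne
      (hu.1.mono fun t ht => lt_of_lt_of_le hs ht.1)
    exact ⟨u y, (hu.2 y (lt_of_lt_of_le hs hy.1)).ne, fun t ht => hmax ht⟩

lemma setLIntegral_Ioo_mul_ne_top (ha : IsWeight a) (hu : IsContinuousFinite u) {s : ℝ}
    (hs : 0 < s) (x : ℝ) : ∫⁻ t in Ioo s x, a t * u t ≠ ∞ := by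
  obtain ⟨K, hK, hKu⟩ := hu.exists_bound hs x
  have h2 : ∫⁻ t in Ioo s x, a t ≠ ∞ :=
    ne_top_of_le_ne_top (ha.prim_ne_top x) (lintegral_mono_set (Ioo_subset_Ioo_left hs.le))
  refine ne_top_of_le_ne_top (ENNReal.mul_ne_top h2 hK) ?_
  rw [← lintegral_mul_const' _ _ hK]
  exact setLIntegral_mono' measurableSet_Ioo fun t ht =>
    mul_le_mul_right (hKu t (Ioo_subset_Icc_self ht)) _

lemma weightMeasure_quotDensity_Ioo {s : ℝ} (hs : 0 ≤ s) (x : ℝ) :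
    weightMeasure (quotDensity a b u) (Ioo s x) = kern a b u s x := by
  rw [weightMeasure_apply measurableSet_Ioo,
    inter_eq_left.mpr (Ioo_subset_Ioi_self.trans (Ioi_subset_Ioi hs))]
  rfl

/-- On (s,x) the factor 1/B is at most 1/B(s), and continuity bounds u on the compact [s,x]. Nothing
is claimed at s = 0, near which the mass may be infinite. -/
lemma weightMeasure_quotDensity_ne_top (ha : IsWeight a) (hb : IsWeight b)
    (hu : IsContinuousFinite u) (s x : ℝ) (hs : 0 < s) :
    weightMeasure (quotDensity a b u) (Ioo s x) ≠ ∞ := by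
  rw [weightMeasure_quotDensity_Ioo hs.le, kern]
  have hB : (prim b s)⁻¹ ≠ ∞ := ENNReal.inv_ne_top.mpr (hb.prim_ne_zero hs)
  refine ne_top_of_le_ne_top
    (ENNReal.mul_ne_top hB (setLIntegral_Ioo_mul_ne_top ha hu hs x)) ?_
  rw [← lintegral_const_mul' _ _ hB]
  refine setLIntegral_mono' measurableSet_Ioo fun t ht => ?_
  rw [div_eq_mul_inv, mul_comm (a t), mul_assoc]
  exact mul_le_mul_left (ENNReal.inv_le_inv.mpr (monotone_prim (le_of_lt ht.1))) _

lemma setLIntegral_prim_quotDensity (ha : IsWeight a) (hb : IsWeight b) (huw : IsWeight u)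
    (hu : IsContinuousFinite u) (x : ℝ) :
    ∫⁻ t in Iio x, weightMeasure b (Iio t) ∂weightMeasure (quotDensity a b u) =
      prim (fun y => a y * u y) x := by
  rw [setLIntegral_weightMeasure_Iio (measPos_quotDensity ha huw) (quotDensity_lt_top ha hb hu),
    prim]
  refine setLIntegral_congr_fun measurableSet_Ioo fun t ht => ?_
  simp only [weightMeasure_Iio, quotDensity]
  rw [← mul_assoc, ENNReal.mul_div_cancel (hb.prim_ne_zero ht.1) (hb.prim_ne_top t)]

/-- Away from 0 the product a u is always integrable on bounded intervals, so A is either finite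
everywhere or infinite at every positive point. -/
lemma prim_mul_ne_top (ha : IsWeight a) (hu : IsContinuousFinite u) {y : ℝ} (hy : 0 < y)
    (h : prim (fun t => a t * u t) y ≠ ∞) (x : ℝ) : prim (fun t => a t * u t) x ≠ ∞ := by
  refine ne_top_of_le_ne_top (ENNReal.add_ne_top.mpr
    ⟨h, setLIntegral_Ioo_mul_ne_top ha hu (half_pos hy) x⟩) ?_
  refine (lintegral_mono_set fun t ht => ?_).trans (lintegral_union_le _ _ _)
  rcases lt_or_ge t y with hty | hty
  · exact Or.inl ⟨ht.1, hty⟩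
  · exact Or.inr ⟨lt_of_lt_of_le (half_lt_self hy) hty, ht.2⟩

lemma iterOp_eq (ha : IsWeight a) (hb : IsWeight b) (huw : IsWeight u)
    (hu : IsContinuousFinite u) (f : ℝ → ℝ≥0∞) (x : ℝ) :
    iterOp (weightMeasure b) (weightMeasure (quotDensity a b u)) f x =
      ∫⁻ t in Ioo 0 x, hardyOp u b f t * a t := by
  rw [iterOp, setLIntegral_weightMeasure_Iio (measPos_quotDensity ha huw)
    (quotDensity_lt_top ha hb hu)]
  refine lintegral_congr fun t => ?_
  rw [setLIntegral_weightMeasure_Iio hb.1 hb.ae_lt_top, quotDensity, hardyOp, div_eq_mul_inv,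
    div_eq_mul_inv]
  ring

lemma cesNorm_eq (ha : IsWeight a) (hb : IsWeight b) (huw : IsWeight u)
    (hu : IsContinuousFinite u) (hw : IsWeight w) (f : ℝ → ℝ≥0∞) :
    cesNorm q w a (hardyOp u b f) = (∫⁻ x, iterOp (weightMeasure b)
      (weightMeasure (quotDensity a b u)) f x ^ q ∂weightMeasure w) ^ (1 / q) := by
  simp_rw [cesNorm, lpNorm_eq hw, iterOp_eq ha hb huw hu]

lemma endTerm_eq (ha : IsWeight a) (hb : IsWeight b) (huw : IsWeight u)
    (hu : IsContinuousFinite u) (hw : IsWeight w) :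
    endTerm p q a u v w = weightMeasure v univ ^ (-(1 / p)) *
      (∫⁻ x, (∫⁻ t in Iio x, weightMeasure b (Iio t) ∂weightMeasure (quotDensity a b u)) ^ q
        ∂weightMeasure w) ^ (1 / q) := by
  simp_rw [endTerm, weightMeasure_univ, lintegral_weightMeasure hw.1 hw.ae_lt_top,
    setLIntegral_prim_quotDensity ha hb huw hu]

lemma measPosDecr_of_antitone {f : ℝ → ℝ≥0∞} (hf : Antitone f) : MeasPosDecr f :=
  ⟨hf.measurable.aemeasurable, hf.antitoneOn _⟩

lemma div_le_hardyNorm (f : ℝ → ℝ≥0∞) (hf : Antitone f) :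
    cesNorm q w a (hardyOp u b f) / lpNorm p v f ≤ hardyNorm p q a b u v w :=
  le_iSup (fun f : {f : ℝ → ℝ≥0∞ // MeasPosDecr f} =>
    cesNorm q w a (hardyOp u b f.1) / lpNorm p v f.1) ⟨f, measPosDecr_of_antitone hf⟩

/-- The test function f = 1. If V(∞) = ∞, both the end term and the quotient are zero by the
conventions. -/
lemma endTerm_le_hardyNorm (ha : IsWeight a) (hb : IsWeight b) (huw : IsWeight u)
    (hu : IsContinuousFinite u) (hv : IsWeight v) (hw : IsWeight w) :
    endTerm p q a u v w ≤ hardyNorm p q a b u v w := by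
  refine le_trans (le_of_eq ?_) (div_le_hardyNorm (fun _ => 1) antitone_const)
  rw [cesNorm_eq ha hb huw hu hw, lpNorm_eq hv, endTerm_eq ha hb huw hu hw, mul_comm]
  simp [iterOp, ENNReal.rpow_neg, div_eq_mul_inv]

/-- A tail average is an admissible test function, and Copson's inequality compares its norm with
that of g. Finiteness of the norm is needed to clear the denominator when the tail average has norm
zero. -/
lemma isBddIter_of_hardyNorm (hp : p.HolderConjugate p') {C : ℝ≥0}
    (hC : ∀ (μ : Measure ℝ) [SigmaFinite μ] [NullSingletonClass μ], (∀ x, μ (Iio x) ≠ ∞) →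
      ∀ g : ℝ → ℝ≥0∞, Measurable g → ∫⁻ s, g s ^ p ∂μ ≠ ∞ →
        (∫⁻ s, tailAvg μ g s ^ p ∂μ) ^ (1 / p) ≤ C * (∫⁻ s, g s ^ p ∂μ) ^ (1 / p))
    (ha : IsWeight a) (hb : IsWeight b) (huw : IsWeight u)
    (hu : IsContinuousFinite u) (hv : IsWeight v) (hw : IsWeight w)
    (hN : hardyNorm p q a b u v w ≠ ∞) :
    IsBddIter p q (weightMeasure v) (weightMeasure w) (weightMeasure b)
      (weightMeasure (quotDensity a b u)) (C * hardyNorm p q a b u v w) := by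
  intro g hg hP
  have := hv.sigmaFinite
  have h1 := hC (weightMeasure v) hv.weightMeasure_Iio_ne_top g hg hP
  have ht : (∫⁻ s, tailAvg (weightMeasure v) g s ^ p ∂weightMeasure v) ^ (1 / p) ≠ ∞ :=
    ne_top_of_le_ne_top (ENNReal.mul_ne_top ENNReal.coe_ne_top
      (ENNReal.rpow_ne_top_of_nonneg hp.one_div_nonneg hP)) h1
  have h2 := div_le_hardyNorm (p := p) (q := q) (a := a) (b := b) (u := u) (v := v) (w := w)
    (tailAvg (weightMeasure v) g) (antitone_tailAvg g)
  rw [cesNorm_eq ha hb huw hu hw, lpNorm_eq hv,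
    ENNReal.div_le_iff_le_mul (Or.inr hN) (Or.inl ht)] at h2
  refine h2.trans ((mul_le_mul_right h1 _).trans (le_of_eq ?_))
  ring

lemma hardyNorm_le (hp : p.HolderConjugate p') (hq : 1 ≤ q) {M : ℝ≥0∞}
    (ha : IsWeight a) (hb : IsWeight b) (huw : IsWeight u)
    (hu : IsContinuousFinite u) (hv : IsWeight v) (hw : IsWeight w)
    (h : IsBddIter p q (weightMeasure v) (weightMeasure w) (weightMeasure b)
      (weightMeasure (quotDensity a b u)) M) :
    hardyNorm p q a b u v w ≤ ENNReal.ofReal p' * M + endTerm p q a u v w := by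
  refine iSup_le fun ⟨f, hf⟩ => ?_
  -- f is monotone only on (0,∞). The value ∞ on the rest makes it antitone on ℝ, and no integral
  -- involved sees that part.
  set f₁ : ℝ → ℝ≥0∞ := fun s => if 0 < s then f s else ∞ with hf₁
  have hanti : Antitone f₁ := by
    intro s t hst
    simp only [hf₁]
    rcases lt_or_ge 0 s with hs | hs
    · rw [if_pos hs, if_pos (hs.trans_le hst)]
      exact hf.2 hs (hs.trans_le hst) hst
    · rw [if_neg (not_lt.mpr hs)]; exact le_top
  have hfe : ∀ s, 0 < s → f s = f₁ s := fun s hs => (if_pos hs).symm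
  have e1 : lpNorm p v f = lpNorm p v f₁ := by
    rw [lpNorm, lpNorm, setLIntegral_congr_fun measurableSet_Ioi fun s hs => by rw [hfe s hs]]
  have e2 : hardyOp u b f = hardyOp u b f₁ := by
    ext t
    rw [hardyOp, hardyOp, setLIntegral_congr_fun measurableSet_Ioo fun s hs => by rw [hfe s hs.1]]
  change cesNorm q w a (hardyOp u b f) / lpNorm p v f ≤ _
  rw [e1, e2]
  rcases eq_or_ne (lpNorm p v f₁) ∞ with ht | ht
  · rw [ht, ENNReal.div_top]; exact zero_le
  refine ENNReal.div_le_of_le_mul ?_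
  rw [lpNorm_eq hv] at ht ⊢
  rw [cesNorm_eq ha hb huw hu hw, endTerm_eq ha hb huw hu hw]
  refine h.antitone_bdd hp hq hv.weightMeasure_Iio_ne_top (ae_weightMeasure fun s hs => ?_) hanti
    fun h => ?_
  · rw [weightMeasure_Iio]; exact hv.prim_ne_zero hs
  · rw [h, ENNReal.top_rpow_of_pos hp.one_div_pos] at ht; exact ht rfl

end WeightMeasure

/-! ### The functionals of the theorem in terms of measures -/

section Functionals

variable {a b u v w : ℝ → ℝ≥0∞} {p q r : ℝ}

lemma lintegral_weightMeasure_withDensity (hw : IsWeight w) {A : ℝ → ℝ≥0∞} (hA : Measurable A)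
    {g : ℝ → ℝ≥0∞} (hg : Measurable g) :
    ∫⁻ x, g x ∂((weightMeasure w).withDensity A) = ∫⁻ x in Ioi 0, g x * A x * w x := by
  rw [lintegral_withDensity_eq_lintegral_mul _ hA hg, lintegral_weightMeasure hw.1 hw.ae_lt_top]
  refine lintegral_congr fun x => ?_
  rw [Pi.mul_apply, mul_comm (A x)]

lemma weightMeasure_withDensity_Iio (hw : IsWeight w) (A : ℝ → ℝ≥0∞) (x : ℝ) :
    ((weightMeasure w).withDensity A) (Iio x) = ∫⁻ t in Ioo 0 x, A t * w t := by
  rw [withDensity_apply _ measurableSet_Iio, setLIntegral_weightMeasure_Iio hw.1 hw.ae_lt_top]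

lemma setLIntegral_inv_rpow (hv : IsWeight v) {x : ℝ} (hx : 0 ≤ x) (c : ℝ) :
    ∫⁻ s in Ioi x, (weightMeasure v (Iio s))⁻¹ ^ c ∂weightMeasure v =
      ∫⁻ s in Ioi x, prim v s ^ (-c) * v s := by
  rw [setLIntegral_weightMeasure_Ioi hv.1 hv.ae_lt_top _ hx]
  simp_rw [weightMeasure_Iio, ENNReal.inv_rpow, ENNReal.rpow_neg]

lemma setLIntegral_div_rpow (hv : IsWeight v) {c : ℝ} (hc : 0 ≤ c) (A : ℝ → ℝ≥0∞) (x : ℝ) :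
    ∫⁻ s in Iio x, (A s / weightMeasure v (Iio s)) ^ c ∂weightMeasure v =
      ∫⁻ s in Ioo 0 x, A s ^ c * prim v s ^ (-c) * v s := by
  rw [setLIntegral_weightMeasure_Iio hv.1 hv.ae_lt_top]
  simp_rw [weightMeasure_Iio, ENNReal.div_rpow_of_nonneg _ _ hc, ENNReal.rpow_neg, div_eq_mul_inv]

lemma setLIntegral_div_rpow' (hv : IsWeight v) (c x : ℝ) :
    ∫⁻ s in Iio x, (weightMeasure b (Iio s) / weightMeasure v (Iio s)) ^ c ∂weightMeasure v =
      ∫⁻ s in Ioo 0 x, (prim b s / prim v s) ^ c * v s := by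
  rw [setLIntegral_weightMeasure_Iio hv.1 hv.ae_lt_top]
  simp_rw [weightMeasure_Iio]

lemma setLIntegral_kern_rpow (hw : IsWeight w) {x : ℝ} (hx : 0 ≤ x) (c : ℝ) :
    ∫⁻ t in Ioi x, weightMeasure (quotDensity a b u) (Ioo x t) ^ c ∂weightMeasure w =
      ∫⁻ t in Ioi x, kern a b u x t ^ c * w t := by
  rw [setLIntegral_weightMeasure_Ioi hw.1 hw.ae_lt_top _ hx]
  simp_rw [weightMeasure_quotDensity_Ioo hx]

lemma setLIntegral_kern_mul_rpow (hv : IsWeight v) (c x : ℝ) :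
    ∫⁻ s in Iio x, weightMeasure (quotDensity a b u) (Ioo s x) ^ c *
      (weightMeasure b (Iio s) / weightMeasure v (Iio s)) ^ c ∂weightMeasure v =
      ∫⁻ s in Ioo 0 x, kern a b u s x ^ c * (prim b s / prim v s) ^ c * v s := by
  rw [setLIntegral_weightMeasure_Iio hv.1 hv.ae_lt_top]
  refine setLIntegral_congr_fun measurableSet_Ioo fun s hs => ?_
  simp only [weightMeasure_Iio, weightMeasure_quotDensity_Ioo hs.1.le]

lemma setLIntegral_weightMeasure_Iio_of_nonpos (g : ℝ → ℝ≥0∞) {x : ℝ} (hx : x ≤ 0) :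
    ∫⁻ s in Iio x, g s ∂weightMeasure v = 0 :=
  setLIntegral_measure_zero _ _
    (measure_mono_null (Iio_subset_Iic_self.trans (Iic_subset_Iic.mpr hx)) weightMeasure_Iic_zero)

/-- The criteria quantify over all real x, the functionals over x > 0; at x ≤ 0 the factor with mass
to the left of x vanishes. -/
lemma forall_le_iff_iSup_le {F : ℝ → ℝ≥0∞} (h : ∀ x ≤ 0, F x = 0) {M : ℝ≥0∞} :
    (∀ x, F x ≤ M) ↔ ⨆ x : Ioi (0 : ℝ), F x ≤ M := by
  rw [iSup_le_iff]
  refine ⟨fun h' x => h' x, fun h' x => ?_⟩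
  rcases le_or_gt x 0 with hx | hx
  · rw [h x hx]; exact zero_le
  · exact h' ⟨x, hx⟩

lemma sup₁_le_iff (hv : IsWeight v) (hw : IsWeight w) (hq : 0 < q) {M : ℝ≥0∞} :
    sup₁ p q a u v w ≤ M ↔ ∀ x,
      ((weightMeasure w).withDensity fun x => prim (fun y => a y * u y) x ^ q) (Iio x) ^ (1 / q) *
        (∫⁻ s in Ioi x, (weightMeasure v (Iio s))⁻¹ ^ conj p ∂weightMeasure v) ^ (1 / conj p) ≤
          M := by
  rw [forall_le_iff_iSup_le, sup₁]
  · refine Eq.to_iff (congrArg (· ≤ M) (iSup_congr fun x => ?_))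
    rw [weightMeasure_withDensity_Iio hw, setLIntegral_inv_rpow hv (le_of_lt x.2)]
  · intro x hx
    rw [withDensity_apply _ measurableSet_Iio, setLIntegral_weightMeasure_Iio_of_nonpos _ hx,
      ENNReal.zero_rpow_of_pos (one_div_pos.mpr hq), zero_mul]

lemma sup₂_le_iff (hp : p.HolderConjugate (conj p)) (hv : IsWeight v)
    {M : ℝ≥0∞} :
    sup₂ p q a u v w ≤ M ↔ ∀ x, weightMeasure w (Ioi x) ^ (1 / q) *
      (∫⁻ s in Iio x, (prim (fun y => a y * u y) s / weightMeasure v (Iio s)) ^ conj p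
        ∂weightMeasure v) ^ (1 / conj p) ≤ M := by
  rw [forall_le_iff_iSup_le, sup₂]
  · refine Eq.to_iff (congrArg (· ≤ M) (iSup_congr fun x => ?_))
    rw [weightMeasure_Ioi (le_of_lt x.2), setLIntegral_div_rpow hv hp.symm.nonneg]
  · intro x hx
    rw [setLIntegral_weightMeasure_Iio_of_nonpos _ hx,
      ENNReal.zero_rpow_of_pos hp.symm.one_div_pos, mul_zero]

lemma sup₃_le_iff (hp : p.HolderConjugate (conj p)) (hv : IsWeight v) (hw : IsWeight w)
    {M : ℝ≥0∞} :
    sup₃ p q a b u v w ≤ M ↔ ∀ x,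
      (∫⁻ t in Ioi x, weightMeasure (quotDensity a b u) (Ioo x t) ^ q ∂weightMeasure w) ^ (1 / q) *
      (∫⁻ s in Iio x, (weightMeasure b (Iio s) / weightMeasure v (Iio s)) ^ conj p
        ∂weightMeasure v) ^ (1 / conj p) ≤ M := by
  rw [forall_le_iff_iSup_le, sup₃]
  · refine Eq.to_iff (congrArg (· ≤ M) (iSup_congr fun x => ?_))
    rw [setLIntegral_kern_rpow hw (le_of_lt x.2), setLIntegral_div_rpow' hv]
  · intro x hx
    rw [setLIntegral_weightMeasure_Iio_of_nonpos _ hx,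
      ENNReal.zero_rpow_of_pos hp.symm.one_div_pos, mul_zero]

lemma sup₄_le_iff (hp : p.HolderConjugate (conj p)) (hv : IsWeight v)
    {M : ℝ≥0∞} :
    sup₄ p q a b u v w ≤ M ↔ ∀ x, weightMeasure w (Ioi x) ^ (1 / q) *
      (∫⁻ s in Iio x, weightMeasure (quotDensity a b u) (Ioo s x) ^ conj p *
        (weightMeasure b (Iio s) / weightMeasure v (Iio s)) ^ conj p
        ∂weightMeasure v) ^ (1 / conj p) ≤ M := by
  rw [forall_le_iff_iSup_le, sup₄]
  · refine Eq.to_iff (congrArg (· ≤ M) (iSup_congr fun x => ?_))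
    rw [weightMeasure_Ioi (le_of_lt x.2), setLIntegral_kern_mul_rpow hv]
  · intro x hx
    rw [setLIntegral_weightMeasure_Iio_of_nonpos _ hx,
      ENNReal.zero_rpow_of_pos hp.symm.one_div_pos, mul_zero]

lemma int₁_eq (hv : IsWeight v) (hw : IsWeight w) :
    int₁ p q a u v w =
      (∫⁻ x, ((weightMeasure w).withDensity fun x => prim (fun y => a y * u y) x ^ q) (Iio x) ^
        (rExp p q / p) *
        (∫⁻ s in Ioi x, (weightMeasure v (Iio s))⁻¹ ^ conj p ∂weightMeasure v) ^
          (rExp p q / conj p)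
        ∂((weightMeasure w).withDensity fun x => prim (fun y => a y * u y) x ^ q)) ^
          (1 / rExp p q) := by
  have hm := ((measurable_measure_Iio ((weightMeasure w).withDensity fun x =>
    prim (fun y => a y * u y) x ^ q)).pow_const (rExp p q / p)).mul
    ((antitone_setLIntegral_Ioi (weightMeasure v) fun s =>
      (weightMeasure v (Iio s))⁻¹ ^ conj p).measurable.pow_const (rExp p q / conj p))
  refine Eq.trans ?_ (congrArg (· ^ (1 / rExp p q)) (lintegral_weightMeasure_withDensity hw
    (measurable_prim.pow_const q) hm)).symm
  rw [int₁]
  congr 1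
  refine setLIntegral_congr_fun measurableSet_Ioi fun x hx => ?_
  rw [Pi.mul_apply]
  rw [weightMeasure_withDensity_Iio hw, setLIntegral_inv_rpow hv (le_of_lt hx)]

lemma int₂_eq (hp : p.HolderConjugate (conj p)) (hv : IsWeight v) (hw : IsWeight w) :
    int₂ p q a u v w = (∫⁻ x, weightMeasure w (Ioi x) ^ (rExp p q / p) *
      (∫⁻ s in Iio x, (prim (fun y => a y * u y) s / weightMeasure v (Iio s)) ^ conj p
        ∂weightMeasure v) ^ (rExp p q / conj p) ∂weightMeasure w) ^ (1 / rExp p q) := by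
  rw [lintegral_weightMeasure hw.1 hw.ae_lt_top, int₂]
  congr 1
  refine setLIntegral_congr_fun measurableSet_Ioi fun x hx => ?_
  rw [weightMeasure_Ioi (le_of_lt hx), setLIntegral_div_rpow hv hp.symm.nonneg]

lemma int₃_eq (hv : IsWeight v) (hw : IsWeight w) :
    int₃ p q a b u v w = (∫⁻ x, weightMeasure w (Ioi x) ^ (rExp p q / p) *
      (∫⁻ s in Iio x, weightMeasure (quotDensity a b u) (Ioo s x) ^ conj p *
        (weightMeasure b (Iio s) / weightMeasure v (Iio s)) ^ conj p
        ∂weightMeasure v) ^ (rExp p q / conj p) ∂weightMeasure w) ^ (1 / rExp p q) := by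
  rw [lintegral_weightMeasure hw.1 hw.ae_lt_top, int₃]
  congr 1
  refine setLIntegral_congr_fun measurableSet_Ioi fun x hx => ?_
  rw [weightMeasure_Ioi (le_of_lt hx), setLIntegral_kern_mul_rpow hv]

lemma int₄_eq (hv : IsWeight v) (hw : IsWeight w) :
    int₄ p q a b u v w = (∫⁻ x, (∫⁻ t in Ioi x, weightMeasure (quotDensity a b u) (Ioo x t) ^ q
        ∂weightMeasure w) ^ (rExp p q / q) *
      (∫⁻ s in Iio x, (weightMeasure b (Iio s) / weightMeasure v (Iio s)) ^ conj p
        ∂weightMeasure v) ^ (rExp p q / conj q) *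
      (weightMeasure b (Iio x) / weightMeasure v (Iio x)) ^ conj p ∂weightMeasure v) ^
        (1 / rExp p q) := by
  rw [lintegral_weightMeasure hv.1 hv.ae_lt_top, int₄]
  congr 1
  refine setLIntegral_congr_fun measurableSet_Ioi fun x hx => ?_
  rw [setLIntegral_kern_rpow hw (le_of_lt hx), setLIntegral_div_rpow' hv, weightMeasure_Iio,
    weightMeasure_Iio]
  simp_rw [mul_comm (w _)]

/-- Boundedness on tail averages is characterized by the supremum functionals when `p ≤ q`. -/
lemma exists_isBddIter_of_le (hp : p.HolderConjugate (conj p)) (hq : q.HolderConjugate (conj q))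
    (hpq : p ≤ q) :
    ∃ C : ℝ≥0, ∀ a b u v w : ℝ → ℝ≥0∞, IsWeight a → IsWeight b → IsWeight u → IsWeight v →
      IsWeight w → IsContinuousFinite u → (∀ x, prim (fun y => a y * u y) x ≠ ∞) →
      ∀ S, S = sup₁ p q a u v w + sup₂ p q a u v w + sup₃ p q a b u v w + sup₄ p q a b u v w →
      IsBddIter p q (weightMeasure v) (weightMeasure w) (weightMeasure b)
        (weightMeasure (quotDensity a b u)) (C * S) ∧
      ∀ M, IsBddIter p q (weightMeasure v) (weightMeasure w) (weightMeasure b)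
        (weightMeasure (quotDensity a b u)) M → S ≤ C * M := by
  obtain ⟨C₁, hC₁⟩ := exists_tail_hardy_of_le hp hq hpq
  obtain ⟨C₂, hC₂⟩ := exists_weighted_hardy_of_le hp hq hpq
  obtain ⟨C₃, hC₃⟩ := exists_weighted_kernel_of_le hp hq hpq
  -- The sum of the C_i serves sufficiency; the 4 serves necessity, where each of the four suprema
  -- is at most M.
  refine ⟨C₁ + C₂ + C₃ + 4, fun a b u v w ha hb huw hv hw hu hA S hS => ?_⟩
  have hsv := hv.sigmaFinite
  have hsw := hw.sigmaFinite
  set A : ℝ → ℝ≥0∞ := prim fun y => a y * u y with hAdef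
  have hAm : Measurable A := measurable_prim
  have hAeq := setLIntegral_prim_quotDensity ha hb huw hu
  have hVm := measurable_measure_Iio (weightMeasure v)
  have hV0 := ae_measure_Iio_ne_zero (weightMeasure v) hv.weightMeasure_Iio_ne_top
  -- Finiteness of A is what makes this measure σ-finite and the weight A/V finite; the
  -- complementary case is treated separately.
  have hsA : SigmaFinite ((weightMeasure w).withDensity fun x => A x ^ q) :=
    sigmaFinite_withDensity_rpow _ hq.nonneg (ae_of_all _ hA)
  obtain ⟨u₁, l₁⟩ := hC₁ (weightMeasure v) ((weightMeasure w).withDensity fun x => A x ^ q)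
    (fun s => (weightMeasure v (Iio s))⁻¹) hVm.inv
    (hV0.mono fun _ h => ENNReal.inv_ne_top.mpr h)
  obtain ⟨u₂, l₂⟩ := hC₂ (weightMeasure v) (weightMeasure w)
    (fun s => A s / weightMeasure v (Iio s)) (hAm.div hVm)
    (hV0.mono fun s h => ENNReal.div_ne_top (hA s) h)
  obtain ⟨u₃, l₃⟩ := hC₃ (weightMeasure v) (weightMeasure w) (weightMeasure (quotDensity a b u))
    weightMeasure_Iic_zero (weightMeasure_quotDensity_ne_top ha hb hu)
    (fun s => weightMeasure b (Iio s) / weightMeasure v (Iio s))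
    ((measurable_measure_Iio _).div hVm)
    (hV0.mono fun s h => ENNReal.div_ne_top (hb.weightMeasure_Iio_ne_top s) h)
  have b₁ : sup₁ p q a u v w ≤ S := by rw [hS, add_assoc, add_assoc]; exact le_self_add
  have b₂ : sup₂ p q a u v w ≤ S := by
    rw [hS, add_assoc, add_assoc, add_left_comm]; exact le_self_add
  have b₃ : sup₃ p q a b u v w ≤ S := by rw [hS]; exact le_add_self.trans le_self_add
  have b₄ : sup₄ p q a b u v w ≤ S := by rw [hS]; exact le_add_self
  refine ⟨?_, fun M hM => ?_⟩
  · have k := IsBddIter.of_parts hq.lt.le hAm hAeq (u₁ S ((sup₁_le_iff hv hw hq.pos).mp b₁))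
      (u₂ S ((sup₂_le_iff hp hv).mp b₂))
      (u₃ S ((sup₃_le_iff hp hv hw).mp b₃) ((sup₄_le_iff hp hv).mp b₄))
    intro g hg hP
    refine (k g hg hP).trans (mul_le_mul_left ?_ _)
    push_cast
    rw [← add_mul, ← add_mul]
    exact mul_le_mul_left le_self_add _
  · have c₁ := (sup₁_le_iff hv hw hq.pos).mpr (l₁ M (hM.tail hq.pos hAm hAeq))
    have c₂ := (sup₂_le_iff hp hv).mpr (l₂ M (hM.hardy hq.pos hAeq))
    have c₃ := (sup₃_le_iff hp hv hw).mpr (l₃ M (hM.kernel hq.pos)).1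
    have c₄ := (sup₄_le_iff hp hv).mpr (l₃ M (hM.kernel hq.pos)).2
    calc S ≤ M + M + M + M := hS ▸ add_le_add (add_le_add (add_le_add c₁ c₂) c₃) c₄
      _ = 4 * M := by ring
      _ ≤ _ := by push_cast; exact mul_le_mul_left le_add_self _

/-- Boundedness on tail averages is characterized by the integral functionals when `q < p`. -/
lemma exists_isBddIter_of_lt (hp : p.HolderConjugate (conj p)) (hq : q.HolderConjugate (conj q))
    (hqp : q < p) :
    ∃ C : ℝ≥0, ∀ a b u v w : ℝ → ℝ≥0∞, IsWeight a → IsWeight b → IsWeight u → IsWeight v →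
      IsWeight w → IsContinuousFinite u → (∀ x, prim (fun y => a y * u y) x ≠ ∞) →
      ∀ S, S = int₁ p q a u v w + int₂ p q a u v w + int₃ p q a b u v w + int₄ p q a b u v w →
      IsBddIter p q (weightMeasure v) (weightMeasure w) (weightMeasure b)
        (weightMeasure (quotDensity a b u)) (C * S) ∧
      ∀ M, IsBddIter p q (weightMeasure v) (weightMeasure w) (weightMeasure b)
        (weightMeasure (quotDensity a b u)) M → S ≤ C * M := by
  have hr : (rExp p q)⁻¹ = q⁻¹ - p⁻¹ := by rw [rExp, inv_inv, one_div, one_div]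
  have hr0 : 0 < rExp p q := by
    rw [← inv_pos, hr, sub_pos]
    exact inv_strictAnti₀ hq.pos hqp
  obtain ⟨C₁, hC₁⟩ := exists_tail_hardy_of_lt hp hq hr hr0
  obtain ⟨C₂, hC₂⟩ := exists_weighted_hardy_of_lt hp hq hr hr0
  obtain ⟨C₃, hC₃⟩ := exists_weighted_kernel_of_lt hp hq hr hr0
  -- C₃ occurs twice because necessity bounds the two kernel functionals one at a time.
  refine ⟨C₁ + C₂ + C₃ + C₃, fun a b u v w ha hb huw hv hw hu hA S hS => ?_⟩
  have hsv := hv.sigmaFinite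
  have hsw := hw.sigmaFinite
  set A : ℝ → ℝ≥0∞ := prim fun y => a y * u y with hAdef
  have hAm : Measurable A := measurable_prim
  have hAeq := setLIntegral_prim_quotDensity ha hb huw hu
  have hVm := measurable_measure_Iio (weightMeasure v)
  have hV0 := ae_measure_Iio_ne_zero (weightMeasure v) hv.weightMeasure_Iio_ne_top
  have hsA : SigmaFinite ((weightMeasure w).withDensity fun x => A x ^ q) :=
    sigmaFinite_withDensity_rpow _ hq.nonneg (ae_of_all _ hA)
  obtain ⟨u₁, l₁⟩ := hC₁ (weightMeasure v) ((weightMeasure w).withDensity fun x => A x ^ q)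
    (fun s => (weightMeasure v (Iio s))⁻¹) hVm.inv
    (hV0.mono fun _ h => ENNReal.inv_ne_top.mpr h)
  obtain ⟨u₂, l₂⟩ := hC₂ (weightMeasure v) (weightMeasure w)
    (fun s => A s / weightMeasure v (Iio s)) (hAm.div hVm)
    (hV0.mono fun s h => ENNReal.div_ne_top (hA s) h)
  obtain ⟨u₃, l₃⟩ := hC₃ (weightMeasure v) (weightMeasure w) (weightMeasure (quotDensity a b u))
    weightMeasure_Iic_zero (weightMeasure_quotDensity_ne_top ha hb hu)
    (fun s => weightMeasure b (Iio s) / weightMeasure v (Iio s))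
    ((measurable_measure_Iio _).div hVm)
    (hV0.mono fun s h => ENNReal.div_ne_top (hb.weightMeasure_Iio_ne_top s) h)
    _ _ (int₃_eq hv hw) (int₄_eq hv hw)
  rw [← int₁_eq hv hw] at u₁ l₁
  rw [← int₂_eq hp hv hw] at u₂ l₂
  refine ⟨?_, fun M hM => ?_⟩
  · have k := IsBddIter.of_parts hq.lt.le hAm hAeq u₁ u₂ u₃
    intro g hg hP
    refine (k g hg hP).trans (mul_le_mul_left ?_ _)
    set I₁ := int₁ p q a u v w
    set I₂ := int₂ p q a u v w
    set I₃ := int₃ p q a b u v w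
    set I₄ := int₄ p q a b u v w
    have b₁ : I₁ ≤ S := by rw [hS, add_assoc, add_assoc]; exact le_self_add
    have b₂ : I₂ ≤ S := by rw [hS, add_assoc, add_assoc, add_left_comm]; exact le_self_add
    have b₃ : I₃ + I₄ ≤ S := by rw [hS, add_assoc]; exact le_add_self
    calc _ ≤ C₁ * S + C₂ * S + C₃ * S := by gcongr
      _ = (C₁ + C₂ + C₃) * S := by ring
      _ ≤ _ := by push_cast; exact mul_le_mul_left le_self_add _
  · have c₁ := l₁ M (hM.tail hq.pos hAm hAeq)
    have c₂ := l₂ M (hM.hardy hq.pos hAeq)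
    obtain ⟨c₃, c₄⟩ := l₃ M (hM.kernel hq.pos)
    calc S ≤ C₁ * M + C₂ * M + C₃ * M + C₃ * M :=
          hS ▸ add_le_add (add_le_add (add_le_add c₁ c₂) c₃) c₄
      _ = _ := by push_cast; ring

end Functionals

/-! ### The case where A is infinite at every positive point -/

section Degenerate

variable {a b u v w : ℝ → ℝ≥0∞} {p q : ℝ}

lemma IsWeight.lintegral_top_mul (hw : IsWeight w) {x : ℝ} (hx : 0 < x) :
    ∫⁻ t in Ioo 0 x, ∞ * w t = ∞ := by
  have : AEMeasurable w (volume.restrict (Ioo 0 x)) :=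
    AEMeasurable.mono_measure hw.1 (Measure.restrict_mono Ioo_subset_Ioi_self le_rfl)
  rw [lintegral_const_mul'' _ this]
  exact ENNReal.top_mul (hw.prim_ne_zero hx)

/-- The constant 1 may have infinite norm, so the test function is the indicator of (-∞,1). Its norm
is finite, while its iterated integral equals A(x) = ∞ for 0 < x < 1. -/
lemma hardyNorm_eq_top (hp : 0 < p) (hq : 0 < q) (ha : IsWeight a) (hb : IsWeight b)
    (huw : IsWeight u) (hu : IsContinuousFinite u) (hv : IsWeight v) (hw : IsWeight w)
    (hA : ∀ x, 0 < x → prim (fun y => a y * u y) x = ∞) :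
    hardyNorm p q a b u v w = ∞ := by
  set f : ℝ → ℝ≥0∞ := (Iio (1 : ℝ)).indicator 1 with hf
  have hanti : Antitone f := by
    intro s t hst
    simp only [hf, indicator_apply, mem_Iio, Pi.one_apply]
    split_ifs with h1 h2 h2
    · exact le_rfl
    · exact absurd (hst.trans_lt h1) h2
    · exact zero_le
    · exact le_rfl
  refine top_le_iff.mp (le_trans (le_of_eq ?_) (div_le_hardyNorm f hanti))
  have h1 : lpNorm p v f ≠ ∞ := by
    rw [lpNorm_eq hv]
    refine ENNReal.rpow_ne_top_of_nonneg (by positivity) (ne_top_of_le_ne_top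
      (hv.weightMeasure_Iio_ne_top 1) ?_)
    rw [← lintegral_indicator_one measurableSet_Iio]
    refine lintegral_mono fun s => ?_
    rw [hf]
    by_cases hs : s ∈ Iio (1 : ℝ) <;> simp [hs, hp]
  have h2 : cesNorm q w a (hardyOp u b f) = ∞ := by
    rw [cesNorm_eq ha hb huw hu hw, ENNReal.rpow_eq_top_iff_of_pos (one_div_pos.mpr hq), eq_top_iff,
      lintegral_weightMeasure hw.1 hw.ae_lt_top, ← hw.lintegral_top_mul one_pos]
    refine (setLIntegral_mono' measurableSet_Ioo fun x hx => ?_).trans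
      (lintegral_mono_set Ioo_subset_Ioi_self)
    refine mul_le_mul_left ?_ _
    rw [top_le_iff, ENNReal.rpow_eq_top_iff_of_pos hq, ← hA x hx.1,
      ← setLIntegral_prim_quotDensity ha hb huw hu, iterOp]
    refine setLIntegral_congr_fun measurableSet_Iio fun t ht => ?_
    rw [← setLIntegral_one]
    refine setLIntegral_congr_fun measurableSet_Iio fun s hs => ?_
    exact indicator_of_mem (mem_Iio.mpr ((lt_trans hs ht).trans hx.2)) _
  rw [h2, ENNReal.top_div_of_ne_top h1]

/-- Some interval (x,∞) with x > 0 has positive v-mass, and V^(-c) is positive there. Because 0·∞ =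
0, an infinite factor in the first functional forces it to be infinite only alongside such a nonzero
factor. -/
lemma IsWeight.exists_tail_pos (hv : IsWeight v) (c : ℝ) :
    ∃ x, 0 < x ∧ ∀ y, 0 < y → y ≤ x → ∫⁻ s in Ioi y, prim v s ^ (-c) * v s ≠ 0 := by
  have h1 : ∃ x, 0 < x ∧ weightMeasure v (Ioi x) ≠ 0 := by
    by_contra! h
    have : weightMeasure v (Ioi 0) = 0 := by
      have e : Ioi (0 : ℝ) = ⋃ n : ℕ, Ioi ((1 : ℝ) / (n + 1)) := by
        ext y
        simp only [mem_Ioi, mem_iUnion]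
        exact ⟨fun hy => exists_nat_one_div_lt hy, fun ⟨n, hn⟩ => lt_trans (by positivity) hn⟩
      rw [e, measure_iUnion_null_iff]
      exact fun n => h _ (by positivity)
    refine hv.prim_ne_zero one_pos (le_antisymm ?_ zero_le)
    rw [← this, weightMeasure_Ioi le_rfl]
    exact lintegral_mono_set Ioo_subset_Ioi_self
  obtain ⟨x, hx, hpos⟩ := h1
  refine ⟨x, hx, fun y hy hyx h => hpos ?_⟩
  rw [← setLIntegral_inv_rpow hv hy.le] at h
  have hm : Measurable fun s => (weightMeasure v (Iio s))⁻¹ ^ c :=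
    (measurable_measure_Iio _).inv.pow_const _
  refine measure_mono_null (Ioi_subset_Ioi hyx) ?_
  rw [lintegral_eq_zero_iff hm] at h
  rw [← Measure.restrict_eq_zero, ← Measure.restrict_univ (μ := (weightMeasure v).restrict _),
    Measure.restrict_eq_zero]
  have h0 : ∀ᵐ s ∂((weightMeasure v).restrict (Ioi y)), False := by
    filter_upwards [h, ae_restrict_mem measurableSet_Ioi] with s hs hys
    have hs0 : 0 < s := hy.trans hys
    rw [weightMeasure_Iio] at hs
    exact absurd hs (ENNReal.rpow_pos (ENNReal.inv_pos.mpr (hv.prim_ne_top s))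
      (ENNReal.inv_ne_top.mpr (hv.prim_ne_zero hs0))).ne'
  rw [ae_iff] at h0
  simpa using h0

lemma sup₁_eq_top (hp : 0 < conj p) (hq : 0 < q) (hv : IsWeight v) (hw : IsWeight w)
    (hA : ∀ x, 0 < x → prim (fun y => a y * u y) x = ∞) : sup₁ p q a u v w = ∞ := by
  obtain ⟨x, hx, hpos⟩ := hv.exists_tail_pos (conj p)
  refine top_le_iff.mp (le_trans (le_of_eq ?_) (le_iSup _ ⟨x, hx⟩))
  have : ∫⁻ t in Ioo 0 x, prim (fun y => a y * u y) t ^ q * w t = ∞ := by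
    rw [← hw.lintegral_top_mul hx]
    exact setLIntegral_congr_fun measurableSet_Ioo fun t ht => by
      rw [hA t ht.1, ENNReal.top_rpow_of_pos hq]
  simp only [this]
  rw [ENNReal.top_rpow_of_pos (one_div_pos.mpr hq), ENNReal.top_mul]
  rw [Ne, ENNReal.rpow_eq_zero_iff_of_pos (one_div_pos.mpr hp)]
  exact hpos x hx le_rfl

lemma int₁_eq_top (hp0 : 0 < p) (hp : 0 < conj p) (hq : 0 < q) (hr : 0 < rExp p q)
    (hv : IsWeight v) (hw : IsWeight w)
    (hA : ∀ x, 0 < x → prim (fun y => a y * u y) x = ∞) : int₁ p q a u v w = ∞ := by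
  obtain ⟨x, hx, hpos⟩ := hv.exists_tail_pos (conj p)
  have hin : ∀ x, 0 < x → ∫⁻ t in Ioo 0 x, prim (fun y => a y * u y) t ^ q * w t = ∞ := by
    intro x hx
    rw [← hw.lintegral_top_mul hx]
    exact setLIntegral_congr_fun measurableSet_Ioo fun t ht => by
      rw [hA t ht.1, ENNReal.top_rpow_of_pos hq]
  rw [int₁, ENNReal.rpow_eq_top_iff_of_pos (one_div_pos.mpr hr), eq_top_iff,
    ← hw.lintegral_top_mul hx]
  refine (setLIntegral_mono' measurableSet_Ioo fun y hy => ?_).trans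
    (lintegral_mono_set Ioo_subset_Ioi_self)
  refine mul_le_mul_left (le_of_eq ?_) _
  rw [hin y hy.1, hA y hy.1, ENNReal.top_rpow_of_pos hq, ENNReal.top_rpow_of_pos (div_pos hr hp0),
    ENNReal.top_mul, ENNReal.top_mul_top]
  rw [Ne, ENNReal.rpow_eq_zero_iff_of_pos (div_pos hr hp)]
  exact hpos y hy.1 hy.2.le

end Degenerate

/-! ### Assembly of the two-sided estimate -/

section Conclusion

variable {p q : ℝ}

/-- A functional that characterizes boundedness on tail averages, together with the end term,
is equivalent to the norm on non-increasing functions. -/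
lemma exists_equivWith (hp : p.HolderConjugate (conj p)) (hq : q.HolderConjugate (conj q))
    (F : (a b u v w : ℝ → ℝ≥0∞) → ℝ≥0∞) {C : ℝ≥0}
    (hF : ∀ a b u v w : ℝ → ℝ≥0∞, IsWeight a → IsWeight b → IsWeight u → IsWeight v →
      IsWeight w → IsContinuousFinite u → (∀ x, prim (fun y => a y * u y) x ≠ ∞) →
      IsBddIter p q (weightMeasure v) (weightMeasure w) (weightMeasure b)
        (weightMeasure (quotDensity a b u)) (C * F a b u v w) ∧
      ∀ M, IsBddIter p q (weightMeasure v) (weightMeasure w) (weightMeasure b)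
        (weightMeasure (quotDensity a b u)) M → F a b u v w ≤ C * M)
    (hF' : ∀ a b u v w : ℝ → ℝ≥0∞, IsWeight v → IsWeight w →
      (∀ x, 0 < x → prim (fun y => a y * u y) x = ∞) → F a b u v w = ∞) :
    ∃ K : ℝ≥0, ∀ a b u v w : ℝ → ℝ≥0∞, IsWeight a → IsWeight b → IsWeight u → IsWeight v →
      IsWeight w → IsContinuousFinite u → ∀ D : ℝ≥0, K ≤ D →
      EquivWith D (hardyNorm p q a b u v w) (F a b u v w + endTerm p q a u v w) := by
  obtain ⟨G, hG⟩ := exists_tailAvg_bdd hp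
  -- The first summand is for the upper bound, with p' from Hardy's inequality for averages. The
  -- second is for the lower bound, with G from Copson's inequality. The 1 covers the end term in
  -- both.
  refine ⟨(conj p).toNNReal * C + C * G + 1, fun a b u v w ha hb huw hv hw hu D hD => ?_⟩
  have hD' : ((conj p).toNNReal * C + C * G + 1 : ℝ≥0∞) ≤ D := by exact_mod_cast hD
  have hD1 : (1 : ℝ≥0∞) ≤ D := le_add_self.trans hD'
  by_cases hA : ∀ x, prim (fun y => a y * u y) x ≠ ∞
  · obtain ⟨hu', hl⟩ := hF a b u v w ha hb huw hv hw hu hA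
    constructor
    · refine (hardyNorm_le hp hq.lt.le ha hb huw hu hv hw hu').trans ?_
      rw [mul_add, ← mul_assoc]
      refine add_le_add (mul_le_mul_left ?_ _) ?_
      · exact le_trans (le_self_add.trans le_self_add) hD'
      · exact le_mul_of_one_le_left zero_le hD1
    · rcases eq_or_ne (hardyNorm p q a b u v w) ∞ with hN | hN
      · rw [hN, ENNReal.mul_top (zero_lt_one.trans_le hD1).ne']
        exact le_top
      · have e1 := hl _ (isBddIter_of_hardyNorm hp hG ha hb huw hu hv hw hN)
        have e2 := endTerm_le_hardyNorm (p := p) (q := q) ha hb huw hu hv hw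
        calc _ ≤ C * (G * hardyNorm p q a b u v w) + hardyNorm p q a b u v w := add_le_add e1 e2
          _ = (C * G + 1) * hardyNorm p q a b u v w := by ring
          _ ≤ _ := by
            refine mul_le_mul_left (le_trans ?_ hD') _
            rw [add_assoc]
            exact le_add_self
  -- Infinite at one point means infinite at all positive points, and then both sides of the
  -- estimate are infinite.
  · push Not at hA
    obtain ⟨x, hx⟩ := hA
    have hA' : ∀ y, 0 < y → prim (fun t => a t * u t) y = ∞ := by
      intro y hy
      by_contra h
      exact prim_mul_ne_top ha hu hy h x hx
    rw [hF' a b u v w hv hw hA', hardyNorm_eq_top hp.pos hq.pos ha hb huw hu hv hw hA', top_add]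
    have : (D : ℝ≥0∞) * ∞ = ∞ := ENNReal.mul_top (zero_lt_one.trans_le hD1).ne'
    exact ⟨this.ge, this.ge⟩

end Conclusion

end CesaroHardy

end

theorem mainTheorem5 (p q : ℝ) (hp : 1 < p) (hq : 1 < q) :
    ∃ C : ℝ≥0, 0 < C ∧ ∀ a b u v w : ℝ → ℝ≥0∞,
      IsWeight a → IsWeight b → IsWeight u → IsWeight v → IsWeight w →
      (∀ᵐ t ∂(volume.restrict (Ioi (0 : ℝ))), 0 < b t) →
      IsContinuousFinite u →
      (p ≤ q →
        EquivWith C (hardyNorm p q a b u v w)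
          (sup₁ p q a u v w + sup₂ p q a u v w + sup₃ p q a b u v w + sup₄ p q a b u v w +
            endTerm p q a u v w)) ∧
      (q < p →
        EquivWith C (hardyNorm p q a b u v w)
          (int₁ p q a u v w + int₂ p q a u v w + int₃ p q a b u v w + int₄ p q a b u v w +
            endTerm p q a u v w)) := by
  have hp' : p.HolderConjugate (conj p) := Real.HolderConjugate.conjExponent hp
  have hq' : q.HolderConjugate (conj q) := Real.HolderConjugate.conjExponent hq
  -- The constant may depend on p and q, so the case is settled before choosing it and the other
  -- implication is vacuous. Adding 1 to K only ensures positivity.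
  rcases le_or_gt p q with hpq | hqp
  · obtain ⟨C, hC⟩ := exists_isBddIter_of_le hp' hq' hpq
    obtain ⟨K, hK⟩ := exists_equivWith hp' hq' (fun a b u v w => sup₁ p q a u v w +
      sup₂ p q a u v w + sup₃ p q a b u v w + sup₄ p q a b u v w)
      (fun a b u v w ha hb huw hv hw hu hA => hC a b u v w ha hb huw hv hw hu hA _ rfl)
      (fun a b u v w hv hw hA => by
        simp [sup₁_eq_top hp'.symm.pos hq'.pos hv hw hA])
    exact ⟨K + 1, by positivity, fun a b u v w ha hb huw hv hw _ hu =>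
      ⟨fun _ => hK a b u v w ha hb huw hv hw hu _ le_self_add, fun h => absurd h hpq.not_gt⟩⟩
  · have hr : 0 < rExp p q := by
      rw [rExp, inv_pos, sub_pos]
      exact one_div_lt_one_div_of_lt hq'.pos hqp
    obtain ⟨C, hC⟩ := exists_isBddIter_of_lt hp' hq' hqp
    obtain ⟨K, hK⟩ := exists_equivWith hp' hq' (fun a b u v w => int₁ p q a u v w +
      int₂ p q a u v w + int₃ p q a b u v w + int₄ p q a b u v w)
      (fun a b u v w ha hb huw hv hw hu hA => hC a b u v w ha hb huw hv hw hu hA _ rfl)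
      (fun a b u v w hv hw hA => by
        simp [int₁_eq_top hp'.pos hp'.symm.pos hq'.pos hr hv hw hA])
    exact ⟨K + 1, by positivity, fun a b u v w ha hb huw hv hw _ hu =>
      ⟨fun h => absurd h hqp.not_ge, fun _ => hK a b u v w ha hb huw hv hw hu _ le_self_add⟩⟩
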